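/- **Rules.** Input symbols are $+,\times,\cdot,\circ$; output symbols are $\oplus,\otimes,\odot$. A rule $\sigma\to\tau$ consists of a non-empty sequence $\sigma$ of input symbols and wild-cards $?$ and a sequence $\tau$ of output symbols of the same length. Let $R$ be a finite set of rules, $\|R\|$ the maximum length of a rule, and $\overline R$ its expansion (each $?$ is replaced by the input symbols in all possible ways). Assume that every input sequence of length at least $\|R\|$ begins with the left-hand side of exactly one rule of $R$. $R$ is *correct* if for every $\sigma\to\tau$ in $\overline R$ and every position $i$: (1) if $\sigma_i\in\{\cdot,\circ\}$ and neither $\sigma_{i-1}$ nor $\sigma_{i+1}$ (if they exist) is $+$, then $\tau_i=\oplus$ or one of $\tau_{i-1},\tau_i,\tau_{i+1}$ is $\otimes$; (2) if $\tau_i=\oplus$, then $\sigma_i=\circ$. **Formulas.** Let $K\ge2$. For a rule of $\overline R$ let $\sigma\tau(x,y)$ be the number of positions with $x$ in $\sigma$ and $y$ in $\tau$ ($?$ allows any symbol), and $p_i(\sigma)=\prod_j p_i(\sigma_j)$. For $i=1,\dots,K$ let $p_i(\circ)=1-\frac iK$, $p_i(+)=\sum_{j<i}\frac1K q_j^{\circ}(\oplus)$,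 $p_i(\times)=\sum_{j<i}\frac1K q_j^{\circ}(\otimes)$, $p_i(\cdot)=\frac1K+\sum_{j<i}\frac1K q_j^{\circ}(\odot)$, where $j\ge1$ and, with sums over $\sigma\to\tau\in\overline R$, $$q_i(y)=\frac{\sum p_i(\sigma)\,\sigma\tau(?,y)}{\sum|\sigma|\,p_i(\sigma)},\qquad q_i^{\circ}(y)=\frac{\sum p_i(\sigma)\,\sigma\tau(\circ,y)}{\sum p_i(\sigma)\,\sigma\tau(\circ,?)}.$$ Let $r_{i,j}=\dfrac{\sum_{|\sigma|\ge j}p_i(\sigma)}{\sum_{|\sigma|\ge j}(|\sigma|-j+1)\,p_i(\sigma)}$ (and $0$ if the denominator is $0$): on an infinite path with independent inputs of law $p_i$, cut into rules in a stationary way, this is the probability that a vertex is the first one of a rule, given that none of the $j-1$ preceding vertices is. **Path covers.** Let $G$ be an $n$-vertex cubic graph with girth at least $g\geq 1$. A *path cover with constant $c$* is a collection of at most $\frac{3+8K}{2g}n$ vertex-disjoint directed paths in $G$, each with fewer than $\frac g{2K}$ vertices, covering all but at most $c\,n/g$ vertices, together with a grouping of the covered vertices into pairs of *mates*, adjacent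 through an edge not contained in the paths. **Procedure.** Assign to each path, uniformly and independently, a level in $\{1,\dots,K\}$. Process the levels in increasing order. On a path $P$ of level $i$, the input label of a vertex is $+,\times,\cdot$ if its mate has lower level and output label $\oplus,\otimes,\odot$ respectively; it is $\cdot$ if its mate has level $i$, and $\circ$ if its mate has higher level. Choose $\ell_0\in\{1,\dots,\|R\|\}$, with $\ell_0=\ell$ with probability $r_{i,\ell}\prod_{j<\ell}(1-r_{i,j})$; add $\|R\|-\ell_0$ auxiliary vertices before $P$ and $\|R\|$ after $P$, each labelled $x$ with probability $p_i(x)$ (given the levels, these choices are independent of each other and between paths). Starting at the first vertex (auxiliary or not), repeatedly find the rule whose left-hand side matches the input labels of the next vertices and give those vertices the right-hand side as output labels; then discard the auxiliary vertices. Let $D$ consist of the uncovered vertices, the vertices with input label $+$, those with output label $\otimes$, and the first and last vertices of all paths. **Claim.** Let $K\ge2$. (a) There is a constant $c$ depending only on $K$ such that every $n$-vertex cubic graph with girth at least $g\ge 1$ has a path cover with constant $c$. (b) Let $R$ be a correct set of rules as above, and $c$ a constant. For every $n$-vertex cubic graph $G$ with girth at least $g\ge1$ and every path cover of $G$ with constant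 $c$, the random choices above are well defined (their probabilities are non-negative and sum to $1$), $D$ is a dominating set of $G$ for every outcome, and $$\mathbb E|D|\le\frac{\sum_{i=1}^K(q_i(\oplus)+q_i(\otimes))}{K}\,n+O\!\left(\frac ng\right),$$ where the constant in $O(\cdot)$ depends only on $R$, $K$ and $c$. If moreover no rule of $\overline R$ has $\sigma_i=+$ and $\tau_i=\otimes$ for some $i$, then equality holds: $\mathbb E|D|=\frac{\sum_{i=1}^K(q_i(\oplus)+q_i(\otimes))}{K}\,n+O(n/g)$ (two-sided error bound). -/

import Mathlib

universe u

namespace CubicDomination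

/-- The input symbols `+`, `×`, `·`, `∘`. -/
inductive Input
  | plus | times | dot | circ
  deriving DecidableEq

instance : Fintype Input where
  elems := {Input.plus, Input.times, Input.dot, Input.circ}
  complete := by intro x; cases x <;> decide

/-- The output symbols `⊕`, `⊗`, `⊙`. -/
inductive Output
  | oplus | otimes | odot
  deriving DecidableEq

/-- A rule `σ → τ`, as the list of the pairs `(σ_i, τ_i)`; so both sides have the same length.
On the left-hand side `none` is the wild-card `?`. -/
abbrev Rule := List (Option Input × Output)

/-- A rule without wild-cards. -/
abbrev PlainRule := List (Input × Output)

/-- The left-hand side of the rule matches the beginning of the given input sequence. -/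
def Matches : Rule → List Input → Prop
  | [], _ => True
  | _ :: _, [] => False
  | (x, _) :: r, a :: s => (x = none ∨ x = some a) ∧ Matches r s

/-- All plain rules obtained from a rule by replacing its wild-cards by input symbols in all
possible ways. -/
def expandRule : Rule → Finset PlainRule
  | [] => {[]}
  | (some a, y) :: r => (expandRule r).image (fun e => (a, y) :: e)
  | (none, y) :: r =>
      Finset.univ.biUnion (fun a : Input => (expandRule r).image (fun e => (a, y) :: e))

/-- The expansion of a set of rules. -/
def expansion (R : Finset Rule) : Finset PlainRule := R.biUnion expandRule

/-- The maximum length `‖R‖` of a rule. -/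
def maxLength (R : Finset Rule) : ℕ := R.sup List.length

/-- The standing property of rule sets: rules are non-empty, and every sufficiently long input
sequence begins with the left-hand side of exactly one rule. -/
structure UniquelyMatching (R : Finset Rule) : Prop where
  ne_nil : ∀ r ∈ R, r ≠ []
  existsUnique : ∀ s : List Input, maxLength R ≤ s.length → ∃! r, r ∈ R ∧ Matches r s

/-- A correct set of rules. A rule with wild-cards stands for all its replacements, so the two
conditions are imposed on the rules `σ → τ` of the expansion. -/
structure Correct (R : Finset Rule) : Prop where
  /-- If `σ_i` is `·` or `∘` and no neighbouring `σ_{i±1}` is `+`, then `τ_i = ⊕` or one of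
  `τ_{i-1}`, `τ_i`, `τ_{i+1}` is `⊗`. -/
  dominated : ∀ e ∈ expansion R, ∀ (i : ℕ) (x : Input) (y : Output), e[i]? = some (x, y) →
    (x = Input.dot ∨ x = Input.circ) →
    (∀ (j : ℕ) (z : Output), (j + 1 = i ∨ j = i + 1) → e[j]? ≠ some (Input.plus, z)) →
    y = Output.oplus ∨
      ∃ (j : ℕ) (w : Input), (j + 1 = i ∨ j = i ∨ j = i + 1) ∧ e[j]? = some (w, Output.otimes)
  /-- If `τ_i` is `⊕`, then `σ_i` is `∘`. -/
  circ_of_oplus : ∀ e ∈ expansion R, ∀ (i : ℕ) (x : Input),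
    e[i]? = some (x, Output.oplus) → x = Input.circ

/-- No rule gives the output `⊗` to a vertex with input `+` (such a vertex is already chosen). -/
def NonWasteful (R : Finset Rule) : Prop :=
  ∀ e ∈ expansion R, (Input.plus, Output.otimes) ∉ e

/-! ### The recursive formulas -/

noncomputable section

/-- `στ(x, y)`: the number of positions with `x` in `σ` and `y` in `τ`, where `none` is the
wild-card. -/
def count (x : Option Input) (y : Option Output) (e : PlainRule) : ℕ :=
  e.countP (fun a => (x = none ∨ x = some a.1) ∧ (y = none ∨ y = some a.2))

/-- `p(σ) = ∏_j p(σ_j)`. -/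
def seqProb (p : Input → ℝ) (e : PlainRule) : ℝ := (e.map (fun a => p a.1)).prod

/-- `Q = ∑ |σ| p(σ)`. -/
def meanLength (R : Finset Rule) (p : Input → ℝ) : ℝ :=
  ∑ e ∈ expansion R, (e.length : ℝ) * seqProb p e

/-- `Q^∘ = ∑ στ(∘, ?) p(σ)`. -/
def meanCirc (R : Finset Rule) (p : Input → ℝ) : ℝ :=
  ∑ e ∈ expansion R, (count (some Input.circ) none e : ℝ) * seqProb p e

/-- `q(y) = ∑ (p(σ) / Q) στ(?, y)`. -/
def outputProb (R : Finset Rule) (p : Input → ℝ) (y : Output) : ℝ :=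
  ∑ e ∈ expansion R, seqProb p e / meanLength R p * (count none (some y) e : ℝ)

/-- `q^∘(y) = ∑ (p(σ) / Q^∘) στ(∘, y)`. -/
def circOutputProb (R : Finset Rule) (p : Input → ℝ) (y : Output) : ℝ :=
  ∑ e ∈ expansion R, seqProb p e / meanCirc R p * (count (some Input.circ) (some y) e : ℝ)

/-- `p_i(x)`, for the levels `i = 1, …, K`. -/
def levelInputProb (R : Finset Rule) (K : ℕ) (i : ℕ) : Input → ℝ
  | Input.circ => 1 - (i : ℝ) / K
  | Input.plus => ∑ j ∈ (Finset.Ico 1 i).attach,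
      1 / (K : ℝ) * circOutputProb R (levelInputProb R K j.1) Output.oplus
  | Input.times => ∑ j ∈ (Finset.Ico 1 i).attach,
      1 / (K : ℝ) * circOutputProb R (levelInputProb R K j.1) Output.otimes
  | Input.dot => 1 / (K : ℝ) + ∑ j ∈ (Finset.Ico 1 i).attach,
      1 / (K : ℝ) * circOutputProb R (levelInputProb R K j.1) Output.odot
termination_by i
decreasing_by all_goals exact (Finset.mem_Ico.mp j.2).2

/-- `q_i(y)`, for the levels `i = 1, …, K`. -/
def levelOutputProb (R : Finset Rule) (K i : ℕ) (y : Output) : ℝ :=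
  outputProb R (levelInputProb R K i) y

/-- `r_j`: on an infinite path with independent inputs of law `p` on which every vertex is equally
likely to be matched to the first symbol of a rule, the probability that a vertex is matched to the
first symbol of a rule, given that none of the `j - 1` preceding vertices is. In each occurrence of
a rule of length `l ≥ j`, exactly `l - j` vertices that are not first are preceded by `j - 1`
vertices that are not first, and so is the first vertex after the occurrence. -/
def startProb (R : Finset Rule) (p : Input → ℝ) (j : ℕ) : ℝ :=
  (∑ e ∈ (expansion R).filter (fun e => j ≤ e.length), seqProb p e) /
    ∑ e ∈ (expansion R).filter (fun e => j ≤ e.length),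
      ((e.length : ℝ) - (j : ℝ) + 1) * seqProb p e

/-- The probability `r_l ∏_{j < l} (1 - r_j)` that `ℓ₀ = l`. -/
def offsetProb (R : Finset Rule) (p : Input → ℝ) (l : ℕ) : ℝ :=
  startProb R p l * ∏ j ∈ Finset.Ico 1 l, (1 - startProb R p j)

/-! ### Collections of paths -/

/-- Vertex-disjoint (directed) paths in `G`, together with a grouping of all the covered vertices
into pairs of mates, adjacent through an edge that is not contained in the paths. -/
structure PathCover {V : Type u} (G : SimpleGraph V) where
  /-- the number of paths -/
  num : ℕ
  /-- the first vertex of a path -/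
  first : Fin num → V
  /-- the last vertex of a path -/
  last : Fin num → V
  walk : ∀ j, G.Walk (first j) (last j)
  isPath : ∀ j, (walk j).IsPath
  disjoint : ∀ i j v, v ∈ (walk i).support → v ∈ (walk j).support → i = j
  /-- the mate of a covered vertex (irrelevant for the other vertices) -/
  mate : V → V
  mate_covered : ∀ j v, v ∈ (walk j).support → ∃ i, mate v ∈ (walk i).support
  mate_mate : ∀ j v, v ∈ (walk j).support → mate (mate v) = v
  mate_adj : ∀ j v, v ∈ (walk j).support → G.Adj v (mate v)
  mate_edge : ∀ j v, v ∈ (walk j).support → ∀ i, s(v, mate v) ∉ (walk i).edges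

namespace PathCover

variable {V : Type u} {G : SimpleGraph V}

/-- The vertex lies on one of the paths. -/
def Covered (P : PathCover G) (v : V) : Prop := ∃ j, v ∈ (P.walk j).support

open Classical in
/-- There are at most `(3 + 8K) n / (2g)` paths, each with less than `g / (2K)` vertices, and all
but at most `c n / g` vertices are covered. -/
structure Admissible [Fintype V] (P : PathCover G) (K g : ℕ) (c : ℝ) : Prop where
  num_le : (P.num : ℝ) ≤ (3 + 8 * (K : ℝ)) / (2 * (g : ℝ)) * (Fintype.card V : ℝ)
  length_lt : ∀ j, ((P.walk j).support.length : ℝ) < (g : ℝ) / (2 * (K : ℝ))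
  uncovered_le : ((Finset.univ.filter (fun v => ¬ P.Covered v)).card : ℝ) ≤
    c * ((Fintype.card V : ℝ) / (g : ℝ))

end PathCover

/-! ### The random choices -/

/-- The random choices made for one path, where `m` is the maximum length of a rule: its level
(`i : Fin K` is the level `i + 1`); the number `ℓ₀` (`l : Fin m` is `ℓ₀ = l + 1`) with the labels of
the `m - ℓ₀` auxiliary vertices at the beginning; the labels of the `m` auxiliary vertices at the
end. -/
abbrev Choice (K m : ℕ) : Type :=
  Fin K × (Σ l : Fin m, (Fin (m - (l.1 + 1)) → Input)) × (Fin m → Input)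

/-- The level, in `{1, …, K}`. -/
def Choice.level {K m : ℕ} (a : Choice K m) : ℕ := a.1.1 + 1

/-- The number `ℓ₀`, in `{1, …, m}`. -/
def Choice.offset {K m : ℕ} (a : Choice K m) : ℕ := a.2.1.1.1 + 1

/-- The labels of the auxiliary vertices at the beginning. -/
def Choice.front {K m : ℕ} (a : Choice K m) : List Input := List.ofFn a.2.1.2

/-- The labels of the auxiliary vertices at the end. -/
def Choice.back {K m : ℕ} (a : Choice K m) : List Input := List.ofFn a.2.2

/-- The probability of the choices for one path: the level `i` is uniform; given the level, `ℓ₀`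
has the law `offsetProb` and the auxiliary labels are independent of law `p_i`. -/
def choiceProb (R : Finset Rule) (K : ℕ) (a : Choice K (maxLength R)) : ℝ :=
  1 / (K : ℝ) * offsetProb R (levelInputProb R K a.level) a.offset *
    (a.front.map (levelInputProb R K a.level)).prod *
    (a.back.map (levelInputProb R K a.level)).prod

namespace PathCover

variable {V : Type u} {G : SimpleGraph V}

/-- The outcomes of all the random choices. -/
abbrev Outcome (P : PathCover G) (K m : ℕ) : Type := Fin P.num → Choice K m

/-- The choices for different paths are independent. -/
def outcomeProb (P : PathCover G) (R : Finset Rule) (K : ℕ) (ω : P.Outcome K (maxLength R)) : ℝ :=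
  ∏ j, choiceProb R K (ω j)

end PathCover

/-! ### The labeling procedure -/

open Classical in
/-- The output symbols obtained by repeatedly applying a matching rule at the beginning of the part
of the input sequence that has no output yet, at most `n` times, until no rule matches. -/
def applyRulesAux (R : Finset Rule) : ℕ → List Input → List Output
  | 0, _ => []
  | n + 1, s =>
      if h : ∃ r, r ∈ R ∧ Matches r s then
        h.choose.map Prod.snd ++ applyRulesAux R n (s.drop h.choose.length)
      else []

/-- The output symbols obtained by applying the rules to an input sequence as long as some rule
matches. As rules are non-empty, `s.length` steps suffice. -/
def applyRules (R : Finset Rule) (s : List Input) : List Output := applyRulesAux R s.length s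

namespace PathCover

variable {V : Type u} {G : SimpleGraph V} {K m : ℕ}

open Classical in
/-- The level of a covered vertex, i.e. of its path (`0` for the other vertices). -/
def vertexLevel (P : PathCover G) (ω : P.Outcome K m) (v : V) : ℕ :=
  if h : P.Covered v then (ω h.choose).level else 0

/-- The input label of a covered vertex, where `out` gives the output labels assigned so far. -/
def inputLabel (P : PathCover G) (ω : P.Outcome K m) (out : V → Output) (v : V) : Input :=
  if P.vertexLevel ω (P.mate v) < P.vertexLevel ω v then
    match out (P.mate v) with
    | Output.oplus => Input.plus
    | Output.otimes => Input.times
    | Output.odot => Input.dot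
  else if P.vertexLevel ω (P.mate v) = P.vertexLevel ω v then Input.dot
  else Input.circ

open Classical in
/-- The output label given to the vertex `v` of the `j`-th path: pad the input labels of the path
with the auxiliary labels, apply the rules, and read off the symbol at the place of `v`. -/
def pathOutput (P : PathCover G) (R : Finset Rule) (ω : P.Outcome K m) (out : V → Output)
    (j : Fin P.num) (v : V) : Output :=
  (applyRules R ((ω j).front ++ (P.walk j).support.map (P.inputLabel ω out) ++ (ω j).back)).getD
    ((ω j).front.length + (P.walk j).support.idxOf v) Output.odot

open Classical in
/-- The output labels after the levels `1, …, t` have been processed (with `⊙` as a dummy value for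
the vertices that have none yet). -/
def outputAfter (P : PathCover G) (R : Finset Rule) (ω : P.Outcome K m) : ℕ → V → Output
  | 0 => fun _ => Output.odot
  | t + 1 => fun v =>
      if h : ∃ j, v ∈ (P.walk j).support ∧ (ω j).level = t + 1 then
        P.pathOutput R ω (outputAfter P R ω t) h.choose v
      else outputAfter P R ω t v

/-- The output label of a covered vertex at the end. -/
def finalOutput (P : PathCover G) (R : Finset Rule) (ω : P.Outcome K m) (v : V) : Output :=
  P.outputAfter R ω K v

/-- The input label of a covered vertex, determined when all lower levels have been processed. -/
def finalInput (P : PathCover G) (R : Finset Rule) (ω : P.Outcome K m) (v : V) : Input :=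
  P.inputLabel ω (P.outputAfter R ω (P.vertexLevel ω v - 1)) v

open Classical in
/-- The set produced by the procedure: the vertices not covered, those with input `+`, those with
output `⊗`, and the first and the last vertex of each path. -/
def dominatingSet [Fintype V] (P : PathCover G) (R : Finset Rule) (ω : P.Outcome K m) : Finset V :=
  Finset.univ.filter (fun v => ¬ P.Covered v ∨ P.finalInput R ω v = Input.plus ∨
    P.finalOutput R ω v = Output.otimes ∨ ∃ j, v = P.first j ∨ v = P.last j)

/-- The expected size of the set produced by the procedure. -/
def expectedSize [Fintype V] (P : PathCover G) (R : Finset Rule) (K : ℕ) : ℝ :=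
  ∑ ω : P.Outcome K (maxLength R), P.outcomeProb R K ω * ((P.dominatingSet R ω).card : ℝ)

end PathCover

/-- Every vertex is in `D` or has a neighbour in `D`. -/
def IsDominating {V : Type u} (G : SimpleGraph V) (D : Finset V) : Prop :=
  ∀ v, v ∈ D ∨ ∃ w ∈ D, G.Adj v w

/-- The coefficient `(∑_{i=1}^K (q_i(⊕) + q_i(⊗))) / K`. -/
def density (R : Finset Rule) (K : ℕ) : ℝ :=
  (∑ i ∈ Finset.Icc 1 K,
    (levelOutputProb R K i Output.oplus + levelOutputProb R K i Output.otimes)) / (K : ℝ)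

end

end CubicDomination

open CubicDomination

/-! Part (b) rests on the fact that, on a path of level i, the input labels are independent of each
other and of the choices made for that path, each with law p_i. The label of a vertex v is a
function of the choices for the paths that are reached from v by alternately crossing an edge
between mates and running along a path, with strictly decreasing levels (`localInput`,
`dependsOn_localInput`). If two vertices of a path reached a common path, or one of them reached its
own path, these routes would close up to a non-backtracking closed walk with fewer than g edges,
which the girth forbids (`disjoint_reachSet`, `notMem_reachSet`). The law is found by induction on
the level (`expectation_localInput`).

For independent inputs the random offset makes the parse exactly stationary: ℓ₀ = l has probability
P(rule length ≥ l) / (mean length) (`offsetProb_eq`), and a telescoped renewal equation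
(`sum_Ico_parseExp`) then gives the pair of labels at every vertex of a path the law described by
the formulas for q, with no boundary error (`stationary_letterValue`). Hence a covered vertex is
chosen because of its labels with probability the mean over i of p_i(+) + q_i(⊗), minus the
probability of having both + and ⊗. As ⊕ is only given to inputs ∘, and is then read as + by the
mate, the means of p_i(+) and q_i(⊕) agree (`sum_levelInputProb_plus`). Uncovered vertices and ends
of paths cost O(n/g). Domination holds for each outcome separately (`isDominating`).

For part (a), Tutte's theorem is applied to G with a few universal vertices added. An odd component
joined to the deleted set by a single edge contains a cycle, hence has at least g vertices, so a
matching missing at most 2n/(3g) vertices exists (`exists_near_perfect_matching`). The other edges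
between matched vertices form a graph of maximum degree two. In a partition of it into as few short
paths as possible, two paths with adjacent ends are together too long to be merged, which bounds the
number of paths (`PathPartition.two_mul_card_le`). -/

namespace CubicDomination

noncomputable section

/-! ### Plain rules as a complete prefix code -/

/-- The left-hand side of a plain rule. -/
def lhs (e : PlainRule) : List Input := e.map Prod.fst

@[simp] theorem length_lhs (e : PlainRule) : (lhs e).length = e.length := by simp [lhs]

theorem length_of_mem_expandRule {r : Rule} :
    ∀ {e : PlainRule}, e ∈ expandRule r → e.length = r.length := by
  induction r with
  | nil => intro e he; simp_all [expandRule]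
  | cons a r ih =>
    intro e he
    obtain ⟨_ | a, y⟩ := a
    · simp only [expandRule, Finset.mem_biUnion, Finset.mem_univ, true_and, Finset.mem_image] at he
      obtain ⟨a, e, he, rfl⟩ := he
      simp [ih he]
    · simp only [expandRule, Finset.mem_image] at he
      obtain ⟨e, he, rfl⟩ := he
      simp [ih he]

theorem map_snd_of_mem_expandRule {r : Rule} :
    ∀ {e : PlainRule}, e ∈ expandRule r → e.map Prod.snd = r.map Prod.snd := by
  induction r with
  | nil => intro e he; simp_all [expandRule]
  | cons a r ih =>
    intro e he
    obtain ⟨_ | a, y⟩ := a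
    · simp only [expandRule, Finset.mem_biUnion, Finset.mem_univ, true_and, Finset.mem_image] at he
      obtain ⟨a, e, he, rfl⟩ := he
      simp [ih he]
    · simp only [expandRule, Finset.mem_image] at he
      obtain ⟨e, he, rfl⟩ := he
      simp [ih he]

/-- Eliminates the wild-cards: from here on a match is a prefix relation with an element of the
expansion. -/
theorem matches_iff {r : Rule} :
    ∀ {s : List Input}, Matches r s ↔ ∃ e ∈ expandRule r, lhs e <+: s := by
  induction r with
  | nil => intro s; simp [Matches, expandRule, lhs]
  | cons a r ih =>
    intro s
    obtain ⟨x, y⟩ := a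
    rcases s with _ | ⟨b, s⟩
    · simp only [Matches, false_iff, not_exists, not_and]
      intro e he h
      have h1 := length_of_mem_expandRule he
      have h2 := h.length_le
      simp only [length_lhs, List.length_cons, List.length_nil] at h1 h2
      omega
    · rcases x with _ | x
      · simp only [Matches, true_or, true_and, expandRule, Finset.mem_biUnion, Finset.mem_univ,
          Finset.mem_image, ih]
        constructor
        · rintro ⟨e, he, h⟩
          exact ⟨(b, y) :: e, ⟨b, e, he, rfl⟩, by simpa [lhs] using h⟩
        · rintro ⟨_, ⟨c, e, he, rfl⟩, h⟩
          exact ⟨e, he, by simpa [lhs] using (List.cons_prefix_cons.1 h).2⟩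
      · simp only [Matches, reduceCtorEq, false_or, Option.some.injEq, expandRule,
          Finset.mem_image, ih]
        constructor
        · rintro ⟨rfl, e, he, h⟩
          exact ⟨(x, y) :: e, ⟨e, he, rfl⟩, by simpa [lhs] using h⟩
        · rintro ⟨_, ⟨e, he, rfl⟩, h⟩
          exact ⟨(List.cons_prefix_cons.1 h).1, e, he,
            by simpa [lhs] using (List.cons_prefix_cons.1 h).2⟩

theorem plainRule_ext {e e' : PlainRule} (h1 : e.map Prod.fst = e'.map Prod.fst)
    (h2 : e.map Prod.snd = e'.map Prod.snd) : e = e' := by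
  rw [← List.zip_unzip e, ← List.zip_unzip e', List.unzip_eq_map, List.unzip_eq_map, h1, h2]

variable {R : Finset Rule}

theorem length_le_maxLength {e : PlainRule} (he : e ∈ expansion R) : e.length ≤ maxLength R := by
  obtain ⟨r, hr, he⟩ := Finset.mem_biUnion.1 he
  rw [length_of_mem_expandRule he]
  exact Finset.le_sup (f := List.length) hr

theorem UniquelyMatching.length_pos (hR : UniquelyMatching R) {e : PlainRule}
    (he : e ∈ expansion R) : 0 < e.length := by
  obtain ⟨r, hr, he⟩ := Finset.mem_biUnion.1 he
  rw [length_of_mem_expandRule he]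
  exact List.length_pos_iff.2 (hR.ne_nil r hr)

/-- The expansion is a complete prefix code. Two matching plain rules come from the same rule, so
they have equal lengths; as prefixes of `s` their left-hand sides then agree, and their right-hand
sides are that of the rule. -/
theorem UniquelyMatching.existsUnique_prefix (hR : UniquelyMatching R) {s : List Input}
    (hs : maxLength R ≤ s.length) : ∃! e, e ∈ expansion R ∧ lhs e <+: s := by
  obtain ⟨r, ⟨hr, hm⟩, huniq⟩ := hR.existsUnique s hs
  obtain ⟨e, he, hp⟩ := matches_iff.1 hm
  refine ⟨e, ⟨Finset.mem_biUnion.2 ⟨r, hr, he⟩, hp⟩, ?_⟩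
  rintro e' ⟨he', hp'⟩
  obtain ⟨r', hr', he'⟩ := Finset.mem_biUnion.1 he'
  obtain rfl := huniq r' ⟨hr', matches_iff.2 ⟨e', he', hp'⟩⟩
  have hl : e'.length = e.length := by
    rw [length_of_mem_expandRule he, length_of_mem_expandRule he']
  refine plainRule_ext ?_ ?_
  · exact (List.prefix_of_prefix_length_le hp' hp (by simp [hl])).eq_of_length (by simp [hl])
  · rw [map_snd_of_mem_expandRule he, map_snd_of_mem_expandRule he']

/-! ### Applying the rules -/

theorem applyRulesAux_nil (hR : UniquelyMatching R) (n : ℕ) : applyRulesAux R n [] = [] := by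
  cases n with
  | zero => rfl
  | succ n =>
    rw [applyRulesAux, dif_neg]
    rintro ⟨r, hr, hm⟩
    cases r with
    | nil => exact hR.ne_nil _ hr rfl
    | cons a r => exact hm

/-- Each step consumes at least one symbol because rules are non-empty, so the step bound is
immaterial once it reaches the length. -/
theorem applyRulesAux_eq_applyRules (hR : UniquelyMatching R) :
    ∀ (n : ℕ) (s : List Input), s.length ≤ n → applyRulesAux R n s = applyRules R s := by
  have key : ∀ (n n' : ℕ) (s : List Input), s.length ≤ n → s.length ≤ n' →
      applyRulesAux R n s = applyRulesAux R n' s := by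
    intro n
    induction n with
    | zero =>
      intro n' s h _
      obtain rfl := List.length_eq_zero_iff.1 (Nat.le_zero.1 h)
      rw [applyRulesAux_nil hR, applyRulesAux_nil hR]
    | succ n ih =>
      intro n' s h h'
      cases n' with
      | zero =>
        obtain rfl := List.length_eq_zero_iff.1 (Nat.le_zero.1 h')
        rw [applyRulesAux_nil hR, applyRulesAux_nil hR]
      | succ n' =>
        rw [applyRulesAux, applyRulesAux]
        split_ifs with hm
        · have hpos : 0 < hm.choose.length :=
            List.length_pos_iff.2 (hR.ne_nil _ hm.choose_spec.1)
          rw [ih n' (s.drop hm.choose.length)]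
          · rw [List.length_drop]; omega
          · rw [List.length_drop]; omega
        · rfl
  intro n s h
  exact key n s.length s h le_rfl

/-- The length hypothesis makes the matching rule unique, so the arbitrary choice in `applyRulesAux`
is forced. Shorter remainders may match no rule, which is why later statements keep `maxLength R`
symbols in reserve. -/
theorem applyRules_append (hR : UniquelyMatching R) {e : PlainRule} (he : e ∈ expansion R)
    {s : List Input} (hs : maxLength R ≤ (lhs e ++ s).length) :
    applyRules R (lhs e ++ s) = e.map Prod.snd ++ applyRules R s := by
  obtain ⟨r, hr, her⟩ := Finset.mem_biUnion.1 he
  have hm : ∃ r, r ∈ R ∧ Matches r (lhs e ++ s) :=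
    ⟨r, hr, matches_iff.2 ⟨e, her, List.prefix_append _ _⟩⟩
  have hc : hm.choose = r := (hR.existsUnique _ hs).unique hm.choose_spec
    ⟨hr, matches_iff.2 ⟨e, her, List.prefix_append _ _⟩⟩
  have hlen := length_of_mem_expandRule her
  rw [← applyRulesAux_eq_applyRules hR _ _ (Nat.le_succ _), applyRulesAux, dif_pos hm, hc,
    ← map_snd_of_mem_expandRule her, applyRulesAux_eq_applyRules hR, ← hlen]
  · congr 2
    rw [List.drop_append_of_le_length (by simp), List.drop_eq_nil_of_le (by simp), List.nil_append]
  · rw [List.length_drop]; omega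

/-- Every position followed by sufficiently many symbols lies in an occurrence of a rule. -/
theorem exists_occurrence (hR : UniquelyMatching R) :
    ∀ (k : ℕ) (s : List Input), k + maxLength R ≤ s.length →
      ∃ e ∈ expansion R, ∃ k₀ i, k = k₀ + i ∧ i < e.length ∧
        ∀ (j : ℕ) (a : Input × Output), e[j]? = some a →
          s[k₀ + j]? = some a.1 ∧ (applyRules R s)[k₀ + j]? = some a.2 := by
  intro k
  induction k using Nat.strong_induction_on with
  | _ k ih =>
    intro s hs
    obtain ⟨e, ⟨he, t, rfl⟩, -⟩ := hR.existsUnique_prefix (s := s) (by omega)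
    have happ := applyRules_append hR he (s := t) (by omega)
    by_cases hk : k < e.length
    · refine ⟨e, he, 0, k, by omega, hk, fun j a hj => ?_⟩
      have hjl : j < e.length := (List.getElem?_eq_some_iff.1 hj).1
      rw [happ, Nat.zero_add, List.getElem?_append_left (by simpa), lhs,
        List.getElem?_append_left (by simpa), List.getElem?_map, List.getElem?_map, hj]
      simp
    · have hpos := hR.length_pos he
      have hlen : (lhs e ++ t).length = e.length + t.length := by simp
      obtain ⟨e', he', k₀, i, hki, hi, h⟩ := ih (k - e.length) (by omega) t (by omega)
      refine ⟨e', he', e.length + k₀, i, by omega, hi, fun j a hj => ?_⟩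
      have := h j a hj
      rw [happ, List.getElem?_append_right (by simp; omega),
        List.getElem?_append_right (by simp; omega)]
      simpa [show e.length + k₀ + j - e.length = k₀ + j by omega] using this

/-! ### Words with independent letters -/

/-- The expectation of `f` on a word of length `n` with independent letters of law `p`. -/
def wordExp (p : Input → ℝ) : ℕ → (List Input → ℝ) → ℝ
  | 0, f => f []
  | n + 1, f => ∑ a, p a * wordExp p n (fun s => f (a :: s))

variable {p : Input → ℝ}

theorem wordExp_congr {n : ℕ} : ∀ {f g : List Input → ℝ}, (∀ s, s.length = n → f s = g s) →
    wordExp p n f = wordExp p n g := by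
  induction n with
  | zero => intro f g h; exact h [] rfl
  | succ n ih =>
    intro f g h
    simp only [wordExp]
    refine Finset.sum_congr rfl fun a _ => ?_
    rw [ih fun s hs => h (a :: s) (by simp [hs])]

theorem wordExp_sum {ι : Type*} (t : Finset ι) {n : ℕ} : ∀ (f : ι → List Input → ℝ),
    wordExp p n (fun s => ∑ i ∈ t, f i s) = ∑ i ∈ t, wordExp p n (f i) := by
  induction n with
  | zero => intro f; rfl
  | succ n ih =>
    intro f
    simp only [wordExp, ih, Finset.mul_sum]
    rw [Finset.sum_comm]

theorem wordExp_const_mul (c : ℝ) {n : ℕ} : ∀ (f : List Input → ℝ),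
    wordExp p n (fun s => c * f s) = c * wordExp p n f := by
  induction n with
  | zero => intro f; rfl
  | succ n ih =>
    intro f
    simp only [wordExp, ih, Finset.mul_sum]
    exact Finset.sum_congr rfl fun _ _ => by ring

theorem wordExp_const (hp : ∑ a, p a = 1) (n : ℕ) (c : ℝ) : wordExp p n (fun _ => c) = c := by
  induction n with
  | zero => rfl
  | succ n ih => simp only [wordExp, ih, ← Finset.sum_mul, hp, one_mul]

theorem wordExp_add (m n : ℕ) : ∀ (f : List Input → ℝ),
    wordExp p (m + n) f = wordExp p m (fun s => wordExp p n (fun t => f (s ++ t))) := by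
  induction m with
  | zero => intro f; simp [wordExp]
  | succ m ih =>
    intro f
    rw [Nat.succ_add]
    simp only [wordExp, ih, List.cons_append]

theorem wordExp_ofFn (n : ℕ) : ∀ (f : List Input → ℝ),
    ∑ s : Fin n → Input, ((List.ofFn s).map p).prod * f (List.ofFn s) = wordExp p n f := by
  induction n with
  | zero => intro f; simp [wordExp]
  | succ n ih =>
    intro f
    rw [← (Fin.consEquiv (fun _ => Input)).sum_comp, Fintype.sum_prod_type]
    simp only [wordExp, ← ih, Finset.mul_sum]
    refine Finset.sum_congr rfl fun a _ => Finset.sum_congr rfl fun s _ => ?_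
    simp [Fin.consEquiv, List.ofFn_succ, mul_assoc]

theorem wordExp_getD (hp : ∑ a, p a = 1) (φ : Input → ℝ) (d : Input) {n : ℕ} :
    ∀ {k : ℕ}, k < n → wordExp p n (fun s => φ (s.getD k d)) = ∑ a, p a * φ a := by
  induction n with
  | zero => intro k h; omega
  | succ n ih =>
    intro k h
    cases k with
    | zero => simp [wordExp, wordExp_const hp]
    | succ k =>
      simp only [wordExp, List.getD_cons_succ, ih (Nat.lt_of_succ_lt_succ h), ← Finset.sum_mul, hp,
        one_mul]

open Classical in
theorem wordExp_prefix (e : PlainRule) : ∀ {n : ℕ}, e.length ≤ n → ∀ (f : List Input → ℝ),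
    wordExp p n (fun s => if lhs e <+: s then f s else 0) =
      seqProb p e * wordExp p (n - e.length) (fun s => f (lhs e ++ s)) := by
  induction e with
  | nil => intro n _ f; simp [lhs, seqProb]
  | cons a e ih =>
    intro n hn f
    cases n with
    | zero => simp at hn
    | succ n =>
      simp only [List.length_cons, Nat.add_le_add_iff_right] at hn
      rw [wordExp, Finset.sum_eq_single a.1]
      · have h := ih hn (fun s => f (a.1 :: s))
        simp only [lhs, List.map_cons, List.cons_prefix_cons, true_and, List.cons_append, seqProb,
          List.prod_cons, List.length_cons, Nat.add_sub_add_right] at h ⊢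
        rw [mul_assoc, ← h]
        congr!
      · intro b _ hb
        have hne : ¬ a.1 = b := fun h => hb h.symm
        have : wordExp p n (fun s => if lhs (a :: e) <+: b :: s then f (b :: s) else 0) =
            wordExp p n (fun s => 0 * f s) := by
          congr 1
          funext s
          simp [lhs, List.cons_prefix_cons, hne]
        rw [this, wordExp_const_mul, zero_mul, mul_zero]
      · simp

open Classical in
-- Conditioning on the first rule of the parse: it is `e` with probability `seqProb p e`, and the
-- letters after it are again independent of law `p`.
theorem wordExp_eq_sum_expansion (hR : UniquelyMatching R) {n : ℕ} (hn : maxLength R ≤ n)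
    (f : List Input → ℝ) : wordExp p n f = ∑ e ∈ expansion R,
      seqProb p e * wordExp p (n - e.length) (fun s => f (lhs e ++ s)) := by
  have h1 : wordExp p n f =
      wordExp p n (fun s => ∑ e ∈ expansion R, if lhs e <+: s then f s else 0) := by
    refine wordExp_congr fun s hs => ?_
    obtain ⟨e, ⟨he, hp⟩, huniq⟩ := hR.existsUnique_prefix (s := s) (by omega)
    rw [Finset.sum_eq_single_of_mem e he, if_pos hp]
    intro e' he' hne
    rw [if_neg fun h => hne (huniq e' ⟨he', h⟩)]
  rw [h1, wordExp_sum]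
  exact Finset.sum_congr rfl fun e he => wordExp_prefix e ((length_le_maxLength he).trans hn) f

theorem sum_seqProb (hR : UniquelyMatching R) (hp : ∑ a, p a = 1) :
    ∑ e ∈ expansion R, seqProb p e = 1 := by
  have h := wordExp_eq_sum_expansion (p := p) hR le_rfl (fun _ => 1)
  simpa [wordExp_const hp] using h.symm

theorem seqProb_nonneg (hp : ∀ a, 0 ≤ p a) (e : PlainRule) : 0 ≤ seqProb p e := by
  refine List.prod_nonneg fun x hx => ?_
  obtain ⟨a, -, rfl⟩ := List.mem_map.1 hx
  exact hp _

end

end CubicDomination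

namespace CubicDomination

noncomputable section

variable {R : Finset Rule} {p : Input → ℝ}

/-! ### The law of the outputs in a stationary parse -/

/-- The value of `φ` at the input and output symbols at the position `k` of a word. -/
def letterValue (R : Finset Rule) (φ : Input × Output → ℝ) (k : ℕ) (s : List Input) : ℝ :=
  φ (s.getD k Input.dot, (applyRules R s).getD k Output.odot)

/-- The expected value of `φ` at the position `k` when the parse starts at the position `0`. -/
def parseExp (R : Finset Rule) (p : Input → ℝ) (φ : Input × Output → ℝ) (k : ℕ) : ℝ :=
  wordExp p (k + maxLength R) (letterValue R φ k)

theorem letterValue_append_left (hR : UniquelyMatching R) (φ : Input × Output → ℝ)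
    {e : PlainRule} (he : e ∈ expansion R) {s : List Input} (hs : maxLength R ≤ (lhs e ++ s).length)
    {k : ℕ} (hk : k < e.length) : letterValue R φ k (lhs e ++ s) = (e.map φ).getD k 0 := by
  rw [letterValue, applyRules_append hR he hs, List.getD_append _ _ _ _ (by simpa),
    List.getD_append _ _ _ _ (by simpa)]
  simp [List.getD_eq_getElem?_getD, lhs, List.getElem?_eq_getElem hk]

theorem letterValue_append_right (hR : UniquelyMatching R) (φ : Input × Output → ℝ)
    {e : PlainRule} (he : e ∈ expansion R) {s : List Input} (hs : maxLength R ≤ (lhs e ++ s).length)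
    {k : ℕ} (hk : e.length ≤ k) :
    letterValue R φ k (lhs e ++ s) = letterValue R φ (k - e.length) s := by
  rw [letterValue, applyRules_append hR he hs, List.getD_append_right _ _ _ _ (by simpa),
    List.getD_append_right _ _ _ _ (by simpa)]
  simp [letterValue]

theorem wordExp_letterValue (hR : UniquelyMatching R) (hp : ∑ a, p a = 1)
    (φ : Input × Output → ℝ) {n k : ℕ} (hn : k + maxLength R ≤ n) :
    wordExp p n (letterValue R φ k) = ∑ e ∈ expansion R, seqProb p e *
      if k < e.length then (e.map φ).getD k 0
      else wordExp p (n - e.length) (letterValue R φ (k - e.length)) := by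
  rw [wordExp_eq_sum_expansion hR (by omega)]
  refine Finset.sum_congr rfl fun e he => ?_
  have hle := length_le_maxLength he
  congr 1
  split_ifs with hk
  · rw [← wordExp_const (p := p) hp (n - e.length) ((e.map φ).getD k 0)]
    exact wordExp_congr fun s hs => letterValue_append_left hR φ he (by simp; omega) hk
  · exact wordExp_congr fun s hs =>
      letterValue_append_right hR φ he (by simp; omega) (not_lt.1 hk)

/-- Letters beyond the `maxLength R` reserved ones cannot influence the rule that contains the
position `k`. -/
theorem wordExp_letterValue_eq_parseExp (hR : UniquelyMatching R) (hp : ∑ a, p a = 1)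
    (φ : Input × Output → ℝ) : ∀ (k n : ℕ), k + maxLength R ≤ n →
      wordExp p n (letterValue R φ k) = parseExp R p φ k := by
  intro k
  induction k using Nat.strong_induction_on with
  | _ k ih =>
    intro n hn
    rw [parseExp, wordExp_letterValue hR hp φ hn, wordExp_letterValue hR hp φ le_rfl]
    refine Finset.sum_congr rfl fun e he => ?_
    have hpos := hR.length_pos he
    congr 1
    split_ifs with hk
    · rfl
    · rw [ih (k - e.length) (by omega) _ (by omega), ih (k - e.length) (by omega) _ (by omega)]

/-- The renewal equation: either the first rule contains the position, or the parse restarts after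
it. -/
theorem parseExp_eq (hR : UniquelyMatching R) (hp : ∑ a, p a = 1)
    (φ : Input × Output → ℝ) (k : ℕ) :
    parseExp R p φ k = ∑ e ∈ expansion R, seqProb p e *
      if k < e.length then (e.map φ).getD k 0 else parseExp R p φ (k - e.length) := by
  rw [parseExp, wordExp_letterValue hR hp φ le_rfl]
  refine Finset.sum_congr rfl fun e he => ?_
  congr 1
  split_ifs with hk
  · rfl
  · exact wordExp_letterValue_eq_parseExp hR hp φ _ _ (by omega)

/-- The renewal equation summed over the positions. From `k` to `k + 1` the value at `k` enters
every window and the value at `k - e.length` leaves it, unless the window is still truncated at 0;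
by `parseExp_eq` the weighted change is exactly the new term on the right. -/
theorem sum_Ico_parseExp (hR : UniquelyMatching R) (hp : ∑ a, p a = 1)
    (φ : Input × Output → ℝ) (k : ℕ) :
    ∑ e ∈ expansion R, seqProb p e * ∑ j ∈ Finset.Ico (k - e.length) k, parseExp R p φ j =
      ∑ e ∈ expansion R, seqProb p e * ∑ i ∈ Finset.range k, (e.map φ).getD i 0 := by
  induction k with
  | zero => simp
  | succ k ih =>
    have h1 : ∀ e ∈ expansion R,
        seqProb p e * ∑ j ∈ Finset.Ico (k + 1 - e.length) (k + 1), parseExp R p φ j =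
        seqProb p e * ∑ j ∈ Finset.Ico (k - e.length) k, parseExp R p φ j +
          (seqProb p e * parseExp R p φ k -
          (seqProb p e * if k < e.length then (e.map φ).getD k 0
            else parseExp R p φ (k - e.length)) + seqProb p e * (e.map φ).getD k 0) := by
      intro e he
      have hpos := hR.length_pos he
      split_ifs with hk
      · rw [show k + 1 - e.length = 0 by omega, show k - e.length = 0 by omega,
          ← Finset.range_eq_Ico, Finset.sum_range_succ]
        simp only [Finset.range_eq_Ico]
        ring
      · rw [Finset.sum_Ico_succ_top (by omega), Finset.sum_eq_sum_Ico_succ_bot (a := k - e.length)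
          (by omega), show k + 1 - e.length = k - e.length + 1 by omega,
          List.getD_eq_default _ _ (by simpa using hk)]
        ring
    rw [Finset.sum_congr rfl h1, Finset.sum_add_distrib, Finset.sum_add_distrib,
      Finset.sum_sub_distrib, ← parseExp_eq hR hp, ← Finset.sum_mul, sum_seqProb hR hp, one_mul,
      sub_self, zero_add, ih, ← Finset.sum_add_distrib]
    refine Finset.sum_congr rfl fun e _ => ?_
    rw [Finset.sum_range_succ, mul_add]

/-! ### The law of the offset ℓ₀ and stationarity of the parse -/

/-- The probability that the first rule has length at least `l`. -/
def tailProb (R : Finset Rule) (p : Input → ℝ) (l : ℕ) : ℝ :=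
  ∑ e ∈ (expansion R).filter (fun e => l ≤ e.length), seqProb p e

theorem tailProb_nonneg (hp : ∀ a, 0 ≤ p a) (l : ℕ) : 0 ≤ tailProb R p l :=
  Finset.sum_nonneg fun e _ => seqProb_nonneg hp e

theorem sum_length_sub (l : ℕ) :
    ∑ e ∈ (expansion R).filter (fun e => l ≤ e.length),
      ((e.length : ℝ) - (l : ℝ) + 1) * seqProb p e =
    ∑ e ∈ expansion R, ((e.length + 1 - l : ℕ) : ℝ) * seqProb p e := by
  rw [Finset.sum_filter]
  refine Finset.sum_congr rfl fun e _ => ?_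
  split_ifs with h
  · rw [Nat.cast_sub (by omega)]; push_cast; ring
  · rw [Nat.sub_eq_zero_of_le (by omega)]; simp

theorem meanLength_pos (hR : UniquelyMatching R) (hp : ∑ a, p a = 1) (hp0 : ∀ a, 0 ≤ p a) :
    0 < meanLength R p := by
  refine one_pos.trans_le ?_
  rw [← sum_seqProb hR hp, meanLength]
  refine Finset.sum_le_sum fun e he => ?_
  have : (1 : ℝ) ≤ e.length := by exact_mod_cast hR.length_pos he
  nlinarith [seqProb_nonneg hp0 e]

theorem sum_sub_add_tailProb (l : ℕ) :
    ∑ e ∈ expansion R, ((e.length + 1 - (l + 1) : ℕ) : ℝ) * seqProb p e + tailProb R p l =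
    ∑ e ∈ expansion R, ((e.length + 1 - l : ℕ) : ℝ) * seqProb p e := by
  rw [tailProb, Finset.sum_filter, ← Finset.sum_add_distrib]
  refine Finset.sum_congr rfl fun e _ => ?_
  split_ifs with h
  · rw [show e.length + 1 - l = e.length + 1 - (l + 1) + 1 by omega]; push_cast; ring
  · rw [Nat.sub_eq_zero_of_le (by omega : e.length + 1 ≤ l + 1),
      Nat.sub_eq_zero_of_le (by omega : e.length + 1 ≤ l)]; simp

/-- Let N_j be the sum of max(|σ| + 1 - j, 0) p(σ), the maximum being supplied by truncated
subtraction. Then 1 - r_j = N_{j+1} / N_j, and the product telescopes from N_1, the mean length. -/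
theorem prod_one_sub_startProb (hp0 : ∀ a, 0 ≤ p a) (l : ℕ) :
    (∏ j ∈ Finset.Ico 1 (l + 1), (1 - startProb R p j)) * meanLength R p =
      ∑ e ∈ expansion R, ((e.length + 1 - (l + 1) : ℕ) : ℝ) * seqProb p e := by
  induction l with
  | zero => simp [meanLength]
  | succ l ih =>
    rw [Finset.prod_Ico_succ_top (by omega), mul_right_comm, ih, startProb, sum_length_sub]
    have h := sum_sub_add_tailProb (R := R) (p := p) (l + 1)
    rw [← tailProb]
    -- If the denominator N_{l+1} is zero, then so is N_{l+2}, since both it and the difference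
    -- `tailProb` are non-negative.
    by_cases h0 : ∑ e ∈ expansion R, ((e.length + 1 - (l + 1) : ℕ) : ℝ) * seqProb p e = 0
    · rw [h0, zero_mul]
      have h1 : 0 ≤ ∑ e ∈ expansion R, ((e.length + 1 - (l + 1 + 1) : ℕ) : ℝ) * seqProb p e :=
        Finset.sum_nonneg fun e _ => mul_nonneg (Nat.cast_nonneg _) (seqProb_nonneg hp0 e)
      linarith [tailProb_nonneg (R := R) hp0 (l + 1)]
    · rw [mul_sub, mul_div_cancel₀ _ h0]; linarith

/-- This is the law of the distance from a vertex to the next later start of a rule in a stationary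
parse. -/
theorem offsetProb_eq (hR : UniquelyMatching R) (hp : ∑ a, p a = 1)
    (hp0 : ∀ a, 0 ≤ p a) (l : ℕ) :
    offsetProb R p (l + 1) = tailProb R p (l + 1) / meanLength R p := by
  have hQ := meanLength_pos hR hp hp0
  rw [eq_div_iff hQ.ne', offsetProb, mul_assoc, prod_one_sub_startProb hp0, startProb,
    sum_length_sub, ← tailProb]
  by_cases h0 : ∑ e ∈ expansion R, ((e.length + 1 - (l + 1) : ℕ) : ℝ) * seqProb p e = 0
  · rw [h0, mul_zero]
    have h := sum_sub_add_tailProb (R := R) (p := p) (l + 1)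
    have h1 : 0 ≤ ∑ e ∈ expansion R, ((e.length + 1 - (l + 1 + 1) : ℕ) : ℝ) * seqProb p e :=
      Finset.sum_nonneg fun e _ => mul_nonneg (Nat.cast_nonneg _) (seqProb_nonneg hp0 e)
    linarith [tailProb_nonneg (R := R) hp0 (l + 1)]
  · exact div_mul_cancel₀ _ h0

theorem offsetProb_nonneg (hR : UniquelyMatching R) (hp : ∑ a, p a = 1)
    (hp0 : ∀ a, 0 ≤ p a) (l : ℕ) : 0 ≤ offsetProb R p (l + 1) := by
  rw [offsetProb_eq hR hp hp0]
  exact div_nonneg (tailProb_nonneg hp0 _) (meanLength_pos hR hp hp0).le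

theorem sum_tailProb_mul (f : ℕ → ℝ) :
    ∑ l ∈ Finset.range (maxLength R), tailProb R p (l + 1) * f l =
      ∑ e ∈ expansion R, seqProb p e * ∑ l ∈ Finset.range e.length, f l := by
  simp only [tailProb, Finset.sum_filter, Finset.sum_mul, Finset.mul_sum]
  rw [Finset.sum_comm]
  refine Finset.sum_congr rfl fun e he => ?_
  have hsub : Finset.range e.length ⊆ Finset.range (maxLength R) :=
    Finset.range_subset_range.2 (length_le_maxLength he)
  rw [← Finset.sum_subset hsub]
  · refine Finset.sum_congr rfl fun l hl => ?_
    rw [if_pos (Nat.succ_le_of_lt (Finset.mem_range.1 hl))]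
  · intro l _ hl
    rw [if_neg (by have := Finset.mem_range.not.1 hl; omega), zero_mul]

theorem sum_offsetProb (hR : UniquelyMatching R) (hp : ∑ a, p a = 1) (hp0 : ∀ a, 0 ≤ p a) :
    ∑ l : Fin (maxLength R), offsetProb R p (l.1 + 1) = 1 := by
  have hQ := meanLength_pos hR hp hp0
  have h := sum_tailProb_mul (R := R) (p := p) (fun _ => 1)
  rw [Fin.sum_univ_eq_sum_range (fun l => offsetProb R p (l + 1)),
    Finset.sum_congr rfl fun l _ => offsetProb_eq hR hp hp0 l, ← Finset.sum_div,
    div_eq_one_iff_eq hQ.ne']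
  simp only [mul_one, Finset.sum_const, Finset.card_range, nsmul_eq_mul] at h
  rw [h, meanLength]
  exact Finset.sum_congr rfl fun _ _ => mul_comm _ _

theorem sum_range_getD {l : List ℝ} : ∀ {n : ℕ}, l.length ≤ n →
    ∑ i ∈ Finset.range n, l.getD i 0 = l.sum := by
  induction l with
  | nil => intro n _; simp
  | cons a l ih =>
    intro n hn
    cases n with
    | zero => simp at hn
    | succ n =>
      rw [Finset.sum_range_succ', List.sum_cons, add_comm]
      simp only [List.getD_cons_succ, List.getD_cons_zero]
      rw [ih (by simpa using hn)]

/-- In a padded word, the law of the input and output symbols at a position of the middle part is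
the stationary one. -/
theorem stationary_letterValue (hR : UniquelyMatching R) (hp : ∑ a, p a = 1)
    (hp0 : ∀ a, 0 ≤ p a) (φ : Input × Output → ℝ) {L k : ℕ} (hk : k < L) :
    ∑ l : Fin (maxLength R), offsetProb R p (l.1 + 1) *
      wordExp p (maxLength R - (l.1 + 1)) (fun s₁ => wordExp p L (fun s₂ =>
        wordExp p (maxLength R) (fun s₃ =>
          letterValue R φ (s₁.length + k) (s₁ ++ s₂ ++ s₃)))) =
    (∑ e ∈ expansion R, seqProb p e * (e.map φ).sum) / meanLength R p := by
  set m := maxLength R with hm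
  have h1 : ∀ l : Fin m, wordExp p (m - (l.1 + 1)) (fun s₁ => wordExp p L (fun s₂ =>
        wordExp p m (fun s₃ => letterValue R φ (s₁.length + k) (s₁ ++ s₂ ++ s₃)))) =
      parseExp R p φ (m + k - (l.1 + 1)) := by
    intro l
    have hl := l.2
    rw [← wordExp_letterValue_eq_parseExp hR hp φ (m + k - (l.1 + 1)) (m - (l.1 + 1) + (L + m))
      (by omega), wordExp_add]
    refine wordExp_congr fun s₁ hs₁ => ?_
    rw [wordExp_add]
    refine wordExp_congr fun s₂ hs₂ => wordExp_congr fun s₃ hs₃ => ?_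
    rw [hs₁, List.append_assoc]
    congr 1
    omega
  rw [Finset.sum_congr rfl fun l _ => by rw [h1 l],
    Fin.sum_univ_eq_sum_range (fun l => offsetProb R p (l + 1) * parseExp R p φ (m + k - (l + 1))),
    Finset.sum_congr rfl fun l _ => by rw [offsetProb_eq hR hp hp0 l, div_mul_eq_mul_div],
    ← Finset.sum_div, sum_tailProb_mul]
  congr 1
  -- Averaging over the offset gives, for each rule, the sum of `parseExp` over the window of its
  -- length that ends before `m + k`. As `m + k` is at least the length of every rule, the
  -- right-hand side of the telescoped identity already contains whole rules.
  have h2 := sum_Ico_parseExp hR hp φ (m + k)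
  have h3 : ∀ e ∈ expansion R, ∑ l ∈ Finset.range e.length, parseExp R p φ (m + k - (l + 1)) =
      ∑ j ∈ Finset.Ico (m + k - e.length) (m + k), parseExp R p φ j := by
    intro e he
    have hle := length_le_maxLength he
    rw [Finset.sum_Ico_eq_sum_range, show m + k - (m + k - e.length) = e.length by omega,
      ← Finset.sum_range_reflect]
    refine Finset.sum_congr rfl fun j hj => ?_
    have := Finset.mem_range.1 hj
    congr 1
    omega
  rw [Finset.sum_congr rfl fun e he => by rw [h3 e he], h2]
  refine Finset.sum_congr rfl fun e he => ?_
  have hle := length_le_maxLength he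
  rw [sum_range_getD (by simp; omega)]

end

end CubicDomination

namespace CubicDomination

noncomputable section

variable {R : Finset Rule} {p : Input → ℝ}

/-! ### The laws of the levels -/

/-- The indicator of the pairs of symbols that are counted by `count x y`. -/
def pairIndicator (x : Option Input) (y : Option Output) (a : Input × Output) : ℝ :=
  if (x = none ∨ x = some a.1) ∧ (y = none ∨ y = some a.2) then 1 else 0

theorem sum_map_pairIndicator (x : Option Input) (y : Option Output) (e : PlainRule) :
    (e.map (pairIndicator x y)).sum = count x y e := by
  induction e with
  | nil => simp [count]
  | cons a e ih =>
    rw [List.map_cons, List.sum_cons, ih, count, count, List.countP_cons, pairIndicator]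
    push_cast
    rw [add_comm]
    congr 1
    simp

/-- `∑ στ(x, y) p(σ)`. -/
def meanCount (R : Finset Rule) (p : Input → ℝ) (x : Option Input) (y : Option Output) : ℝ :=
  ∑ e ∈ expansion R, seqProb p e * (count x y e : ℝ)

theorem meanCount_nonneg (hp0 : ∀ a, 0 ≤ p a) (x : Option Input) (y : Option Output) :
    0 ≤ meanCount R p x y :=
  Finset.sum_nonneg fun _ _ => mul_nonneg (seqProb_nonneg hp0 _) (Nat.cast_nonneg _)

theorem meanCirc_eq : meanCirc R p = meanCount R p (some Input.circ) none :=
  Finset.sum_congr rfl fun _ _ => mul_comm _ _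

theorem outputProb_eq (y : Output) :
    outputProb R p y = meanCount R p none (some y) / meanLength R p := by
  rw [outputProb, meanCount, Finset.sum_div]
  exact Finset.sum_congr rfl fun _ _ => by ring

theorem circOutputProb_eq (y : Output) :
    circOutputProb R p y = meanCount R p (some Input.circ) (some y) / meanCirc R p := by
  rw [circOutputProb, meanCount, Finset.sum_div]
  exact Finset.sum_congr rfl fun _ _ => by ring

theorem count_eq_sum_outputs (x : Option Input) (e : PlainRule) :
    (count x none e : ℝ) = count x (some Output.oplus) e + count x (some Output.otimes) e +
      count x (some Output.odot) e := by
  simp only [← sum_map_pairIndicator, ← List.sum_map_add]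
  congr 2
  funext ⟨a, y⟩
  by_cases h : x = none ∨ x = some a <;> cases y <;> simp [pairIndicator, h]

theorem meanCount_eq_sum_outputs (x : Option Input) :
    meanCount R p x none = meanCount R p x (some Output.oplus) +
      meanCount R p x (some Output.otimes) + meanCount R p x (some Output.odot) := by
  simp only [meanCount, ← Finset.sum_add_distrib]
  refine Finset.sum_congr rfl fun e _ => ?_
  rw [count_eq_sum_outputs]; ring

/-- A Wald identity. For a function of the input symbol alone, the stationary average can also be
computed without the parse, and equals `p x`; a middle part of one letter suffices. -/
theorem meanCount_input (hR : UniquelyMatching R) (hp : ∑ a, p a = 1) (hp0 : ∀ a, 0 ≤ p a)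
    (x : Input) : meanCount R p (some x) none = p x * meanLength R p := by
  have h := stationary_letterValue hR hp hp0 (pairIndicator (some x) none) (L := 1) (k := 0)
    (by omega)
  have h1 : ∀ n : ℕ, wordExp p n (fun s₁ => wordExp p 1 (fun s₂ =>
        wordExp p (maxLength R) (fun s₃ =>
          letterValue R (pairIndicator (some x) none) (s₁.length + 0) (s₁ ++ s₂ ++ s₃)))) =
      p x := by
    intro n
    rw [← wordExp_const (p := p) hp n (p x)]
    refine wordExp_congr fun s₁ _ => ?_
    rw [show p x = ∑ a, p a * (if x = a then 1 else 0) by simp]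
    rw [← wordExp_getD hp (fun a => if x = a then 1 else 0) Input.dot (k := 0) (n := 1) (by omega)]
    refine wordExp_congr fun s₂ hs₂ => ?_
    rw [← wordExp_const (p := p) hp (maxLength R) (if x = _ then 1 else 0)]
    refine wordExp_congr fun s₃ _ => ?_
    rw [letterValue, List.append_assoc, List.getD_append_right _ _ _ _ (by omega),
      List.getD_append _ _ _ _ (by omega)]
    simp [pairIndicator]
  simp only [h1, sum_map_pairIndicator, ← Finset.sum_mul, sum_offsetProb hR hp hp0, one_mul] at h
  rw [h, meanCount, div_mul_cancel₀ _ (meanLength_pos hR hp hp0).ne']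

theorem meanCirc_eq_mul (hR : UniquelyMatching R) (hp : ∑ a, p a = 1) (hp0 : ∀ a, 0 ≤ p a) :
    meanCirc R p = p Input.circ * meanLength R p := by
  rw [meanCirc_eq, meanCount_input hR hp hp0]

theorem circOutputProb_nonneg (hp0 : ∀ a, 0 ≤ p a) (y : Output) : 0 ≤ circOutputProb R p y := by
  rw [circOutputProb_eq, meanCirc_eq]
  exact div_nonneg (meanCount_nonneg hp0 _ _) (meanCount_nonneg hp0 _ _)

/-- The case `meanCirc R p = 0` matters: it occurs at level K, where p(∘) = 0. Then all three
non-negative counts that add up to `meanCirc` vanish. -/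
theorem circOutputProb_mul (hp0 : ∀ a, 0 ≤ p a) (y : Output) :
    circOutputProb R p y * meanCirc R p = meanCount R p (some Input.circ) (some y) := by
  rw [circOutputProb_eq]
  by_cases h : meanCirc R p = 0
  · rw [h, mul_zero]
    have h1 := meanCount_eq_sum_outputs (R := R) (p := p) (some Input.circ)
    rw [← meanCirc_eq, h] at h1
    have h2 := fun y => meanCount_nonneg (R := R) hp0 (some Input.circ) (some y)
    have := h2 Output.oplus
    have := h2 Output.otimes
    have := h2 Output.odot
    cases y <;> linarith
  · exact div_mul_cancel₀ _ h

theorem sum_circOutputProb (hR : UniquelyMatching R) (hp : ∑ a, p a = 1) (hp0 : ∀ a, 0 ≤ p a)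
    (hc : 0 < p Input.circ) : circOutputProb R p Output.oplus + circOutputProb R p Output.otimes +
      circOutputProb R p Output.odot = 1 := by
  simp only [circOutputProb_eq, ← add_div]
  rw [← meanCount_eq_sum_outputs, ← meanCirc_eq, div_self]
  rw [meanCirc_eq_mul hR hp hp0]
  exact (mul_pos hc (meanLength_pos hR hp hp0)).ne'

variable {K : ℕ}

theorem levelInputProb_circ (i : ℕ) : levelInputProb R K i Input.circ = 1 - (i : ℝ) / K := by
  rw [levelInputProb]

theorem levelInputProb_plus (i : ℕ) : levelInputProb R K i Input.plus =
    ∑ j ∈ Finset.Ico 1 i, 1 / (K : ℝ) * circOutputProb R (levelInputProb R K j) Output.oplus := by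
  rw [levelInputProb]
  exact Finset.sum_attach (Finset.Ico 1 i)
    (fun j => 1 / (K : ℝ) * circOutputProb R (levelInputProb R K j) Output.oplus)

theorem levelInputProb_times (i : ℕ) : levelInputProb R K i Input.times =
    ∑ j ∈ Finset.Ico 1 i, 1 / (K : ℝ) * circOutputProb R (levelInputProb R K j) Output.otimes := by
  rw [levelInputProb]
  exact Finset.sum_attach (Finset.Ico 1 i)
    (fun j => 1 / (K : ℝ) * circOutputProb R (levelInputProb R K j) Output.otimes)

theorem levelInputProb_dot (i : ℕ) : levelInputProb R K i Input.dot = 1 / (K : ℝ) +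
    ∑ j ∈ Finset.Ico 1 i, 1 / (K : ℝ) * circOutputProb R (levelInputProb R K j) Output.odot := by
  rw [levelInputProb]
  rw [Finset.sum_attach (Finset.Ico 1 i)
    (fun j => 1 / (K : ℝ) * circOutputProb R (levelInputProb R K j) Output.odot)]

theorem sum_input (f : Input → ℝ) :
    ∑ a, f a = f Input.plus + f Input.times + f Input.dot + f Input.circ := by
  rw [show (Finset.univ : Finset Input) =
    {Input.plus, Input.times, Input.dot, Input.circ} from rfl]
  simp [add_assoc]

/-- For j < i ≤ K one has p_j(∘) = 1 - j/K > 0, so the three values of q_j^∘ sum to 1. Hence the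
total mass is (i-1)/K + 1/K + (1 - i/K) = 1. -/
theorem levelInputProb_law (hR : UniquelyMatching R) (hK : 0 < K) : ∀ {i : ℕ}, 1 ≤ i → i ≤ K →
    (∀ a, 0 ≤ levelInputProb R K i a) ∧ ∑ a, levelInputProb R K i a = 1 := by
  intro i
  induction i using Nat.strong_induction_on with
  | _ i ih =>
    intro h1 hi
    have hK' : (0 : ℝ) < K := by exact_mod_cast hK
    have hnn : ∀ j ∈ Finset.Ico 1 i, ∀ y,
        0 ≤ 1 / (K : ℝ) * circOutputProb R (levelInputProb R K j) y := by
      intro j hj y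
      rw [Finset.mem_Ico] at hj
      have := circOutputProb_nonneg (R := R) (ih j hj.2 hj.1 (by omega)).1 y
      positivity
    refine ⟨?_, ?_⟩
    · intro a
      cases a
      · rw [levelInputProb_plus]; exact Finset.sum_nonneg fun j hj => hnn j hj _
      · rw [levelInputProb_times]; exact Finset.sum_nonneg fun j hj => hnn j hj _
      · rw [levelInputProb_dot]
        exact add_nonneg (by positivity) (Finset.sum_nonneg fun j hj => hnn j hj _)
      · rw [levelInputProb_circ, sub_nonneg, div_le_one hK']
        exact_mod_cast hi
    · have hs : ∑ j ∈ Finset.Ico 1 i,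
          (1 / (K : ℝ) * circOutputProb R (levelInputProb R K j) Output.oplus +
          1 / (K : ℝ) * circOutputProb R (levelInputProb R K j) Output.otimes +
          1 / (K : ℝ) * circOutputProb R (levelInputProb R K j) Output.odot) =
          ((i : ℝ) - 1) / K := by
        rw [Finset.sum_congr rfl (g := fun _ => 1 / (K : ℝ))]
        · rw [Finset.sum_const, Nat.card_Ico, nsmul_eq_mul, Nat.cast_sub h1]
          push_cast; ring
        · intro j hj
          rw [Finset.mem_Ico] at hj
          obtain ⟨hj0, hj1⟩ := ih j hj.2 hj.1 (by omega)
          rw [← mul_add, ← mul_add, sum_circOutputProb hR hj1 hj0, mul_one]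
          rw [levelInputProb_circ, sub_pos, div_lt_one hK']
          exact_mod_cast hj.2.trans_le hi
      rw [Finset.sum_add_distrib, Finset.sum_add_distrib] at hs
      rw [sum_input, levelInputProb_plus, levelInputProb_times, levelInputProb_dot,
        levelInputProb_circ, ← add_assoc]
      linear_combination hs + (by ring : (1 : ℝ) / K + (1 - i / K) = 1 - (i - 1) / K)

theorem levelInputProb_nonneg (hR : UniquelyMatching R) (hK : 0 < K) {i : ℕ} (h1 : 1 ≤ i)
    (hi : i ≤ K) (a : Input) : 0 ≤ levelInputProb R K i a :=
  (levelInputProb_law hR hK h1 hi).1 a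

theorem sum_levelInputProb (hR : UniquelyMatching R) (hK : 0 < K) {i : ℕ} (h1 : 1 ≤ i)
    (hi : i ≤ K) : ∑ a, levelInputProb R K i a = 1 :=
  (levelInputProb_law hR hK h1 hi).2

theorem count_oplus (hc : Correct R) {e : PlainRule} (he : e ∈ expansion R) :
    count none (some Output.oplus) e = count (some Input.circ) (some Output.oplus) e := by
  refine List.countP_congr fun a ha => ?_
  obtain ⟨i, hi⟩ := List.getElem?_of_mem ha
  obtain ⟨x, y⟩ := a
  simp only [true_or, true_and, reduceCtorEq, false_or, Option.some.injEq, decide_eq_true_eq,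
    iff_and_self]
  rintro rfl
  exact (hc.circ_of_oplus e he i x hi).symm

theorem levelOutputProb_oplus (hR : UniquelyMatching R) (hc : Correct R) (hK : 0 < K) {i : ℕ}
    (h1 : 1 ≤ i) (hi : i ≤ K) : levelOutputProb R K i Output.oplus =
      (1 - (i : ℝ) / K) * circOutputProb R (levelInputProb R K i) Output.oplus := by
  have hp := sum_levelInputProb hR hK h1 hi
  have hp0 := levelInputProb_nonneg hR hK h1 hi
  have h : meanCount R (levelInputProb R K i) none (some Output.oplus) =
      meanCount R (levelInputProb R K i) (some Input.circ) (some Output.oplus) :=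
    Finset.sum_congr rfl fun e he => by rw [count_oplus hc he]
  rw [levelOutputProb, outputProb_eq, h, ← circOutputProb_mul hp0, meanCirc_eq_mul hR hp hp0,
    levelInputProb_circ]
  field_simp [(meanLength_pos hR hp hp0).ne']

/-- The expected numbers of vertices with input `+` and with output `⊕` agree. -/
theorem sum_levelInputProb_plus (hR : UniquelyMatching R) (hc : Correct R) (hK : 0 < K) :
    ∑ i ∈ Finset.Icc 1 K, levelInputProb R K i Input.plus =
      ∑ i ∈ Finset.Icc 1 K, levelOutputProb R K i Output.oplus := by
  have hK' : (K : ℝ) ≠ 0 := by exact_mod_cast hK.ne'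
  simp only [levelInputProb_plus]
  -- Level j contributes to each of the K - j higher levels, and (K - j)/K = p_j(∘) is the factor
  -- that turns q_j^∘(⊕) into q_j(⊕).
  rw [Finset.sum_comm' (t' := Finset.Icc 1 K) (s' := fun j => Finset.Icc (j + 1) K)]
  · refine Finset.sum_congr rfl fun j hj => ?_
    rw [Finset.mem_Icc] at hj
    rw [levelOutputProb_oplus hR hc hK hj.1 hj.2, Finset.sum_const, Nat.card_Icc, nsmul_eq_mul,
      Nat.add_sub_add_right, Nat.cast_sub hj.2]
    field_simp
  · intro i j
    simp only [Finset.mem_Icc, Finset.mem_Ico]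
    omega

/-! ### The law of the choices -/

theorem sum_choiceProb_mul (f : Choice K (maxLength R) → ℝ) :
    ∑ a, choiceProb R K a * f a = ∑ i : Fin K, 1 / (K : ℝ) * ∑ l : Fin (maxLength R),
      offsetProb R (levelInputProb R K (i.1 + 1)) (l.1 + 1) *
      ∑ s : Fin (maxLength R - (l.1 + 1)) → Input,
        ((List.ofFn s).map (levelInputProb R K (i.1 + 1))).prod *
      ∑ t : Fin (maxLength R) → Input,
        ((List.ofFn t).map (levelInputProb R K (i.1 + 1))).prod * f (i, ⟨l, s⟩, t) := by
  rw [Fintype.sum_prod_type]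
  refine Finset.sum_congr rfl fun i _ => ?_
  rw [Fintype.sum_prod_type, Fintype.sum_sigma, Finset.mul_sum]
  refine Finset.sum_congr rfl fun l _ => ?_
  rw [Finset.mul_sum, Finset.mul_sum]
  refine Finset.sum_congr rfl fun s _ => ?_
  rw [Finset.mul_sum, Finset.mul_sum, Finset.mul_sum]
  refine Finset.sum_congr rfl fun t _ => ?_
  simp only [choiceProb, Choice.level, Choice.offset, Choice.front, Choice.back]
  ring

/-- The expectation of a function of the choices for a path that depends on the auxiliary labels
only through the padding. -/
theorem sum_choiceProb_pad (f : ℕ → List Input → List Input → ℝ) :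
    ∑ a : Choice K (maxLength R), choiceProb R K a * f a.level a.front a.back =
      ∑ i ∈ Finset.Icc 1 K, 1 / (K : ℝ) * ∑ l : Fin (maxLength R),
        offsetProb R (levelInputProb R K i) (l.1 + 1) *
        wordExp (levelInputProb R K i) (maxLength R - (l.1 + 1)) (fun s =>
          wordExp (levelInputProb R K i) (maxLength R) (fun t => f i s t)) := by
  rw [sum_choiceProb_mul]
  simp only [Choice.level, Choice.front, Choice.back]
  have hIcc : ∀ F : ℕ → ℝ, ∑ i ∈ Finset.Icc 1 K, F i = ∑ i : Fin K, F (i.1 + 1) := by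
    intro F
    rw [Fin.sum_univ_eq_sum_range (fun i => F (i + 1)), ← Finset.Ico_succ_right_eq_Icc,
      Finset.sum_Ico_eq_sum_range]
    simp [add_comm]
  rw [hIcc]
  refine Finset.sum_congr rfl fun i _ => ?_
  congr 1
  refine Finset.sum_congr rfl fun l _ => ?_
  congr 1
  rw [← wordExp_ofFn]
  refine Finset.sum_congr rfl fun s _ => ?_
  congr 1
  exact wordExp_ofFn _ (fun t => f (i.1 + 1) (List.ofFn s) t)

theorem sum_choiceProb_level (hR : UniquelyMatching R) (hK : 0 < K) (f : ℕ → ℝ) :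
    ∑ a : Choice K (maxLength R), choiceProb R K a * f a.level =
      ∑ i ∈ Finset.Icc 1 K, 1 / (K : ℝ) * f i := by
  rw [sum_choiceProb_pad (fun i _ _ => f i)]
  refine Finset.sum_congr rfl fun i hi => ?_
  rw [Finset.mem_Icc] at hi
  have hp := sum_levelInputProb hR hK hi.1 hi.2
  simp only [wordExp_const hp, ← Finset.sum_mul,
    sum_offsetProb hR hp (levelInputProb_nonneg hR hK hi.1 hi.2), one_mul]

theorem sum_choiceProb (hR : UniquelyMatching R) (hK : 0 < K) :
    ∑ a : Choice K (maxLength R), choiceProb R K a = 1 := by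
  have h := sum_choiceProb_level hR hK (fun _ => 1)
  have hK' : (K : ℝ) ≠ 0 := by exact_mod_cast hK.ne'
  simpa [hK'] using h

theorem Choice.level_mem {m : ℕ} (a : Choice K m) : 1 ≤ a.level ∧ a.level ≤ K :=
  ⟨Nat.succ_le_succ (Nat.zero_le _), a.1.2⟩

theorem choiceProb_nonneg (hR : UniquelyMatching R) (a : Choice K (maxLength R)) :
    0 ≤ choiceProb R K a := by
  obtain ⟨h1, hi⟩ := a.level_mem
  have hK : 0 < K := by omega
  have hp := sum_levelInputProb hR hK h1 hi
  have hp0 := levelInputProb_nonneg hR hK h1 hi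
  have hl : ∀ l : List Input, 0 ≤ (l.map (levelInputProb R K a.level)).prod := by
    intro l
    refine List.prod_nonneg fun x hx => ?_
    obtain ⟨b, -, rfl⟩ := List.mem_map.1 hx
    exact hp0 b
  exact mul_nonneg (mul_nonneg (mul_nonneg (by positivity) (offsetProb_nonneg hR hp hp0 _))
    (hl _)) (hl _)

end

end CubicDomination

namespace CubicDomination

noncomputable section

/-! ### Expectations for independent choices -/

variable {ι α : Type*} [Fintype ι] [DecidableEq ι] [Fintype α]

/-- The expectation of `f` when the coordinates are independent with the weights `w`. -/
def prodExp (w : α → ℝ) (f : (ι → α) → ℝ) : ℝ := ∑ ω : ι → α, (∏ j, w (ω j)) * f ω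

variable {w : α → ℝ}

theorem sum_prod_eq_one {κ : Type*} [Fintype κ] [DecidableEq κ] (hw : ∑ c, w c = 1) :
    ∑ ω : κ → α, ∏ j, w (ω j) = 1 := by
  have h := Finset.prod_univ_sum (fun _ : κ => (Finset.univ : Finset α)) (fun _ c => w c)
  simp only [hw, Finset.prod_const_one, Fintype.piFinset_univ] at h
  exact h.symm

theorem prodExp_sum {κ : Type*} (t : Finset κ) (f : κ → (ι → α) → ℝ) :
    prodExp w (fun ω => ∑ i ∈ t, f i ω) = ∑ i ∈ t, prodExp w (f i) := by
  simp only [prodExp, Finset.mul_sum]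
  rw [Finset.sum_comm]

theorem prodExp_const (hw : ∑ c, w c = 1) (c : ℝ) : prodExp (ι := ι) w (fun _ => c) = c := by
  rw [prodExp, ← Finset.sum_mul, sum_prod_eq_one hw, one_mul]

open Classical in
-- Fubini after splitting the coordinates into those in `S` and the others. The coordinates that a
-- factor ignores are frozen at an arbitrary `c₀`, which exists because the weights sum to 1.
theorem prodExp_mul (hw : ∑ c, w c = 1) {f g : (ι → α) → ℝ} {S T : Set ι} (hf : DependsOn f S)
    (hg : DependsOn g T) (hST : Disjoint S T) :
    prodExp w (fun ω => f ω * g ω) = prodExp w f * prodExp w g := by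
  have hne : Nonempty α := by
    by_contra h
    rw [not_nonempty_iff] at h
    simp at hw
  obtain ⟨c₀⟩ := hne
  let E := Equiv.piEquivPiSubtypeProd (fun j => j ∈ S) (fun _ : ι => α)
  let f' : ({j // j ∈ S} → α) → ℝ := fun a => f (E.symm (a, fun _ => c₀))
  let g' : ({j // ¬ j ∈ S} → α) → ℝ := fun b => g (E.symm (fun _ => c₀, b))
  let W : ({j // j ∈ S} → α) → ℝ := fun a => ∏ j, w (a j)
  let W' : ({j // ¬ j ∈ S} → α) → ℝ := fun b => ∏ j, w (b j)
  have hW : ∑ a, W a = 1 := sum_prod_eq_one hw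
  have hW' : ∑ b, W' b = 1 := sum_prod_eq_one hw
  have hf' : ∀ a b, f (E.symm (a, b)) = f' a := by
    intro a b
    refine hf fun j hj => ?_
    simp [E, Equiv.piEquivPiSubtypeProd, hj]
  have hg' : ∀ a b, g (E.symm (a, b)) = g' b := by
    intro a b
    refine hg fun j hj => ?_
    have hj' : j ∉ S := fun h => Set.disjoint_left.1 hST h hj
    simp [E, Equiv.piEquivPiSubtypeProd, hj']
  have hprod : ∀ a b, ∏ j, w (E.symm (a, b) j) = W a * W' b := by
    intro a b
    rw [← Fintype.prod_subtype_mul_prod_subtype (fun j => j ∈ S)]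
    congr 1
    · refine Finset.prod_congr rfl fun j _ => ?_
      simp [E, Equiv.piEquivPiSubtypeProd, j.2]
    · refine Finset.prod_congr rfl fun j _ => ?_
      simp [E, Equiv.piEquivPiSubtypeProd, j.2]
  have key : ∀ h : (ι → α) → ℝ, prodExp w h = ∑ a, ∑ b, W a * W' b * h (E.symm (a, b)) := by
    intro h
    rw [prodExp, ← E.symm.sum_comp, Fintype.sum_prod_type]
    simp only [hprod]
  simp only [key, hf', hg']
  have h1 : ∑ a, ∑ b, W a * W' b * f' a = ∑ a, W a * f' a := by
    refine Finset.sum_congr rfl fun a _ => ?_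
    rw [← mul_one (W a * f' a), ← hW', Finset.mul_sum]
    exact Finset.sum_congr rfl fun _ _ => by ring
  have h2 : ∑ a, ∑ b, W a * W' b * g' b = ∑ b, W' b * g' b := by
    rw [Finset.sum_comm]
    refine Finset.sum_congr rfl fun b _ => ?_
    rw [← mul_one (W' b * g' b), ← hW, Finset.mul_sum]
    exact Finset.sum_congr rfl fun _ _ => by ring
  rw [h1, h2, Finset.sum_mul_sum]
  exact Finset.sum_congr rfl fun a _ => Finset.sum_congr rfl fun b _ => by ring

theorem dependsOn_list_map {ι α β γ : Type*} {X : β → (ι → α) → γ} {S : β → Set ι} {l : List β}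
    (hX : ∀ v ∈ l, DependsOn (X v) (S v)) :
    DependsOn (fun ω => l.map (fun v => X v ω)) (⋃ v ∈ l, S v) := by
  intro ω ω' h
  refine List.map_congr_left fun v hv => hX v hv fun j hj => h j ?_
  exact Set.mem_biUnion (s := {v | v ∈ l}) (t := S) hv hj

/-- A word of independent random letters with the same law. -/
theorem prodExp_list_map (hw : ∑ c, w c = 1) {β : Type*} {X : β → (ι → α) → Input}
    {S : β → Set ι} {p : Input → ℝ} {l : List β} (hX : ∀ v ∈ l, DependsOn (X v) (S v))
    (hS : l.Pairwise (fun u v => Disjoint (S u) (S v)))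
    (hlaw : ∀ v ∈ l, ∀ a, prodExp w (fun ω => if X v ω = a then 1 else 0) = p a)
    (f : List Input → ℝ) :
    prodExp w (fun ω => f (l.map (fun v => X v ω))) = wordExp p l.length f := by
  induction l generalizing f with
  | nil => simp [wordExp, prodExp_const hw]
  | cons v l ih =>
    rw [List.pairwise_cons] at hS
    simp only [List.length_cons, wordExp]
    have h1 : ∀ ω : ι → α, f ((v :: l).map (fun v => X v ω)) =
        ∑ a, (if X v ω = a then 1 else 0) * f (a :: l.map (fun v => X v ω)) := by
      intro ω
      simp
    simp only [h1]
    rw [prodExp_sum]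
    refine Finset.sum_congr rfl fun a _ => ?_
    rw [prodExp_mul hw (S := S v) (T := ⋃ u ∈ l, S u), hlaw v (by simp) a]
    · congr 1
      exact ih (fun u hu => hX u (by simp [hu])) hS.2 (fun u hu => hlaw u (by simp [hu]))
        (fun s => f (a :: s))
    · intro ω ω' h
      simp only [hX v (by simp) h]
    · intro ω ω' h
      have := dependsOn_list_map (l := l) (fun u hu => hX u (by simp [hu])) h
      simp only at this
      simp only [this]
    · rw [Set.disjoint_iUnion₂_right]
      exact hS.1

/-- Here `ω j` plays the role of the choices for a path, and the word that of the input labels on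
the same path. -/
theorem prodExp_coord_list_map (hw : ∑ c, w c = 1) {β : Type*} {X : β → (ι → α) → Input}
    {S : β → Set ι} {p : Input → ℝ} {l : List β} (hX : ∀ v ∈ l, DependsOn (X v) (S v))
    (hS : l.Pairwise (fun u v => Disjoint (S u) (S v)))
    (hlaw : ∀ v ∈ l, ∀ a, prodExp w (fun ω => if X v ω = a then 1 else 0) = p a)
    {j : ι} (hj : ∀ v ∈ l, j ∉ S v) (f : α → List Input → ℝ) :
    prodExp w (fun ω => f (ω j) (l.map (fun v => X v ω))) =
      ∑ c, w c * wordExp p l.length (f c) := by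
  classical
  have h1 : ∀ ω : ι → α, f (ω j) (l.map (fun v => X v ω)) =
      ∑ c, (if ω j = c then 1 else 0) * f c (l.map (fun v => X v ω)) := by
    intro ω
    simp
  have h2 : ∀ c, prodExp w (fun ω : ι → α => if ω j = c then 1 else 0) = w c := by
    intro c
    have h := Finset.prod_univ_sum (fun _ : ι => (Finset.univ : Finset α))
      (fun i d => w d * if i = j then (if d = c then 1 else 0) else 1)
    rw [Fintype.piFinset_univ] at h
    rw [prodExp]
    have h3 : ∀ ω : ι → α, (∏ i, w (ω i)) * (if ω j = c then (1 : ℝ) else 0) =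
        ∏ i, (w (ω i) * if i = j then (if ω i = c then 1 else 0) else 1) := by
      intro ω
      rw [Finset.prod_mul_distrib, Finset.prod_ite_eq' Finset.univ j
        (fun i => if ω i = c then (1 : ℝ) else 0), if_pos (Finset.mem_univ j)]
    rw [Finset.sum_congr rfl fun ω _ => h3 ω, ← h, Finset.prod_eq_single j]
    · simp
    · intro i _ hi
      simp [hi, hw]
    · simp
  simp only [h1]
  rw [prodExp_sum]
  refine Finset.sum_congr rfl fun c _ => ?_
  rw [prodExp_mul hw (S := {j}) (T := ⋃ u ∈ l, S u), h2, prodExp_list_map hw hX hS hlaw]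
  · intro ω ω' h
    simp only [h j rfl]
  · intro ω ω' h
    have := dependsOn_list_map hX h
    simp only at this
    simp only [this]
  · rw [Set.disjoint_iUnion₂_right]
    intro v hv
    rw [Set.disjoint_singleton_left]
    exact hj v hv

end

end CubicDomination

/-! ### Final labels in terms of levels and padded paths -/

namespace CubicDomination

noncomputable section

/-- The input symbol of a vertex whose mate has the given output on a lower level. -/
def Output.toInput : Output → Input
  | Output.oplus => Input.plus
  | Output.otimes => Input.times
  | Output.odot => Input.dot

/-- The output at the position `k` of a path with the given input labels. -/
def paddedOutput (R : Finset Rule) {K m : ℕ} (a : Choice K m) (s : List Input) (k : ℕ) : Output :=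
  (applyRules R (a.front ++ s ++ a.back)).getD (a.front.length + k) Output.odot

namespace PathCover

variable {V : Type u} {G : SimpleGraph V} {K m : ℕ} {P : PathCover G} {R : Finset Rule}
  {ω : P.Outcome K m}

theorem choose_eq {v : V} {j : Fin P.num} (hv : v ∈ (P.walk j).support) (h : P.Covered v) :
    h.choose = j :=
  P.disjoint _ _ v h.choose_spec hv

theorem vertexLevel_eq {v : V} {j : Fin P.num} (hv : v ∈ (P.walk j).support) :
    P.vertexLevel ω v = (ω j).level := by
  have h : P.Covered v := ⟨j, hv⟩
  rw [vertexLevel, dif_pos h, choose_eq hv h]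

theorem inputLabel_of_lt {out : V → Output} {v : V}
    (h : P.vertexLevel ω (P.mate v) < P.vertexLevel ω v) :
    P.inputLabel ω out v = (out (P.mate v)).toInput := by
  rw [inputLabel, if_pos h]
  cases out (P.mate v) <;> rfl

theorem inputLabel_of_eq {out : V → Output} {v : V}
    (h : P.vertexLevel ω (P.mate v) = P.vertexLevel ω v) :
    P.inputLabel ω out v = Input.dot := by
  rw [inputLabel, if_neg h.not_lt, if_pos h]

theorem inputLabel_of_gt {out : V → Output} {v : V}
    (h : P.vertexLevel ω v < P.vertexLevel ω (P.mate v)) :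
    P.inputLabel ω out v = Input.circ := by
  rw [inputLabel, if_neg h.not_gt, if_neg h.ne']

theorem pathOutput_eq [DecidableEq V] (out : V → Output) (j : Fin P.num) (v : V) :
    P.pathOutput R ω out j v =
      paddedOutput R (ω j) ((P.walk j).support.map (P.inputLabel ω out))
        ((P.walk j).support.idxOf v) := by
  rw [pathOutput, paddedOutput]
  congr!

/-- Labels are never overwritten, because `v` lies on a single path and that path is processed only
at its own level. -/
theorem outputAfter_eq {v : V} {j : Fin P.num} (hv : v ∈ (P.walk j).support) :
    ∀ {t : ℕ}, (ω j).level ≤ t →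
      P.outputAfter R ω t v = P.pathOutput R ω (P.outputAfter R ω ((ω j).level - 1)) j v := by
  intro t
  induction t with
  | zero => intro h; exact absurd (Choice.level_mem (ω j)).1 (by omega)
  | succ t ih =>
    intro h
    rw [outputAfter]
    beta_reduce
    by_cases hlt : (ω j).level = t + 1
    · have hex : ∃ j, v ∈ (P.walk j).support ∧ (ω j).level = t + 1 := ⟨j, hv, hlt⟩
      have hc : hex.choose = j := P.disjoint _ _ v hex.choose_spec.1 hv
      rw [dif_pos hex, hc, hlt, Nat.add_sub_cancel]
    · rw [dif_neg, ih (by omega)]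
      rintro ⟨j', hj', hl⟩
      obtain rfl := P.disjoint _ _ v hj' hv
      exact hlt hl

theorem finalOutput_eq_outputAfter {v : V} {j : Fin P.num} (hv : v ∈ (P.walk j).support) {t : ℕ}
    (ht : (ω j).level ≤ t) : P.finalOutput R ω v = P.outputAfter R ω t v := by
  rw [finalOutput, outputAfter_eq hv (Choice.level_mem (ω j)).2, outputAfter_eq hv ht]

theorem finalInput_eq_inputLabel {v : V} {j : Fin P.num} (hv : v ∈ (P.walk j).support) :
    P.finalInput R ω v = P.inputLabel ω (P.outputAfter R ω ((ω j).level - 1)) v := by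
  rw [finalInput, vertexLevel_eq hv]

theorem finalOutput_eq [DecidableEq V] {v : V} {j : Fin P.num} (hv : v ∈ (P.walk j).support) :
    P.finalOutput R ω v = paddedOutput R (ω j) ((P.walk j).support.map (P.finalInput R ω))
      ((P.walk j).support.idxOf v) := by
  rw [finalOutput, outputAfter_eq hv (Choice.level_mem (ω j)).2, pathOutput_eq]
  congr 1
  refine List.map_congr_left fun x hx => ?_
  rw [finalInput_eq_inputLabel hx]

theorem finalInput_of_lt {v : V} {i j : Fin P.num} (hv : v ∈ (P.walk j).support)
    (hm : P.mate v ∈ (P.walk i).support) (h : (ω i).level < (ω j).level) :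
    P.finalInput R ω v = (P.finalOutput R ω (P.mate v)).toInput := by
  rw [finalInput_eq_inputLabel hv, inputLabel_of_lt (by rwa [vertexLevel_eq hv, vertexLevel_eq hm]),
    finalOutput_eq_outputAfter hm (t := (ω j).level - 1) (by omega)]

theorem finalInput_of_eq {v : V} {i j : Fin P.num} (hv : v ∈ (P.walk j).support)
    (hm : P.mate v ∈ (P.walk i).support) (h : (ω i).level = (ω j).level) :
    P.finalInput R ω v = Input.dot := by
  rw [finalInput_eq_inputLabel hv, inputLabel_of_eq (by rwa [vertexLevel_eq hv, vertexLevel_eq hm])]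

theorem finalInput_of_gt {v : V} {i j : Fin P.num} (hv : v ∈ (P.walk j).support)
    (hm : P.mate v ∈ (P.walk i).support) (h : (ω j).level < (ω i).level) :
    P.finalInput R ω v = Input.circ := by
  rw [finalInput_eq_inputLabel hv, inputLabel_of_gt (by rwa [vertexLevel_eq hv, vertexLevel_eq hm])]

/-! ### The set produced by the procedure is dominating -/

theorem mem_dominatingSet [Fintype V] {v : V} : v ∈ P.dominatingSet R ω ↔ ¬ P.Covered v ∨
    P.finalInput R ω v = Input.plus ∨ P.finalOutput R ω v = Output.otimes ∨
      ∃ j, v = P.first j ∨ v = P.last j := by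
  simp [dominatingSet]

theorem mate_finalInput_of_oplus {v : V} {j : Fin P.num} (hv : v ∈ (P.walk j).support)
    (hin : P.finalInput R ω v = Input.circ) (hout : P.finalOutput R ω v = Output.oplus) :
    P.finalInput R ω (P.mate v) = Input.plus := by
  obtain ⟨i, hi⟩ := P.mate_covered j v hv
  have hmm := P.mate_mate j v hv
  rcases lt_trichotomy (ω i).level (ω j).level with h | h | h
  · rw [finalInput_of_lt hv hi h] at hin
    cases hf : P.finalOutput R ω (P.mate v) <;> simp [hf, Output.toInput] at hin
  · rw [finalInput_of_eq hv hi h] at hin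
    exact absurd hin (by decide)
  · rw [finalInput_of_lt hi (by rwa [hmm]) h, hmm, hout]
    rfl

/-- An undominated `v` is interior to its path, so the positions next to it in a rule belong to its
neighbours and not to auxiliary vertices. Input × means that the mate has output ⊗. For · and ∘
correctness yields + or ⊗ at a neighbour, ⊗ at `v`, or ⊕ at `v`; in the last case `v` has input ∘
and its mate reads +. -/
theorem isDominating [Fintype V] {ω : P.Outcome K (maxLength R)} (hR : UniquelyMatching R)
    (hc : Correct R) : IsDominating G (P.dominatingSet R ω) := by
  classical
  intro v
  by_contra hcon
  push Not at hcon
  obtain ⟨hvD, hnb⟩ := hcon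
  have hvD' := hvD
  rw [mem_dominatingSet] at hvD'
  push Not at hvD'
  obtain ⟨⟨j, hv⟩, hplus, htimes, hends⟩ := hvD'
  have hin : ∀ x ∈ (P.walk j).support, G.Adj v x → P.finalInput R ω x ≠ Input.plus ∧
      P.finalOutput R ω x ≠ Output.otimes := by
    intro x _ hadj
    exact ⟨fun h => hnb x (mem_dominatingSet.2 (Or.inr (Or.inl h))) hadj,
      fun h => hnb x (mem_dominatingSet.2 (Or.inr (Or.inr (Or.inl h)))) hadj⟩
  have hmate := P.mate_adj j v hv
  set s := (P.walk j).support with hs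
  set W := (ω j).front ++ s.map (P.finalInput R ω) ++ (ω j).back with hW
  set k := s.idxOf v with hk
  have hks : k < s.length := List.idxOf_lt_length_iff.2 hv
  have hsk : s[k] = v := List.getElem_idxOf hks
  have hback : (ω j).back.length = maxLength R := by simp [Choice.back]
  have hnodup : s.Nodup := (P.isPath j).support_nodup
  -- The `maxLength R` auxiliary vertices behind the path ensure that `v` lies in a complete
  -- occurrence of a rule.
  obtain ⟨e, he, k₀, i, hki, hi, hocc⟩ := exists_occurrence hR ((ω j).front.length + k) W
    (by simp only [hW, List.length_append, List.length_map, hback]; omega)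
  have hWin : ∀ (n : ℕ) (hn : n < s.length),
      W[(ω j).front.length + n]? = some (P.finalInput R ω s[n]) := by
    intro n hn
    rw [hW, List.append_assoc, List.getElem?_append_right (by omega),
      List.getElem?_append_left (by rw [List.length_map]; omega)]
    simp [hn]
  have hWout : ∀ (n : ℕ) (hn : n < s.length) (y : Output),
      (applyRules R W)[(ω j).front.length + n]? = some y → P.finalOutput R ω s[n] = y := by
    intro n hn y hy
    rw [finalOutput_eq (j := j) (List.getElem_mem hn), paddedOutput, ← hs,
      hnodup.idxOf_getElem n hn, ← hW, List.getD_eq_getElem?_getD, hy]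
    rfl
  have hk0 : k ≠ 0 := by
    intro h0
    refine (hends j).1 ?_
    rw [← hsk, ← (P.walk j).support_getElem_zero]
    congr 1
  have hk1 : k + 1 ≠ s.length := by
    intro h0
    refine (hends j).2 ?_
    rw [← hsk, ← (P.walk j).support_getElem_length]
    have := (P.walk j).length_support
    rw [← hs] at this
    congr 1
    omega
  have hchain := List.isChain_iff_getElem.1 (P.walk j).isChain_adj_support
  have hadj : ∀ (n : ℕ) (hn : n < s.length), n + 1 = k ∨ n = k + 1 → G.Adj v s[n] := by
    rintro n hn (h | rfl)
    · have h1 : G.Adj s[n] s[n + 1] := hchain n (by rw [← hs]; omega)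
      simp only [h, hsk] at h1
      exact h1.symm
    · rw [← hsk]
      exact hchain k (by rw [← hs]; omega)
  have hpos : ∀ (i' : ℕ) (a : Input × Output), i' + 1 = i ∨ i' = i ∨ i' = i + 1 → e[i']? = some a →
      ∃ (n : ℕ) (hn : n < s.length), n + i = k + i' ∧
        P.finalInput R ω s[n] = a.1 ∧ P.finalOutput R ω s[n] = a.2 := by
    intro i' a h hi'
    obtain ⟨h1, h2⟩ := hocc i' a hi'
    obtain ⟨n, hn⟩ : ∃ n, n + i = k + i' := ⟨k + i' - i, by omega⟩
    rw [show k₀ + i' = (ω j).front.length + n by omega] at h1 h2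
    have hns : n < s.length := by omega
    rw [hWin n hns] at h1
    exact ⟨n, hns, hn, Option.some_injective _ h1, hWout n hns _ h2⟩
  obtain ⟨n, hn, hnk, hx, hy⟩ := hpos i e[i] (Or.inr (Or.inl rfl)) (List.getElem?_eq_getElem hi)
  obtain rfl : n = k := by omega
  rw [hsk] at hx hy
  obtain ⟨b, hb⟩ := P.mate_covered j v hv
  have hsym : e[i].1 = Input.dot ∨ e[i].1 = Input.circ := by
    rcases hcase : e[i].1 with _ | _ | _ | _
    · exact absurd (hx.trans hcase) hplus
    · exfalso
      rw [hcase] at hx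
      rcases lt_trichotomy (ω b).level (ω j).level with h | h | h
      · rw [finalInput_of_lt hv hb h] at hx
        refine hnb _ (mem_dominatingSet.2 (Or.inr (Or.inr (Or.inl ?_)))) hmate
        cases hf : P.finalOutput R ω (P.mate v) <;> simp [hf, Output.toInput] at hx ⊢
      · rw [finalInput_of_eq hv hb h] at hx
        exact absurd hx (by decide)
      · rw [finalInput_of_gt hv hb h] at hx
        exact absurd hx (by decide)
    · exact Or.inl rfl
    · exact Or.inr rfl
  have hnoplus : ∀ (i' : ℕ) (z : Output), (i' + 1 = i ∨ i' = i + 1) →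
      e[i']? ≠ some (Input.plus, z) := by
    intro i' z hi' hei'
    obtain ⟨n, hns, hn', hin', -⟩ := hpos i' _ (by omega) hei'
    exact (hin _ (List.getElem_mem hns) (hadj n hns (by omega))).1 hin'
  rcases hc.dominated e he i e[i].1 e[i].2 (List.getElem?_eq_getElem hi) hsym hnoplus with h | h
  · have hcirc := hc.circ_of_oplus e he i e[i].1 (by rw [← h]; exact List.getElem?_eq_getElem hi)
    rw [hcirc] at hx
    rw [h] at hy
    exact hnb _ (mem_dominatingSet.2 (Or.inr (Or.inl (mate_finalInput_of_oplus hv hx hy)))) hmate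
  · obtain ⟨i', x, hi', hei'⟩ := h
    obtain ⟨n, hns, hn', -, hout⟩ := hpos i' _ hi' hei'
    rcases hi' with h | rfl | h
    · exact (hin _ (List.getElem_mem hns) (hadj n hns (by omega))).2 hout
    · obtain rfl : n = k := by omega
      rw [hsk] at hout
      exact htimes hout
    · exact (hin _ (List.getElem_mem hns) (hadj n hns (by omega))).2 hout

/-! ### Input labels in terms of independent choices -/

open Classical in
/-- The input label that `v` has if its level is `t`. It is determined by the choices for the paths
that can be reached from the mate of `v`. -/
def localInput (P : PathCover G) (R : Finset Rule) (ω : P.Outcome K m) (t : ℕ) (v : V) : Input :=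
  if h : P.Covered (P.mate v) then
    if (ω h.choose).level < t then
      -- In this branch the mate of `v` lies on a lower level than `v`, so its own input is ∘.
      -- Writing ∘ directly cuts the recursion there instead of returning to `v`.
      (paddedOutput R (ω h.choose) ((P.walk h.choose).support.map (fun x =>
        if x = P.mate v then Input.circ else localInput P R ω (ω h.choose).level x))
        ((P.walk h.choose).support.idxOf (P.mate v))).toInput
    else if (ω h.choose).level = t then Input.dot else Input.circ
  else Input.circ
termination_by t

theorem localInput_eq [DecidableEq V] {v : V} {b : Fin P.num}
    (hb : P.mate v ∈ (P.walk b).support) (t : ℕ) :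
    P.localInput R ω t v = if (ω b).level < t then
      (paddedOutput R (ω b) ((P.walk b).support.map (fun x =>
        if x = P.mate v then Input.circ else P.localInput R ω (ω b).level x))
        ((P.walk b).support.idxOf (P.mate v))).toInput
    else if (ω b).level = t then Input.dot else Input.circ := by
  have h : P.Covered (P.mate v) := ⟨b, hb⟩
  have hc := choose_eq hb h
  rw [localInput, dif_pos h, hc]
  congr!

theorem finalInput_eq_localInput : ∀ (t : ℕ) {v : V} {j : Fin P.num}, (ω j).level = t →
    v ∈ (P.walk j).support → P.finalInput R ω v = P.localInput R ω t v := by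
  classical
  intro t
  induction t using Nat.strong_induction_on with
  | _ t ih =>
    intro v j hj hv
    obtain ⟨b, hb⟩ := P.mate_covered j v hv
    rw [localInput_eq hb]
    split_ifs with h1 h2
    · rw [finalInput_of_lt hv hb (by omega), finalOutput_eq hb]
      congr 2
      refine List.map_congr_left fun x hx => ?_
      split_ifs with hxm
      · rw [hxm, finalInput_of_gt hb (i := j) (by rwa [P.mate_mate j v hv]) (by omega)]
      · exact ih _ h1 rfl hx
    · exact finalInput_of_eq hv hb (by omega)
    · exact finalInput_of_gt hv hb (by omega)

theorem finalOutput_eq_localInput [DecidableEq V] {v : V} {j : Fin P.num}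
    (hv : v ∈ (P.walk j).support) : P.finalOutput R ω v =
      paddedOutput R (ω j) ((P.walk j).support.map (P.localInput R ω (ω j).level))
        ((P.walk j).support.idxOf v) := by
  rw [finalOutput_eq hv]
  congr 1
  exact List.map_congr_left fun x hx => finalInput_eq_localInput _ rfl hx

end PathCover

end

end CubicDomination

namespace CubicDomination

/-! ### Short walks in graphs with large girth -/

section Girth

variable {V : Type u} {G : SimpleGraph V}

/-- The edges of `p` form a forest, as a cycle among them would need at least `g` distinct edges. In
a forest a walk without immediate backtracking is a path. -/
theorem isPath_of_isChain_edges {g : ℕ} (hg : (g : ℕ∞) ≤ G.egirth) {u v : V} (p : G.Walk u v)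
    (hp : p.edges.IsChain (· ≠ ·)) (hlen : p.length < g) : p.IsPath := by
  classical
  set F : SimpleGraph V := SimpleGraph.fromEdgeSet {e | e ∈ p.edges} with hF
  have hle : F ≤ G := by
    intro a b hab
    rw [hF, SimpleGraph.fromEdgeSet_adj] at hab
    exact p.adj_of_mem_edges hab.1
  have hacyc : F.IsAcyclic := by
    intro a c hc
    have h1 := SimpleGraph.le_egirth.1 hg a (c.mapLe hle) (hc.mapLe hle)
    have h2 : c.edges ⊆ p.edges := by
      intro e he
      have := c.edges_subset_edgeSet he
      rw [hF, SimpleGraph.edgeSet_fromEdgeSet] at this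
      exact this.1
    have h3 := (hc.edges_nodup.subperm h2).length_le
    simp only [SimpleGraph.Walk.length_edges] at h3
    have h4 : (c.mapLe hle).length = c.length := by simp
    rw [h4, Nat.cast_le] at h1
    omega
  have hpF : ∀ e ∈ p.edges, e ∈ F.edgeSet := by
    intro e he
    rw [hF, SimpleGraph.edgeSet_fromEdgeSet]
    exact ⟨he, G.not_isDiag_of_mem_edgeSet (p.edges_subset_edgeSet he)⟩
  have h := (hacyc.isPath_iff_isChain (p.transfer F hpF)).2 (by simpa using hp)
  simpa [SimpleGraph.Walk.isPath_def] using h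

theorem length_eq_zero_of_isChain_edges {g : ℕ} (hg : (g : ℕ∞) ≤ G.egirth) {u : V}
    (p : G.Walk u u) (hp : p.edges.IsChain (· ≠ ·)) (hlen : p.length < g) : p.length = 0 := by
  have h := isPath_of_isChain_edges hg p hp hlen
  rw [SimpleGraph.Walk.isPath_iff_nil] at h
  exact SimpleGraph.Walk.length_eq_zero_iff.2 h

theorem exists_segment {a b u v : V} {p : G.Walk a b} (hu : u ∈ p.support)
    (hv : v ∈ p.support) : ∃ q : G.Walk u v, q.edges.IsChain (· ≠ ·) ∧ q.edges ⊆ p.edges ∧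
      q.length < p.support.length := by
  classical
  let r := (p.takeUntil u hu).reverse.append (p.takeUntil v hv)
  have hsub : r.bypass.edges ⊆ p.edges := by
    refine fun e he => ?_
    have := r.edges_bypass_subset_edges he
    simp only [r, SimpleGraph.Walk.edges_append, SimpleGraph.Walk.edges_reverse,
      List.mem_append, List.mem_reverse] at this
    rcases this with h | h
    · exact p.edges_takeUntil_subset_edges hu h
    · exact p.edges_takeUntil_subset_edges hv h
  have hnd := r.bypass_isPath.isTrail.edges_nodup
  refine ⟨r.bypass, hnd.isChain, hsub, ?_⟩
  have := (hnd.subperm hsub).length_le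
  simp only [SimpleGraph.Walk.length_edges] at this
  rw [SimpleGraph.Walk.length_support]
  omega

end Girth

/-! ### Paths reached from a vertex, and disjointness by girth -/

namespace PathCover

variable {V : Type u} {G : SimpleGraph V} {K m : ℕ}

/-- The paths that can be reached from `v` by at most `t` alternations of an edge to the mate and a
segment of a path. -/
def reachSet (P : PathCover G) : ℕ → V → Set (Fin P.num)
  | 0, _ => ∅
  | t + 1, v => {c | P.mate v ∈ (P.walk c).support ∨
      ∃ b, P.mate v ∈ (P.walk b).support ∧
        ∃ x ∈ (P.walk b).support, x ≠ P.mate v ∧ c ∈ reachSet P t x}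

variable {P : PathCover G}

/-- Each recursive call of `localInput` lowers the level, so `t` rounds suffice. At level 0 the
label is constantly ∘, because actual levels start at 1. -/
theorem dependsOn_localInput (R : Finset Rule) : ∀ {t s : ℕ}, s ≤ t → ∀ v : V,
    DependsOn (fun ω : P.Outcome K m => P.localInput R ω s v) (P.reachSet t v) := by
  classical
  intro t
  induction t with
  | zero =>
    intro s hs v ω ω' _
    obtain rfl : s = 0 := by omega
    by_cases h : P.Covered (P.mate v)
    · obtain ⟨b, hb⟩ := h
      have h1 : ∀ ω : P.Outcome K m, 1 ≤ (ω b).level := fun ω => (ω b).level_mem.1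
      have h2 := h1 ω
      have h3 := h1 ω'
      simp only [localInput_eq hb]
      rw [if_neg (by omega), if_neg (by omega), if_neg (by omega), if_neg (by omega)]
    · simp only
      rw [localInput, localInput, dif_neg h, dif_neg h]
  | succ t ih =>
    intro s hs v ω ω' hω
    by_cases h : P.Covered (P.mate v)
    · obtain ⟨b, hb⟩ := h
      have hωb : ω b = ω' b := hω b (Or.inl hb)
      simp only [localInput_eq hb, ← hωb]
      split_ifs with h1
      · congr 2
        refine List.map_congr_left fun x hx => ?_
        split_ifs with hxm
        · rfl
        · refine ih (by omega) x fun c hc => hω c (Or.inr ⟨b, hb, x, hx, hxm, hc⟩)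
      · rfl
      · rfl
    · simp only
      rw [localInput, localInput, dif_neg h, dif_neg h]

/-- At most `t` mate edges alternate with at most `t - 1` segments of at most `M - 1` edges, in
total at most (t-1)M + 1 edges. There is no backtracking at the junctions because mate edges are not
contained in the paths. The information on the first and last edge is what allows such walks to be
glued. -/
theorem exists_walk_of_mem_reachSet {M : ℕ} (hM : ∀ j, (P.walk j).support.length ≤ M) :
    ∀ {t : ℕ} {v : V} {a c : Fin P.num}, v ∈ (P.walk a).support → c ∈ P.reachSet t v →
      ∃ x ∈ (P.walk c).support, ∃ q : G.Walk v x, q.edges.IsChain (· ≠ ·) ∧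
        (∀ e ∈ q.edges.head?, e = s(v, P.mate v)) ∧
        (∀ e ∈ q.edges.getLast?, e = s(x, P.mate x)) ∧ 0 < q.length ∧ q.length + M ≤ t * M + 1 := by
  intro t
  induction t with
  | zero => intro v a c _ hc; exact hc.elim
  | succ t ih =>
    intro v a c hv hc
    have hadj := P.mate_adj a v hv
    have hmm := P.mate_mate a v hv
    rcases hc with hc | ⟨b, hb, x₀, hx₀, hne, hc⟩
    · refine ⟨P.mate v, hc, SimpleGraph.Walk.cons hadj SimpleGraph.Walk.nil, ?_⟩
      refine ⟨by simp, by simp, by simp [hmm, Sym2.eq_swap], by simp, ?_⟩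
      simp only [SimpleGraph.Walk.length_cons, SimpleGraph.Walk.length_nil]
      nlinarith
    · obtain ⟨x, hx, q, hq, hhead, hlast, hpos, hlen⟩ := ih hx₀ hc
      obtain ⟨r, hr, hsub, hrlen⟩ := exists_segment hb hx₀
      have hrM := hM b
      have hrne : r.edges ≠ [] := by
        intro h
        rw [← List.length_eq_zero_iff, SimpleGraph.Walk.length_edges] at h
        exact hne (SimpleGraph.Walk.eq_of_length_eq_zero h).symm
      have hqne : q.edges ≠ [] := by
        rw [← List.length_pos_iff, SimpleGraph.Walk.length_edges]; exact hpos
      refine ⟨x, hx, SimpleGraph.Walk.cons hadj (r.append q), ?_, by simp, ?_, by simp, ?_⟩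
      · rw [SimpleGraph.Walk.edges_cons, SimpleGraph.Walk.edges_append, List.isChain_cons,
          List.isChain_append]
        refine ⟨?_, hr, hq, ?_⟩
        · intro e he heq
          rw [List.head?_append_of_ne_nil _ hrne] at he
          exact P.mate_edge a v hv b (heq ▸ hsub (List.mem_of_mem_head? he))
        · intro e he e' he' heq
          rw [hhead e' he'] at heq
          exact P.mate_edge b x₀ hx₀ b (heq ▸ hsub (List.mem_of_mem_getLast? he))
      · intro e he
        refine hlast e ?_
        rw [SimpleGraph.Walk.edges_cons, SimpleGraph.Walk.edges_append, ← List.cons_append,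
          List.getLast?_append_of_ne_nil _ hqne] at he
        exact he
      · rw [SimpleGraph.Walk.length_cons, SimpleGraph.Walk.length_append]
        nlinarith

theorem mul_length_lt {M t g : ℕ} (ht : t ≤ K) (hKM : 2 * K * M < g) : 2 * (t * M) < g := by
  have := Nat.mul_le_mul_right M ht
  nlinarith

/-- Otherwise a segment of the path `a` closes the walk to a non-backtracking one of positive length
at most tM < g. -/
theorem notMem_reachSet {g M t : ℕ} (hg : (g : ℕ∞) ≤ G.egirth)
    (hM : ∀ j, (P.walk j).support.length ≤ M) (ht : t ≤ K) (hKM : 2 * K * M < g) {v : V}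
    {a : Fin P.num} (hv : v ∈ (P.walk a).support) : a ∉ P.reachSet t v := by
  intro ha
  have htM := mul_length_lt ht hKM
  obtain ⟨x, hx, q, hq, -, hlast, hpos, hlen⟩ := exists_walk_of_mem_reachSet hM hv ha
  obtain ⟨r, hr, hsub, hrlen⟩ := exists_segment hx hv
  have hMa := hM a
  have h := length_eq_zero_of_isChain_edges hg (q.append r) ?_ ?_
  · rw [SimpleGraph.Walk.length_append] at h; omega
  · rw [SimpleGraph.Walk.edges_append, List.isChain_append]
    refine ⟨hq, hr, ?_⟩
    intro e he e' he' heq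
    rw [hlast e he] at heq
    exact P.mate_edge a x hx a (heq ▸ hsub (List.mem_of_mem_head? he'))
  · rw [SimpleGraph.Walk.length_append]; omega

theorem disjoint_reachSet {g M t : ℕ} (hg : (g : ℕ∞) ≤ G.egirth)
    (hM : ∀ j, (P.walk j).support.length ≤ M) (ht : t ≤ K) (hKM : 2 * K * M < g) {v v' : V}
    {a : Fin P.num} (hv : v ∈ (P.walk a).support) (hv' : v' ∈ (P.walk a).support) (hne : v ≠ v') :
    Disjoint (P.reachSet t v) (P.reachSet t v') := by
  rw [Set.disjoint_left]
  intro c hc hc'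
  have htM := mul_length_lt ht hKM
  obtain ⟨x, hx, q, hq, hhead, hlast, hpos, hlen⟩ := exists_walk_of_mem_reachSet hM hv hc
  obtain ⟨x', hx', q', hq', hhead', hlast', hpos', hlen'⟩ := exists_walk_of_mem_reachSet hM hv' hc'
  obtain ⟨r, hr, hsub, hrlen⟩ := exists_segment hv hv'
  obtain ⟨r', hr', hsub', hrlen'⟩ := exists_segment hx' hx
  have hMa := hM a
  have hMc := hM c
  have hrne : r.edges ≠ [] := by
    intro h
    rw [← List.length_eq_zero_iff, SimpleGraph.Walk.length_edges] at h
    exact hne (SimpleGraph.Walk.eq_of_length_eq_zero h)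
  have hqne' : q'.edges ≠ [] := by
    rw [← List.length_pos_iff, SimpleGraph.Walk.length_edges]; exact hpos'
  -- The closed walk has at most 2((t-1)M + 1) + 2(M-1) = 2tM < g edges. It is based at `x`, so the
  -- junction there needs no check; `r'` may be trivial, while `r` is not since `v ≠ v'`.
  have h := length_eq_zero_of_isChain_edges hg ((q.reverse.append r).append (q'.append r')) ?_ ?_
  · simp only [SimpleGraph.Walk.length_append] at h; omega
  · simp only [SimpleGraph.Walk.edges_append, SimpleGraph.Walk.edges_reverse, List.isChain_append]
    refine ⟨⟨?_, hr, ?_⟩, ⟨hq', hr', ?_⟩, ?_⟩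
    · rw [List.isChain_reverse]
      exact hq.imp fun _ _ h => h.symm
    · intro e he e' he' heq
      rw [List.getLast?_reverse] at he
      rw [hhead e he] at heq
      exact P.mate_edge a v hv a (heq ▸ hsub (List.mem_of_mem_head? he'))
    · intro e he e' he' heq
      rw [hlast' e he] at heq
      exact P.mate_edge c x' hx' c (heq ▸ hsub' (List.mem_of_mem_head? he'))
    · intro e he e' he' heq
      rw [List.getLast?_append_of_ne_nil _ hrne] at he
      rw [List.head?_append_of_ne_nil _ hqne'] at he'
      rw [hhead' e' he'] at heq
      exact P.mate_edge a v' hv' a (heq ▸ hsub (List.mem_of_mem_getLast? he))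
  · simp only [SimpleGraph.Walk.length_append, SimpleGraph.Walk.length_reverse]; omega

end PathCover

end CubicDomination

/-! ### The law of the labels, by induction on the level -/

namespace CubicDomination

noncomputable section

theorem wordExp_comm {p p' : Input → ℝ} (m n : ℕ) : ∀ f : List Input → List Input → ℝ,
    wordExp p m (fun s => wordExp p' n (fun t => f s t)) =
      wordExp p' n (fun t => wordExp p m (fun s => f s t)) := by
  induction m with
  | zero => intro f; rfl
  | succ m ih =>
    intro f
    simp only [wordExp, ih]
    rw [wordExp_sum]
    simp only [wordExp_const_mul]

namespace PathCover

variable {V : Type u} {G : SimpleGraph V} {K : ℕ} {P : PathCover G} {R : Finset Rule}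

/-- The expectation over the outcomes of the random choices. -/
def expectation (P : PathCover G) (R : Finset Rule) (K : ℕ)
    (f : P.Outcome K (maxLength R) → ℝ) : ℝ :=
  ∑ ω, P.outcomeProb R K ω * f ω

theorem expectation_eq_prodExp (f : P.Outcome K (maxLength R) → ℝ) :
    P.expectation R K f = prodExp (choiceProb R K) f := rfl

theorem outcomeProb_nonneg (hR : UniquelyMatching R) (ω : P.Outcome K (maxLength R)) :
    0 ≤ P.outcomeProb R K ω :=
  Finset.prod_nonneg fun _ _ => choiceProb_nonneg hR _

theorem sum_outcomeProb (hR : UniquelyMatching R) (hK : 0 < K) :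
    ∑ ω, P.outcomeProb R K ω = 1 :=
  sum_prod_eq_one (sum_choiceProb hR hK)

theorem expectation_mono (hR : UniquelyMatching R) {f g : P.Outcome K (maxLength R) → ℝ}
    (h : ∀ ω, f ω ≤ g ω) : P.expectation R K f ≤ P.expectation R K g :=
  Finset.sum_le_sum fun ω _ => mul_le_mul_of_nonneg_left (h ω) (outcomeProb_nonneg hR ω)

theorem expectation_sum {κ : Type*} (t : Finset κ) (f : κ → P.Outcome K (maxLength R) → ℝ) :
    P.expectation R K (fun ω => ∑ i ∈ t, f i ω) = ∑ i ∈ t, P.expectation R K (f i) :=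
  prodExp_sum t f

theorem expectation_const_add (hR : UniquelyMatching R) (hK : 0 < K) (c : ℝ)
    (f : P.Outcome K (maxLength R) → ℝ) :
    P.expectation R K (fun ω => c + f ω) = c + P.expectation R K f := by
  simp only [expectation, mul_add, Finset.sum_add_distrib, ← Finset.sum_mul,
    sum_outcomeProb hR hK, one_mul]

/-- The expected value of `φ` at a vertex of level `i`, if the inputs on its path are independent of
law `p_i`. -/
def meanValue (R : Finset Rule) (p : Input → ℝ) (φ : Input × Output → ℝ) : ℝ :=
  (∑ e ∈ expansion R, seqProb p e * (e.map φ).sum) / meanLength R p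

theorem meanValue_pairIndicator (p : Input → ℝ) (x : Option Input) (y : Option Output) :
    meanValue R p (pairIndicator x y) = meanCount R p x y / meanLength R p := by
  simp only [meanValue, meanCount, sum_map_pairIndicator]

/-- Only the level `i`, of probability 1/K, contributes, and there the padded word is in the
situation of `stationary_letterValue`. -/
theorem sum_choiceProb_wordExp (hR : UniquelyMatching R) {i L k : ℕ} (h1 : 1 ≤ i) (hi : i ≤ K)
    (hk : k < L) (φ : Input × Output → ℝ) :
    ∑ a : Choice K (maxLength R), choiceProb R K a * wordExp (levelInputProb R K i) L (fun s =>
      if a.level = i then φ (s.getD k Input.dot, paddedOutput R a s k) else 0) =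
      1 / (K : ℝ) * meanValue R (levelInputProb R K i) φ := by
  have hK : 0 < K := by omega
  have hp := sum_levelInputProb hR hK h1 hi
  have hp0 := levelInputProb_nonneg hR hK h1 hi
  have h := sum_choiceProb_pad (R := R) (K := K) (fun j s₁ s₃ =>
    wordExp (levelInputProb R K i) L (fun s₂ => if j = i then
      letterValue R φ (s₁.length + k) (s₁ ++ s₂ ++ s₃) else 0))
  rw [Finset.sum_eq_single_of_mem i (Finset.mem_Icc.2 ⟨h1, hi⟩)] at h
  · simp only [if_true] at h
    rw [meanValue, ← stationary_letterValue hR hp hp0 φ hk]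
    refine Eq.trans ?_ (h.trans ?_)
    · refine Finset.sum_congr rfl fun a _ => ?_
      congr 1
      refine wordExp_congr fun s hs => ?_
      rw [letterValue, paddedOutput, List.append_assoc, List.getD_append_right _ _ _ _ (by omega),
        List.getD_append _ _ _ _ (by omega), Nat.add_sub_cancel_left, ← List.append_assoc]
    · congr 1
      refine Finset.sum_congr rfl fun l _ => ?_
      congr 1
      refine wordExp_congr fun s₁ _ => ?_
      rw [wordExp_comm]
  · intro j hj hne
    rw [Finset.mem_Icc] at hj
    have hpj := sum_levelInputProb hR hK hj.1 hj.2
    simp [hne, wordExp_const hp, wordExp_const hpj]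

variable {g M : ℕ}

/-- The labels on the path `a` depend on pairwise disjoint sets of paths, none of which contains
`a`; so they may be replaced by independent letters, independent of `ω a`. -/
theorem expectation_path (hR : UniquelyMatching R) (hg : (g : ℕ∞) ≤ G.egirth)
    (hM : ∀ j, (P.walk j).support.length ≤ M) (hKM : 2 * K * M < g) (hK : 0 < K) {t : ℕ}
    (ht : t ≤ K) {p : Input → ℝ} {a : Fin P.num}
    (hlaw : ∀ v ∈ (P.walk a).support, ∀ x,
      P.expectation R K (fun ω => if P.localInput R ω t v = x then 1 else 0) = p x)
    (f : Choice K (maxLength R) → List Input → ℝ) :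
    P.expectation R K (fun ω => f (ω a) ((P.walk a).support.map (P.localInput R ω t))) =
      ∑ c, choiceProb R K c * wordExp p (P.walk a).support.length (f c) := by
  rw [expectation_eq_prodExp]
  refine prodExp_coord_list_map (X := fun v ω => P.localInput R ω t v) (S := P.reachSet t)
    (sum_choiceProb hR hK) (fun v _ => dependsOn_localInput R le_rfl v) ?_ hlaw
    (fun v hv => notMem_reachSet hg hM ht hKM hv) f
  refine List.Pairwise.imp_of_mem ?_ (P.isPath a).support_nodup
  intro v v' hv hv' hne
  exact disjoint_reachSet hg hM ht hKM hv hv' hne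

theorem expectation_level (hR : UniquelyMatching R) (hK : 0 < K) (a : Fin P.num) (f : ℕ → ℝ) :
    P.expectation R K (fun ω => f (ω a).level) = ∑ i ∈ Finset.Icc 1 K, 1 / (K : ℝ) * f i := by
  have h := prodExp_coord_list_map (ι := Fin P.num) (β := V) (X := fun _ _ => Input.dot)
    (S := fun _ => ∅) (l := []) (p := fun _ => 0) (j := a) (sum_choiceProb hR hK) (by simp)
    List.Pairwise.nil (by simp) (by simp) (fun c _ => f c.level)
  rw [expectation_eq_prodExp]
  refine h.trans ?_
  simp only [List.length_nil, wordExp]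
  exact sum_choiceProb_level hR hK f

/-- The law of the input label given to a vertex by a mate of lower level. -/
def toInputProb (R : Finset Rule) (p : Input → ℝ) : Input → ℝ
  | Input.plus => circOutputProb R p Output.oplus
  | Input.times => circOutputProb R p Output.otimes
  | Input.dot => circOutputProb R p Output.odot
  | Input.circ => 0

theorem meanValue_toInput (hR : UniquelyMatching R) {p : Input → ℝ} (hp : ∑ a, p a = 1)
    (hp0 : ∀ a, 0 ≤ p a) (x : Input) :
    meanValue R p (fun a => if a.1 = Input.circ ∧ a.2.toInput = x then 1 else 0) =
      toInputProb R p x * p Input.circ := by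
  have hQ := (meanLength_pos hR hp hp0).ne'
  have key : ∀ y : Output, meanValue R p (pairIndicator (some Input.circ) (some y)) =
      circOutputProb R p y * p Input.circ := by
    intro y
    rw [meanValue_pairIndicator, ← circOutputProb_mul hp0, meanCirc_eq_mul hR hp hp0, ← mul_assoc,
      mul_div_cancel_right₀ _ hQ]
  cases x
  · rw [toInputProb, ← key]
    congr 1; funext ⟨a, y⟩
    cases a <;> cases y <;> simp [pairIndicator, Output.toInput]
  · rw [toInputProb, ← key]
    congr 1; funext ⟨a, y⟩
    cases a <;> cases y <;> simp [pairIndicator, Output.toInput]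
  · rw [toInputProb, ← key]
    congr 1; funext ⟨a, y⟩
    cases a <;> cases y <;> simp [pairIndicator, Output.toInput]
  · have : ∀ a : Input × Output,
        (if a.1 = Input.circ ∧ a.2.toInput = Input.circ then (1 : ℝ) else 0) = 0 := by
      rintro ⟨a, y⟩
      cases y <;> simp [Output.toInput]
    simp [meanValue, this, toInputProb]

/-- The recursion for p_t, read as an average over the level `s` of the mate: lower, equal or
higher. -/
theorem sum_levels_toInputProb {t : ℕ} (h1 : 1 ≤ t) (ht : t ≤ K) (x : Input) :
    ∑ s ∈ Finset.Icc 1 K, 1 / (K : ℝ) * (if s < t then toInputProb R (levelInputProb R K s) x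
      else if s = t then (if Input.dot = x then 1 else 0)
      else if Input.circ = x then 1 else 0) = levelInputProb R K t x := by
  have hK' : (K : ℝ) ≠ 0 := by have : 0 < K := by omega
                               exact_mod_cast this.ne'
  have hsplit : Finset.Icc 1 K = Finset.Ico 1 t ∪ ({t} ∪ Finset.Icc (t + 1) K) := by
    ext s; simp only [Finset.mem_Icc, Finset.mem_union, Finset.mem_Ico, Finset.mem_singleton]; omega
  rw [hsplit, Finset.sum_union, Finset.sum_union, Finset.sum_singleton]
  · have e1 : ∀ f : ℕ → ℝ, ∑ s ∈ Finset.Ico 1 t, 1 / (K : ℝ) * (if s < t then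
        toInputProb R (levelInputProb R K s) x else f s) =
        ∑ s ∈ Finset.Ico 1 t, 1 / (K : ℝ) * toInputProb R (levelInputProb R K s) x := by
      intro f
      refine Finset.sum_congr rfl fun s hs => ?_
      rw [if_pos (Finset.mem_Ico.1 hs).2]
    have e2 : ∀ (f : ℕ → ℝ) (c d : ℝ), ∑ s ∈ Finset.Icc (t + 1) K, 1 / (K : ℝ) *
        (if s < t then f s else if s = t then c else d) = (1 - t / K) * d := by
      intro f c d
      rw [Finset.sum_congr rfl (g := fun _ => 1 / (K : ℝ) * d)]
      · rw [Finset.sum_const, Nat.card_Icc, nsmul_eq_mul, Nat.add_sub_add_right, Nat.cast_sub ht]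
        field_simp
      · intro s hs
        rw [Finset.mem_Icc] at hs
        rw [if_neg (by omega), if_neg (by omega)]
    rw [e1, e2, if_neg (lt_irrefl t), if_pos rfl]
    cases x
    · rw [levelInputProb_plus]; simp [toInputProb]
    · rw [levelInputProb_times]; simp [toInputProb]
    · rw [levelInputProb_dot]; simp [toInputProb]; ring
    · rw [levelInputProb_circ]; simp [toInputProb]
  · rw [Finset.disjoint_left]
    intro s hs hs'
    simp only [Finset.mem_Icc, Finset.mem_singleton] at hs hs'
    omega
  · rw [Finset.disjoint_left]
    intro s hs hs'
    simp only [Finset.mem_Icc, Finset.mem_singleton, Finset.mem_union, Finset.mem_Ico] at hs hs'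
    omega

theorem getD_map_idxOf {β : Type*} [DecidableEq V] {l : List V} {v : V} (hv : v ∈ l) (f : V → β)
    (d : β) : (l.map f).getD (l.idxOf v) d = f v := by
  have hlt := List.idxOf_lt_length_iff.2 hv
  rw [List.getD_eq_getElem _ _ (by simpa), List.getElem_map, List.getElem_idxOf hlt]

/-- The probability that the mate of `v` has level `s` and gives the input `x` to `v`, when `v` has
a higher level. -/
theorem expectation_lower_mate [DecidableEq V] (hR : UniquelyMatching R)
    (hg : (g : ℕ∞) ≤ G.egirth)
    (hM : ∀ j, (P.walk j).support.length ≤ M) (hKM : 2 * K * M < g) {s : ℕ}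
    (h1 : 1 ≤ s) (hs : s < K) {b : Fin P.num} {y : V} (hy : y ∈ (P.walk b).support)
    (hlaw : ∀ v ∈ (P.walk b).support, ∀ x,
      P.expectation R K (fun ω => if P.localInput R ω s v = x then 1 else 0) =
        levelInputProb R K s x) (x : Input) :
    P.expectation R K (fun ω => if (ω b).level = s ∧
      (paddedOutput R (ω b) ((P.walk b).support.map (fun z =>
        if z = y then Input.circ else P.localInput R ω s z))
        ((P.walk b).support.idxOf y)).toInput = x then 1 else 0) =
      1 / (K : ℝ) * toInputProb R (levelInputProb R K s) x := by
  have hK : 0 < K := by omega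
  have hp := sum_levelInputProb hR hK h1 hs.le
  have hp0 := levelInputProb_nonneg hR hK h1 hs.le
  have hk : (P.walk b).support.idxOf y < (P.walk b).support.length :=
    List.idxOf_lt_length_iff.2 hy
  have hcirc : levelInputProb R K s Input.circ ≠ 0 := by
    rw [levelInputProb_circ]
    have hK' : (0 : ℝ) < K := by exact_mod_cast hK
    have : (s : ℝ) / K < 1 := by rw [div_lt_one hK']; exact_mod_cast hs
    linarith
  -- In `A` the input of `y` is forced to be ∘, while `B` says that it really is ∘. They depend on
  -- disjoint sets of paths, so E[AB] = E[A] p_s(∘). Where `B` is 1 the forcing changes nothing, so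
  -- E[AB] also follows from the stationary law. Since s < K, the factor p_s(∘) is non-zero and can
  -- be cancelled.
  set A : P.Outcome K (maxLength R) → ℝ := fun ω => if (ω b).level = s ∧
      (paddedOutput R (ω b) ((P.walk b).support.map (fun z =>
        if z = y then Input.circ else P.localInput R ω s z))
        ((P.walk b).support.idxOf y)).toInput = x then 1 else 0 with hA
  set B : P.Outcome K (maxLength R) → ℝ :=
    fun ω => if P.localInput R ω s y = Input.circ then 1 else 0 with hB
  have hAB : P.expectation R K (fun ω => A ω * B ω) =
      P.expectation R K A * levelInputProb R K s Input.circ := by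
    rw [← hlaw y hy]
    refine prodExp_mul (sum_choiceProb hR hK)
      (S := {b} ∪ ⋃ z ∈ {z | z ∈ (P.walk b).support ∧ z ≠ y}, P.reachSet s z)
      (T := P.reachSet s y) ?_ ?_ ?_
    · intro ω ω' hω
      have hb : ω b = ω' b := hω b (Or.inl rfl)
      have hlab : (P.walk b).support.map (fun z =>
          if z = y then Input.circ else P.localInput R ω s z) =
          (P.walk b).support.map (fun z =>
          if z = y then Input.circ else P.localInput R ω' s z) := by
        refine List.map_congr_left fun z hz => ?_
        split_ifs with hzy
        · rfl
        · exact dependsOn_localInput R le_rfl z fun c hc =>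
            hω c (Or.inr (Set.mem_biUnion (show z ∈ {z | z ∈ (P.walk b).support ∧ z ≠ y} from
              ⟨hz, hzy⟩) hc))
      simp only [hA, hb, hlab]
    · intro ω ω' hω
      have : P.localInput R ω s y = P.localInput R ω' s y := dependsOn_localInput R le_rfl y hω
      simp only [hB, this]
    · rw [Set.disjoint_union_left, Set.disjoint_singleton_left, Set.disjoint_iUnion₂_left]
      exact ⟨notMem_reachSet hg hM hs.le hKM hy,
        fun z hz => disjoint_reachSet hg hM hs.le hKM hz.1 hy hz.2⟩
  have hAB' : P.expectation R K (fun ω => A ω * B ω) =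
      1 / (K : ℝ) * (toInputProb R (levelInputProb R K s) x *
        levelInputProb R K s Input.circ) := by
    rw [← meanValue_toInput hR hp hp0, ← sum_choiceProb_wordExp hR h1 hs.le hk,
      ← expectation_path hR hg hM hKM hK hs.le hlaw]
    congr 1
    funext ω
    rw [getD_map_idxOf hy]
    simp only [hA, hB]
    by_cases h : P.localInput R ω s y = Input.circ
    · have : (P.walk b).support.map (fun z =>
          if z = y then Input.circ else P.localInput R ω s z) =
          (P.walk b).support.map (P.localInput R ω s) := by
        refine List.map_congr_left fun z _ => ?_
        split_ifs with hzy
        · rw [hzy, h]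
        · rfl
      rw [this]
      simp only [h, true_and, if_true, mul_one, ite_and]
    · simp [h]
  rw [hAB'] at hAB
  exact (mul_right_cancel₀ hcirc (by rw [← hAB]; ring)).symm

/-- The label is split according to the level `s` of the path of the mate; for s < t the induction
hypothesis supplies the law of all labels on that path. -/
theorem expectation_localInput (hR : UniquelyMatching R) (hg : (g : ℕ∞) ≤ G.egirth)
    (hM : ∀ j, (P.walk j).support.length ≤ M) (hKM : 2 * K * M < g) :
    ∀ {t : ℕ}, 1 ≤ t → t ≤ K → ∀ {v : V}, P.Covered v → ∀ x : Input,
      P.expectation R K (fun ω => if P.localInput R ω t v = x then 1 else 0) =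
        levelInputProb R K t x := by
  classical
  intro t
  induction t using Nat.strong_induction_on with
  | _ t ih =>
    rintro h1 ht v ⟨a, hv⟩ x
    have hK : 0 < K := by omega
    obtain ⟨b, hb⟩ := P.mate_covered a v hv
    have hsum : ∀ ω : P.Outcome K (maxLength R),
        (if P.localInput R ω t v = x then (1 : ℝ) else 0) =
        ∑ s ∈ Finset.Icc 1 K, if s < t then
          (if (ω b).level = s ∧ (paddedOutput R (ω b) ((P.walk b).support.map (fun z =>
            if z = P.mate v then Input.circ else P.localInput R ω s z))
            ((P.walk b).support.idxOf (P.mate v))).toInput = x then 1 else 0)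
          else if (ω b).level = s then (if s = t then (if Input.dot = x then 1 else 0)
            else if Input.circ = x then 1 else 0) else 0 := by
      intro ω
      rw [Finset.sum_eq_single_of_mem (ω b).level (Finset.mem_Icc.2 (ω b).level_mem),
        localInput_eq hb]
      · simp only [true_and, if_true]
        split_ifs <;> rfl
      · intro s _ hs
        simp [hs.symm]
    simp only [hsum]
    rw [expectation_sum, ← sum_levels_toInputProb h1 ht x]
    refine Finset.sum_congr rfl fun s hs => ?_
    rw [Finset.mem_Icc] at hs
    by_cases hst : s < t
    · simp only [if_pos hst]
      exact expectation_lower_mate hR hg hM hKM hs.1 (by omega) hb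
        (fun z hz => ih s hst hs.1 hs.2 ⟨b, hz⟩) x
    · simp only [if_neg hst]
      rw [expectation_level hR hK b (fun l => if l = s then (if s = t then
        (if Input.dot = x then 1 else 0) else if Input.circ = x then 1 else 0) else 0),
        Finset.sum_eq_single_of_mem s (Finset.mem_Icc.2 hs), if_pos rfl]
      intro l _ hl
      simp [hl]

/-- The joint law of the final labels of a covered vertex. -/
theorem expectation_final (hR : UniquelyMatching R) (hg : (g : ℕ∞) ≤ G.egirth)
    (hM : ∀ j, (P.walk j).support.length ≤ M) (hKM : 2 * K * M < g) (hK : 0 < K) {v : V}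
    (hv : P.Covered v) (φ : Input × Output → ℝ) :
    P.expectation R K (fun ω => φ (P.finalInput R ω v, P.finalOutput R ω v)) =
      ∑ i ∈ Finset.Icc 1 K, 1 / (K : ℝ) * meanValue R (levelInputProb R K i) φ := by
  classical
  obtain ⟨a, ha⟩ := hv
  have hk : (P.walk a).support.idxOf v < (P.walk a).support.length :=
    List.idxOf_lt_length_iff.2 ha
  have hsum : ∀ ω : P.Outcome K (maxLength R),
      φ (P.finalInput R ω v, P.finalOutput R ω v) =
      ∑ i ∈ Finset.Icc 1 K, if (ω a).level = i then
        φ (((P.walk a).support.map (P.localInput R ω i)).getD ((P.walk a).support.idxOf v)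
          Input.dot, paddedOutput R (ω a) ((P.walk a).support.map (P.localInput R ω i))
          ((P.walk a).support.idxOf v)) else 0 := by
    intro ω
    rw [Finset.sum_eq_single_of_mem (ω a).level (Finset.mem_Icc.2 (ω a).level_mem), if_pos rfl,
      getD_map_idxOf ha, ← finalInput_eq_localInput _ rfl ha, finalOutput_eq_localInput ha]
    intro i _ hi
    rw [if_neg hi.symm]
  simp only [hsum]
  rw [expectation_sum]
  refine Finset.sum_congr rfl fun i hi => ?_
  rw [Finset.mem_Icc] at hi
  rw [← sum_choiceProb_wordExp hR hi.1 hi.2 hk φ, ← expectation_path hR hg hM hKM hK hi.2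
    (fun z hz => expectation_localInput hR hg hM hKM hi.1 hi.2 ⟨a, hz⟩)]

end PathCover

end

end CubicDomination

/-! ### The expected size of the dominating set -/

namespace CubicDomination

noncomputable section

namespace PathCover

variable {V : Type u} {G : SimpleGraph V} {K : ℕ} {P : PathCover G} {R : Finset Rule}

/-- The indicator of the labels of the vertices chosen because of their labels. -/
def chosenIndicator (a : Input × Output) : ℝ :=
  if a.1 = Input.plus ∨ a.2 = Output.otimes then 1 else 0

theorem chosenIndicator_eq (a : Input × Output) :
    chosenIndicator a = pairIndicator (some Input.plus) none a +
      pairIndicator none (some Output.otimes) a -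
      pairIndicator (some Input.plus) (some Output.otimes) a := by
  obtain ⟨x, y⟩ := a
  cases x <;> cases y <;> simp [chosenIndicator, pairIndicator]

/-- Inclusion-exclusion. The subtracted term is the only source of inequality in the main term; it
vanishes for non-wasteful rules. -/
theorem meanValue_chosenIndicator (hR : UniquelyMatching R) {p : Input → ℝ} (hp : ∑ a, p a = 1)
    (hp0 : ∀ a, 0 ≤ p a) : meanValue R p chosenIndicator = p Input.plus +
      outputProb R p Output.otimes -
      meanValue R p (pairIndicator (some Input.plus) (some Output.otimes)) := by
  have hQ := (meanLength_pos hR hp hp0).ne'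
  have h1 : p Input.plus = meanValue R p (pairIndicator (some Input.plus) none) := by
    rw [meanValue_pairIndicator, meanCount_input hR hp hp0, mul_div_cancel_right₀ _ hQ]
  rw [h1, outputProb_eq, ← meanValue_pairIndicator]
  simp only [meanValue, ← add_div, ← sub_div, ← Finset.sum_add_distrib, ← Finset.sum_sub_distrib,
    ← mul_add, ← mul_sub, ← List.sum_map_add]
  congr 1
  refine Finset.sum_congr rfl fun e he => ?_
  clear he
  congr 1
  rw [funext chosenIndicator_eq]
  induction e with
  | nil => simp
  | cons a e ih =>
    simp only [List.map_cons, List.sum_cons] at ih ⊢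
    rw [ih]; ring

/-- The probability that a covered vertex has input `+` and output `⊗`. -/
def wasteProb (R : Finset Rule) (K : ℕ) : ℝ :=
  ∑ i ∈ Finset.Icc 1 K, 1 / (K : ℝ) * meanValue R (levelInputProb R K i)
    (pairIndicator (some Input.plus) (some Output.otimes))

theorem wasteProb_nonneg (hR : UniquelyMatching R) (hK : 0 < K) : 0 ≤ wasteProb R K := by
  refine Finset.sum_nonneg fun i hi => ?_
  rw [Finset.mem_Icc] at hi
  have hp := sum_levelInputProb hR hK hi.1 hi.2
  have hp0 := levelInputProb_nonneg hR hK hi.1 hi.2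
  rw [meanValue_pairIndicator]
  have := meanCount_nonneg (R := R) hp0 (some Input.plus) (some Output.otimes)
  have := meanLength_pos hR hp hp0
  positivity

theorem wasteProb_eq_zero (hN : NonWasteful R) : wasteProb R K = 0 := by
  refine Finset.sum_eq_zero fun i _ => ?_
  rw [meanValue, Finset.sum_eq_zero, zero_div, mul_zero]
  intro e he
  rw [List.sum_eq_zero, mul_zero]
  intro x hx
  obtain ⟨⟨a, y⟩, ha, rfl⟩ := List.mem_map.1 hx
  rw [pairIndicator, if_neg]
  simp only [reduceCtorEq, Option.some.injEq, false_or, not_and]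
  rintro rfl rfl
  exact hN e he ha

theorem sum_meanValue_chosenIndicator (hR : UniquelyMatching R) (hc : Correct R) (hK : 0 < K) :
    ∑ i ∈ Finset.Icc 1 K, 1 / (K : ℝ) * meanValue R (levelInputProb R K i) chosenIndicator =
      density R K - wasteProb R K := by
  have h : ∀ i ∈ Finset.Icc 1 K,
      1 / (K : ℝ) * meanValue R (levelInputProb R K i) chosenIndicator =
      1 / (K : ℝ) * levelInputProb R K i Input.plus +
      1 / (K : ℝ) * levelOutputProb R K i Output.otimes -
      1 / (K : ℝ) * meanValue R (levelInputProb R K i)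
        (pairIndicator (some Input.plus) (some Output.otimes)) := by
    intro i hi
    rw [Finset.mem_Icc] at hi
    rw [meanValue_chosenIndicator hR (sum_levelInputProb hR hK hi.1 hi.2)
      (levelInputProb_nonneg hR hK hi.1 hi.2), levelOutputProb]
    ring
  rw [Finset.sum_congr rfl h, Finset.sum_sub_distrib, Finset.sum_add_distrib, ← Finset.mul_sum,
    sum_levelInputProb_plus hR hc hK, ← Finset.mul_sum, density, Finset.sum_add_distrib, wasteProb]
  ring

open Classical in
/-- The vertices that are not covered. -/
def uncovered [Fintype V] (P : PathCover G) : Finset V :=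
  Finset.univ.filter (fun v => ¬ P.Covered v)

open Classical in
/-- The number of covered vertices that are chosen because of their labels. -/
def chosenCount [Fintype V] (P : PathCover G) (R : Finset Rule) {m : ℕ} (ω : P.Outcome K m) : ℝ :=
  ∑ v ∈ (P.uncovered)ᶜ, chosenIndicator (P.finalInput R ω v, P.finalOutput R ω v)

theorem chosenCount_le [Fintype V] {m : ℕ} (ω : P.Outcome K m) :
    P.chosenCount R ω ≤ ((P.dominatingSet R ω).card : ℝ) := by
  classical
  rw [chosenCount]
  simp only [chosenIndicator]
  rw [← Finset.sum_filter, Finset.sum_const, nsmul_eq_mul, mul_one, Nat.cast_le]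
  refine Finset.card_le_card fun v hv => ?_
  rw [Finset.mem_filter] at hv
  rw [mem_dominatingSet]
  rcases hv.2 with h | h
  · exact Or.inr (Or.inl h)
  · exact Or.inr (Or.inr (Or.inl h))

theorem card_dominatingSet_le [Fintype V] {m : ℕ} (ω : P.Outcome K m) :
    ((P.dominatingSet R ω).card : ℝ) ≤
      (P.uncovered.card : ℝ) + 2 * (P.num : ℝ) + P.chosenCount R ω := by
  classical
  rw [chosenCount]
  simp only [chosenIndicator]
  rw [← Finset.sum_filter, Finset.sum_const, nsmul_eq_mul, mul_one]
  set C := (P.uncovered)ᶜ.filter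
    (fun v => P.finalInput R ω v = Input.plus ∨ P.finalOutput R ω v = Output.otimes) with hC
  have hsub : P.dominatingSet R ω ⊆ ((P.uncovered ∪ Finset.univ.image P.first) ∪
      Finset.univ.image P.last) ∪ C := by
    intro v hv
    rw [mem_dominatingSet] at hv
    by_cases hcov : P.Covered v
    · rcases hv with h | h | h | ⟨j, h | h⟩
      · exact absurd hcov h
      · simp [hC, uncovered, hcov, h]
      · simp [hC, uncovered, hcov, h]
      · simp [h]
      · simp [h]
    · simp [uncovered, hcov]
  have h1 := Finset.card_le_card hsub
  have h2 := Finset.card_union_le (((P.uncovered ∪ Finset.univ.image P.first) ∪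
      Finset.univ.image P.last)) C
  have h3 := Finset.card_union_le (P.uncovered ∪ Finset.univ.image P.first)
      (Finset.univ.image P.last)
  have h4 := Finset.card_union_le P.uncovered (Finset.univ.image P.first)
  have h5 : (Finset.univ.image P.first).card ≤ P.num := by
    simpa using Finset.card_image_le (s := Finset.univ) (f := P.first)
  have h6 : (Finset.univ.image P.last).card ≤ P.num := by
    simpa using Finset.card_image_le (s := Finset.univ) (f := P.last)
  have : (P.dominatingSet R ω).card ≤ P.uncovered.card + 2 * P.num + C.card := by omega
  exact_mod_cast this

theorem expectation_chosenCount [Fintype V] (hR : UniquelyMatching R) (hc : Correct R) {g M : ℕ}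
    (hg : (g : ℕ∞) ≤ G.egirth) (hM : ∀ j, (P.walk j).support.length ≤ M) (hKM : 2 * K * M < g)
    (hK : 0 < K) : P.expectation R K (P.chosenCount R) =
      ((Fintype.card V : ℝ) - P.uncovered.card) * (density R K - wasteProb R K) := by
  classical
  unfold chosenCount
  rw [expectation_sum, Finset.sum_congr rfl (g := fun _ => density R K - wasteProb R K),
    Finset.sum_const, nsmul_eq_mul, Finset.card_compl, Nat.cast_sub (Finset.card_le_univ _)]
  intro v hv
  have hcov : P.Covered v := by simpa [uncovered] using hv
  rw [expectation_final hR hg hM hKM hK hcov, sum_meanValue_chosenIndicator hR hc hK]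

/-- The size of D lies between `chosenCount` and `chosenCount` plus the uncovered vertices plus two
ends per path. The factor 1 + |density| pays for counting uncovered vertices and for omitting them
from the main term. -/
theorem expectedSize_bounds [Fintype V] (hR : UniquelyMatching R) (hc : Correct R) {g : ℕ}
    (hK : 0 < K) (hg0 : 0 < g) (hg : (g : ℕ∞) ≤ G.egirth) {c : ℝ} (hP : P.Admissible K g c) :
    P.expectedSize R K ≤ density R K * (Fintype.card V : ℝ) +
        ((1 + |density R K|) * c + (3 + 8 * K)) * ((Fintype.card V : ℝ) / g) ∧
      (NonWasteful R → |P.expectedSize R K - density R K * (Fintype.card V : ℝ)| ≤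
        ((1 + |density R K|) * c + (3 + 8 * K)) * ((Fintype.card V : ℝ) / g)) := by
  have hlen : ∀ j, (P.walk j).support.length ≤ (g - 1) / (2 * K) := by
    intro j
    have h := hP.length_lt j
    rw [lt_div_iff₀ (by positivity)] at h
    have h' : (P.walk j).support.length * (2 * K) < g := by exact_mod_cast h
    rw [Nat.le_div_iff_mul_le (by positivity)]
    omega
  have hKM : 2 * K * ((g - 1) / (2 * K)) < g := by
    have := Nat.mul_div_le (g - 1) (2 * K)
    omega
  have hE := expectation_chosenCount hR hc hg hlen hKM hK
  have hU : (P.uncovered.card : ℝ) ≤ c * ((Fintype.card V : ℝ) / g) := hP.uncovered_le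
  have hnum := hP.num_le
  have hUn : (P.uncovered.card : ℝ) ≤ Fintype.card V := by
    exact_mod_cast Finset.card_le_univ P.uncovered
  have hU0 : (0 : ℝ) ≤ P.uncovered.card := Nat.cast_nonneg _
  have hg' : (0 : ℝ) < g := by exact_mod_cast hg0
  have hnum' : 2 * (P.num : ℝ) ≤ (3 + 8 * K) * ((Fintype.card V : ℝ) / g) := by
    calc 2 * (P.num : ℝ) ≤ 2 * ((3 + 8 * (K : ℝ)) / (2 * (g : ℝ)) * (Fintype.card V : ℝ)) := by
          linarith
      _ = _ := by field_simp
  have hupper : P.expectedSize R K ≤ (P.uncovered.card : ℝ) + 2 * (P.num : ℝ) +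
      ((Fintype.card V : ℝ) - P.uncovered.card) * (density R K - wasteProb R K) := by
    rw [← hE, ← expectation_const_add hR hK]
    exact expectation_mono hR card_dominatingSet_le
  have hlower : ((Fintype.card V : ℝ) - P.uncovered.card) * (density R K - wasteProb R K) ≤
      P.expectedSize R K := by
    rw [← hE]
    exact expectation_mono hR chosenCount_le
  have hw := wasteProb_nonneg hR hK
  have hd1 := le_abs_self (density R K)
  have hd2 := neg_abs_le (density R K)
  have hUd : (1 + |density R K|) * (P.uncovered.card : ℝ) ≤
      (1 + |density R K|) * c * ((Fintype.card V : ℝ) / g) := by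
    rw [mul_assoc]
    exact mul_le_mul_of_nonneg_left hU (by positivity)
  have hU1 : (P.uncovered.card : ℝ) * density R K ≤ P.uncovered.card * |density R K| :=
    mul_le_mul_of_nonneg_left hd1 hU0
  have hU2 : (P.uncovered.card : ℝ) * -|density R K| ≤ P.uncovered.card * density R K :=
    mul_le_mul_of_nonneg_left hd2 hU0
  have hle : P.expectedSize R K ≤ density R K * (Fintype.card V : ℝ) +
        ((1 + |density R K|) * c + (3 + 8 * K)) * ((Fintype.card V : ℝ) / g) := by
    have := mul_nonneg (sub_nonneg.2 hUn) hw
    linarith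
  refine ⟨hle, fun hN => ?_⟩
  rw [wasteProb_eq_zero hN] at hlower
  rw [abs_le]
  constructor <;> linarith

end PathCover

end

end CubicDomination

/-! ### Near-perfect matchings from Tutte's theorem -/

namespace CubicDomination

open Classical in
/-- The neighbours of a vertex. -/
noncomputable def nbrs {V : Type*} [Fintype V] (G : SimpleGraph V) (v : V) : Finset V :=
  Finset.univ.filter (fun w => G.Adj v w)

section

variable {V : Type u} [Fintype V] {G : SimpleGraph V}

@[simp] theorem mem_nbrs {v w : V} : w ∈ nbrs G v ↔ G.Adj v w := by simp [nbrs]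

theorem card_nbrs_of_regular [DecidableRel G.Adj] {d : ℕ} (h : G.IsRegularOfDegree d) (v : V) :
    (nbrs G v).card = d := by
  rw [← h v, ← SimpleGraph.card_neighborFinset_eq_degree]
  congr 1
  ext w
  simp

open Classical in
theorem sum_card_nbrs (G : SimpleGraph V) : ∑ v, (nbrs G v).card = 2 * G.edgeSet.ncard := by
  rw [← SimpleGraph.coe_edgeFinset, Set.ncard_coe_finset,
    ← SimpleGraph.sum_degrees_eq_twice_card_edges]
  refine Finset.sum_congr rfl fun v _ => ?_
  rw [← SimpleGraph.card_neighborFinset_eq_degree]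
  congr 1
  ext w
  simp

open Classical in
theorem sum_card_nbrs_inter_comm (G : SimpleGraph V) (S T : Finset V) :
    ∑ v ∈ S, (nbrs G v ∩ T).card = ∑ v ∈ T, (nbrs G v ∩ S).card := by
  have h : ∀ A B : Finset V, ∑ v ∈ A, (nbrs G v ∩ B).card =
      ∑ v ∈ A, ∑ w ∈ B, if G.Adj v w then 1 else 0 := by
    intro A B
    refine Finset.sum_congr rfl fun v _ => ?_
    rw [← Finset.card_filter]
    congr 1
    ext w
    simp [and_comm]
  rw [h, h, Finset.sum_comm]
  simp only [G.adj_comm]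

open Classical in
-- A forest extends to a spanning tree of the complete graph.
theorem ncard_edgeSet_add_one_le {A : Type*} [Fintype A] [Nonempty A] {F : SimpleGraph A}
    (hF : F.IsAcyclic) : F.edgeSet.ncard + 1 ≤ Fintype.card A := by
  obtain ⟨T, hle, -, hT⟩ :=
    (SimpleGraph.connected_top (V := A)).exists_isTree_le_of_le_of_isAcyclic le_top hF
  rw [← hT.card_edgeFinset, ← SimpleGraph.coe_edgeFinset, Set.ncard_coe_finset]
  exact Nat.add_le_add_right (Finset.card_le_card (SimpleGraph.edgeFinset_mono hle)) 1

open Classical in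
theorem sum_card_nbrs_inter (G : SimpleGraph V) (A : Finset V) :
    ∑ v ∈ A, (nbrs G v ∩ A).card = 2 * (G.induce (A : Set V)).edgeSet.ncard := by
  rw [← sum_card_nbrs (G.induce (A : Set V)), ← Finset.sum_coe_sort A]
  refine Finset.sum_congr rfl fun v _ => ?_
  rw [← Finset.card_map (Function.Embedding.subtype (fun x => x ∈ (A : Set V)))]
  congr 1
  ext w
  simp [and_comm]

open Classical in
/-- In a graph with girth at least `g`, a set of vertices with at least as many edges as vertices
has at least `g` elements. -/
theorem girth_le_card {g : ℕ} (hg : (g : ℕ∞) ≤ G.egirth) {A : Finset V} (hA : A.Nonempty)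
    (h : 2 * A.card ≤ ∑ v ∈ A, (nbrs G v ∩ A).card) : g ≤ A.card := by
  have : Nonempty (A : Set V) := hA.to_subtype
  have hcyc : ¬ (G.induce (A : Set V)).IsAcyclic := by
    intro hac
    have h1 := ncard_edgeSet_add_one_le hac
    rw [sum_card_nbrs_inter] at h
    have h2 : Fintype.card (A : Set V) = A.card := by simp
    omega
  unfold SimpleGraph.IsAcyclic at hcyc
  push Not at hcyc
  obtain ⟨v, c, hc⟩ := hcyc
  have h1 := SimpleGraph.le_egirth.1 hg _ _
    (hc.map (f := (SimpleGraph.Embedding.induce (A : Set V)).toHom) Subtype.val_injective)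
  rw [SimpleGraph.Walk.length_map, Nat.cast_le] at h1
  have h2 := hc.support_nodup.length_le_card
  have h3 : Fintype.card (A : Set V) = A.card := by simp
  simp only [List.length_tail, SimpleGraph.Walk.length_support, Nat.add_sub_cancel] at h2
  omega

open Classical in
/-- The number of odd sets of vertices whose outer neighbours all lie in `S`. -/
theorem card_odd_family_le {g : ℕ} (hg : (g : ℕ∞) ≤ G.egirth) (hreg : ∀ v, (nbrs G v).card = 3)
    {κ : Type*} {T : Finset κ} {A : κ → Finset V} {S : Finset V}
    (hdisj : (T : Set κ).PairwiseDisjoint A) (hodd : ∀ c ∈ T, Odd (A c).card)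
    (hAS : ∀ c ∈ T, Disjoint (A c) S)
    (hcl : ∀ c ∈ T, ∀ v ∈ A c, ∀ w, G.Adj v w → w ∈ A c ∨ w ∈ S) :
    3 * g * T.card ≤ 3 * g * S.card + 2 * Fintype.card V := by
  -- The number of edges from `A c` to `S` is 3|A c| minus twice the number of inner edges, hence
  -- odd. If it is at least 3, the first term suffices. If it is 1, the inner degrees sum to 3|A c|
  -- - 1 ≥ 2|A c|, and the girth gives |A c| ≥ g.
  have key : ∀ c ∈ T, 3 * g ≤ g * ∑ v ∈ A c, (nbrs G v ∩ S).card + 2 * (A c).card := by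
    intro c hc
    have h3 : 3 * (A c).card =
        ∑ v ∈ A c, (nbrs G v ∩ A c).card + ∑ v ∈ A c, (nbrs G v ∩ S).card := by
      rw [← Finset.sum_add_distrib, mul_comm, ← smul_eq_mul, ← Finset.sum_const]
      refine Finset.sum_congr rfl fun v hv => ?_
      rw [← hreg v, ← Finset.card_union_of_disjoint]
      · congr 1
        ext w
        simp only [Finset.mem_union, Finset.mem_inter, mem_nbrs]
        have := hcl c hc v hv w
        tauto
      · exact (hAS c hc).mono Finset.inter_subset_right Finset.inter_subset_right
    have h2 := sum_card_nbrs_inter G (A c)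
    obtain ⟨k, hk⟩ := hodd c hc
    by_cases hb : 3 ≤ ∑ v ∈ A c, (nbrs G v ∩ S).card
    · have := Nat.mul_le_mul_left g hb
      omega
    · have hb1 : ∑ v ∈ A c, (nbrs G v ∩ S).card = 1 := by omega
      have := girth_le_card hg (A := A c) (Finset.card_pos.1 (by omega)) (by omega)
      rw [hb1]
      omega
  have hsum := Finset.sum_le_sum key
  rw [Finset.sum_const, smul_eq_mul, Finset.sum_add_distrib, ← Finset.mul_sum, ← Finset.mul_sum,
    ← Finset.sum_biUnion hdisj, ← Finset.card_biUnion hdisj] at hsum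
  have h1 : ∑ v ∈ T.biUnion A, (nbrs G v ∩ S).card ≤ 3 * S.card := by
    rw [sum_card_nbrs_inter_comm, mul_comm, ← smul_eq_mul, ← Finset.sum_const]
    refine Finset.sum_le_sum fun v _ => ?_
    rw [← hreg v]
    exact Finset.card_le_card Finset.inter_subset_left
  have h2 : (T.biUnion A).card ≤ Fintype.card V := Finset.card_le_univ _
  have h3 := Nat.mul_le_mul_left g h1
  nlinarith

/-- The graph `G` with `d` additional vertices that are adjacent to all vertices. -/
def withUniversal {V : Type*} (G : SimpleGraph V) (d : ℕ) : SimpleGraph (V ⊕ Fin d) where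
  Adj
    | Sum.inl v, Sum.inl w => G.Adj v w
    | a, b => a ≠ b
  symm := ⟨by
    rintro (v | i) (w | j) h
    · exact G.adj_symm h
    · exact Ne.symm h
    · exact Ne.symm h
    · exact Ne.symm h⟩
  loopless := ⟨by
    rintro (v | i) h
    · exact G.irrefl h
    · exact h rfl⟩

theorem withUniversal_adj_inr {V : Type*} {G : SimpleGraph V} {d : ℕ} {x : V ⊕ Fin d} {j : Fin d} (h : x ≠ Sum.inr j) :
    (withUniversal G d).Adj x (Sum.inr j) := by
  rcases x with v | i <;> exact h

open Classical in
-- By parity a violator `u` leaves at least |u| + 2 odd components. A universal vertex outside `u`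
-- would leave at most one component. So `u` contains all `d` of them, and |S| + d + 2 odd
-- components, with S the part of `u` in `V`, contradict `card_odd_family_le`.
theorem not_isTutteViolator {g : ℕ} (hg : (g : ℕ∞) ≤ G.egirth)
    (hreg : ∀ v, (nbrs G v).card = 3) {d : ℕ} (hd : Even d)
    (hgd : 2 * Fintype.card V < 3 * g * (d + 2)) (u : Set (V ⊕ Fin d)) :
    ¬ (withUniversal G d).IsTutteViolator u := by
  intro hu
  unfold SimpleGraph.IsTutteViolator at hu
  set L := ((⊤ : (withUniversal G d).Subgraph).deleteVerts u).coe with hL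
  have hLadj : ∀ x y, L.Adj x y ↔ (withUniversal G d).Adj x.1 y.1 := by
    intro x y
    have hx := x.2.2
    have hy := y.2.2
    simp [hL, hx, hy]
  have hmem : ∀ x, x ∈ ((⊤ : (withUniversal G d).Subgraph).deleteVerts u).verts ↔ x ∉ u := by
    intro x; simp
  have hpar : Even L.oddComponents.ncard ↔ Even u.ncard := by
    have h1 := SimpleGraph.odd_ncard_oddComponents (G := L)
    have hneven : Even (Fintype.card V) := by
      have h := sum_card_nbrs G
      rw [Finset.sum_congr rfl fun v _ => hreg v, Finset.sum_const, smul_eq_mul,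
        Finset.card_univ] at h
      rw [Nat.even_iff]; omega
    have h2 : Nat.card ((⊤ : (withUniversal G d).Subgraph).deleteVerts u).verts + u.ncard =
        Fintype.card V + d := by
      have h3 : ((⊤ : (withUniversal G d).Subgraph).deleteVerts u).verts = uᶜ := by
        ext x; simp
      rw [Nat.card_coe_set_eq, h3, add_comm, Set.ncard_add_ncard_compl]
      simp
    rw [Nat.even_iff] at hd hneven
    rw [Nat.odd_iff, Nat.odd_iff] at h1
    rw [Nat.even_iff, Nat.even_iff]
    omega
  by_cases hj : ∃ j : Fin d, Sum.inr j ∉ u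
  · obtain ⟨j, hj⟩ := hj
    have hsub : L.oddComponents.ncard ≤ 1 := by
      rw [Set.ncard_le_one_iff]
      have hreach : ∀ x, L.Reachable x ⟨Sum.inr j, (hmem _).2 hj⟩ := by
        intro x
        by_cases hx : x.1 = Sum.inr j
        · have : x = ⟨Sum.inr j, (hmem _).2 hj⟩ := Subtype.ext hx
          rw [this]
        · exact SimpleGraph.Adj.reachable ((hLadj _ _).2 (withUniversal_adj_inr hx))
      intro a b _ _
      induction a using SimpleGraph.ConnectedComponent.ind with | _ x =>
      induction b using SimpleGraph.ConnectedComponent.ind with | _ y =>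
      exact SimpleGraph.ConnectedComponent.sound ((hreach x).trans (hreach y).symm)
    rw [Nat.even_iff, Nat.even_iff] at hpar
    omega
  · push Not at hj
    set S : Finset V := Finset.univ.filter (fun v => Sum.inl v ∈ u) with hS
    have hucard : S.card + d ≤ u.ncard := by
      have h1 : (S.disjSum (Finset.univ : Finset (Fin d))).card = S.card + d := by simp
      rw [← h1, ← Set.ncard_coe_finset]
      refine Set.ncard_le_ncard ?_ (Set.toFinite u)
      rintro (v | j) hx
      · simpa [hS] using hx
      · exact hj j
    let A : L.ConnectedComponent → Finset V := fun c =>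
      Finset.univ.filter (fun v => ∃ x, x ∈ c.supp ∧ x.1 = Sum.inl v)
    have hmemA : ∀ c v, v ∈ A c ↔ ∃ x, x ∈ c.supp ∧ x.1 = Sum.inl v := by intro c v; simp [A]
    have hAcard : ∀ c, (A c).card = c.supp.ncard := by
      intro c
      rw [← Set.ncard_coe_finset]
      symm
      have hinl : ∀ x : ((⊤ : (withUniversal G d).Subgraph).deleteVerts u).verts,
          ∃ v, x.1 = Sum.inl v := by
        rintro ⟨v | j, hx⟩
        · exact ⟨v, rfl⟩
        · exact absurd (hj j) ((hmem _).1 hx)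
      choose f hf using hinl
      refine Set.ncard_congr (fun x _ => f x) ?_ ?_ ?_
      · intro x hx
        exact (hmemA c _).2 ⟨x, hx, hf x⟩
      · intro x y _ _ hxy
        exact Subtype.ext ((hf x).trans ((congrArg Sum.inl hxy).trans (hf y).symm))
      · intro v hv
        obtain ⟨x, hx, hxv⟩ := (hmemA c v).1 hv
        exact ⟨x, hx, Sum.inl_injective ((hf x).symm.trans hxv)⟩
    have hfin : (L.oddComponents).Finite := Set.toFinite _
    have hT := card_odd_family_le hg hreg (T := hfin.toFinset) (A := A) (S := S) ?_ ?_ ?_ ?_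
    · rw [← Set.ncard_eq_toFinset_card _ hfin] at hT
      rw [Nat.even_iff, Nat.even_iff] at hpar
      have h1 : S.card + d + 2 ≤ L.oddComponents.ncard ∨ u.ncard + 1 = L.oddComponents.ncard := by
        omega
      rcases h1 with h1 | h1
      · have := Nat.mul_le_mul_left (3 * g) h1
        nlinarith
      · omega
    · intro c _ c' _ hne
      rw [Function.onFun, Finset.disjoint_left]
      intro v hv hv'
      obtain ⟨x, hx, hxv⟩ := (hmemA c v).1 hv
      obtain ⟨y, hy, hyv⟩ := (hmemA c' v).1 hv'
      obtain rfl : x = y := Subtype.ext (hxv.trans hyv.symm)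
      exact hne (hx.symm.trans hy)
    · intro c hc
      rw [hAcard]
      simpa using hc
    · intro c _
      rw [Finset.disjoint_left]
      intro v hv hvS
      obtain ⟨x, hx, hxv⟩ := (hmemA c v).1 hv
      have := (hmem _).1 x.2
      rw [hxv] at this
      exact this (by simpa [hS] using hvS)
    · intro c _ v hv w hvw
      by_cases hw : Sum.inl w ∈ u
      · exact Or.inr (by simpa [hS] using hw)
      · refine Or.inl ((hmemA c w).2 ⟨⟨Sum.inl w, (hmem _).2 hw⟩, ?_, rfl⟩)
        obtain ⟨x, hx, hxv⟩ := (hmemA c v).1 hv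
        have hadj : L.Adj ⟨Sum.inl w, (hmem _).2 hw⟩ x := by
          rw [hLadj, hxv]
          exact hvw.symm
        exact (SimpleGraph.ConnectedComponent.sound hadj.reachable).trans hx

open Classical in
/-- A cubic graph with girth at least `g` has a matching that misses at most `2n / (3g)` of the
vertices. -/
theorem exists_near_perfect_matching {g : ℕ} (hg0 : 0 < g) (hg : (g : ℕ∞) ≤ G.egirth)
    (hreg : ∀ v, (nbrs G v).card = 3) : ∃ (U : Finset V) (mate : V → V),
      3 * g * U.card ≤ 2 * Fintype.card V ∧
      ∀ v ∉ U, mate v ∉ U ∧ mate (mate v) = v ∧ G.Adj v (mate v) := by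
  -- The largest even number with 3gd ≤ 2n; at most `d` vertices are matched to added vertices, and
  -- these form the exceptional set.
  set d := 2 * (Fintype.card V / (3 * g)) with hd
  have hd1 : 2 * Fintype.card V < 3 * g * (d + 2) := by
    have := Nat.lt_mul_div_succ (Fintype.card V) (show 0 < 3 * g by omega)
    rw [hd]
    nlinarith
  have hd2 : 3 * g * d ≤ 2 * Fintype.card V := by
    have := Nat.mul_div_le (Fintype.card V) (3 * g)
    rw [hd]
    nlinarith
  obtain ⟨M, hM⟩ := SimpleGraph.tutte.2
    (not_isTutteViolator hg hreg (d := d) ⟨Fintype.card V / (3 * g), by omega⟩ hd1)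
  rw [SimpleGraph.Subgraph.isPerfectMatching_iff] at hM
  choose π hπ hπu using hM
  have hπu' : ∀ x y, M.Adj x y → y = π x := fun x y h => hπu x y h
  have hinv : ∀ x, π (π x) = x := fun x => (hπu' _ _ (hπ x).symm).symm
  refine ⟨Finset.univ.filter (fun v => ∃ j, π (Sum.inl v) = Sum.inr j),
    fun v => Sum.elim id (fun _ => v) (π (Sum.inl v)), ?_, ?_⟩
  · refine le_trans (Nat.mul_le_mul_left _ ?_) hd2
    rw [← Fintype.card_coe]
    refine le_of_le_of_eq ?_ (Fintype.card_fin d)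
    have hex : ∀ v : {v // v ∈ Finset.univ.filter (fun v => ∃ j, π (Sum.inl v) = Sum.inr j)},
        ∃ j, π (Sum.inl v.1) = Sum.inr j := fun v => (Finset.mem_filter.1 v.2).2
    choose f hf using hex
    refine Fintype.card_le_of_injective f fun v w h => ?_
    have h1 : π (Sum.inl v.1) = π (Sum.inl w.1) := by rw [hf, hf, h]
    have h2 := congrArg π h1
    rw [hinv, hinv] at h2
    exact Subtype.ext (Sum.inl_injective h2)
  · intro v hv
    rcases hpv : π (Sum.inl v) with w | j
    · have hw : π (Sum.inl w) = Sum.inl v := by rw [← hpv, hinv]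
      simp only [hpv, Sum.elim_inl, id_eq, hw, Finset.mem_filter, Finset.mem_univ, true_and,
        reduceCtorEq, exists_false, not_false_eq_true]
      have := (hπ (Sum.inl v)).adj_sub
      rw [hpv] at this
      exact this
    · exact absurd (Finset.mem_filter.2 ⟨Finset.mem_univ v, j, hpv⟩) hv

end

end CubicDomination

/-! ### Partitions into few short paths -/

namespace CubicDomination

section

variable {V : Type u} {H : SimpleGraph V}

/-- Vertex-disjoint paths with at most `m` vertices that cover exactly the vertices in `W`. -/
structure PathPartition (H : SimpleGraph V) (W : Finset V) (m : ℕ) (T : Finset (List V)) :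
    Prop where
  ne_nil : ∀ l ∈ T, l ≠ []
  nodup : ∀ l ∈ T, l.Nodup
  isChain : ∀ l ∈ T, l.IsChain H.Adj
  length_le : ∀ l ∈ T, l.length ≤ m
  disjoint : ∀ l ∈ T, ∀ l' ∈ T, ∀ v, v ∈ l → v ∈ l' → l = l'
  cover : ∀ v, v ∈ W ↔ ∃ l ∈ T, v ∈ l

theorem exists_minimal_pathPartition (H : SimpleGraph V) (W : Finset V) {m : ℕ} (hm : 1 ≤ m) :
    ∃ T, PathPartition H W m T ∧ ∀ T', PathPartition H W m T' → T.card ≤ T'.card := by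
  classical
  have h0 : PathPartition H W m (W.image (fun v => [v])) := by
    constructor
    · intro l hl; obtain ⟨v, -, rfl⟩ := Finset.mem_image.1 hl; simp
    · intro l hl; obtain ⟨v, -, rfl⟩ := Finset.mem_image.1 hl; simp
    · intro l hl; obtain ⟨v, -, rfl⟩ := Finset.mem_image.1 hl; simp
    · intro l hl; obtain ⟨v, -, rfl⟩ := Finset.mem_image.1 hl; simpa
    · intro l hl l' hl' v hv hv'
      obtain ⟨x, -, rfl⟩ := Finset.mem_image.1 hl
      obtain ⟨y, -, rfl⟩ := Finset.mem_image.1 hl'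
      rw [List.mem_singleton] at hv hv'
      rw [← hv, ← hv']
    · intro v; simp
  obtain ⟨T, hT, hmin⟩ := WellFounded.has_min (measure (Finset.card (α := List V))).wf
    {T | PathPartition H W m T} ⟨_, h0⟩
  exact ⟨T, hT, fun T' hT' => not_lt.1 (hmin T' hT')⟩

open Classical in
-- For `P ≠ Q` the new partition has fewer paths, which is how minimality is contradicted.
theorem PathPartition.merge {W : Finset V} {m : ℕ} {T : Finset (List V)}
    (hT : PathPartition H W m T) {P Q : List V} (hP : P ∈ T) (hQ : Q ∈ T)
    {l : List V} (hne : l ≠ []) (hnd : l.Nodup) (hch : l.IsChain H.Adj) (hlen : l.length ≤ m)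
    (hmem : ∀ v, v ∈ l ↔ v ∈ P ∨ v ∈ Q) :
    PathPartition H W m (insert l ((T.erase P).erase Q)) := by
  have hT' : ∀ l' ∈ insert l ((T.erase P).erase Q),
      l' = l ∨ (l' ∈ T ∧ l' ≠ P ∧ l' ≠ Q) := by
    intro l' hl'
    simp only [Finset.mem_insert, Finset.mem_erase] at hl'
    tauto
  have hdis : ∀ l' ∈ T, l' ≠ P → l' ≠ Q → ∀ v ∈ l', v ∉ l := by
    intro l' hl' h1 h2 v hv hvl
    rcases (hmem v).1 hvl with h | h
    · exact h1 (hT.disjoint _ hl' _ hP v hv h)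
    · exact h2 (hT.disjoint _ hl' _ hQ v hv h)
  constructor
  · intro l' hl'
    rcases hT' l' hl' with rfl | h
    · exact hne
    · exact hT.ne_nil _ h.1
  · intro l' hl'
    rcases hT' l' hl' with rfl | h
    · exact hnd
    · exact hT.nodup _ h.1
  · intro l' hl'
    rcases hT' l' hl' with rfl | h
    · exact hch
    · exact hT.isChain _ h.1
  · intro l' hl'
    rcases hT' l' hl' with rfl | h
    · exact hlen
    · exact hT.length_le _ h.1
  · intro l' hl' l'' hl'' v hv hv'
    rcases hT' l' hl' with rfl | h
    · rcases hT' l'' hl'' with rfl | h'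
      · rfl
      · exact absurd hv (hdis _ h'.1 h'.2.1 h'.2.2 v hv')
    · rcases hT' l'' hl'' with rfl | h'
      · exact absurd hv' (hdis _ h.1 h.2.1 h.2.2 v hv)
      · exact hT.disjoint _ h.1 _ h'.1 v hv hv'
  · intro v
    rw [hT.cover]
    constructor
    · rintro ⟨l', hl', hv⟩
      by_cases h : l' = P ∨ l' = Q
      · refine ⟨l, Finset.mem_insert_self _ _, (hmem v).2 ?_⟩
        rcases h with rfl | rfl
        · exact Or.inl hv
        · exact Or.inr hv
      · push Not at h
        exact ⟨l', by simp [h.1, h.2, hl'], hv⟩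
    · rintro ⟨l', hl', hv⟩
      rcases hT' l' hl' with rfl | h
      · rcases (hmem v).1 hv with h | h
        · exact ⟨P, hP, h⟩
        · exact ⟨Q, hQ, h⟩
      · exact ⟨l', h.1, hv⟩

theorem exists_orientation_getLast {P : List V} {v : V} (hch : P.IsChain H.Adj)
    (hv : P.head? = some v ∨ P.getLast? = some v) :
    ∃ P' : List V, P'.Perm P ∧ P'.IsChain H.Adj ∧ P'.getLast? = some v := by
  rcases hv with h | h
  · refine ⟨P.reverse, P.reverse_perm, ?_, by rw [List.getLast?_reverse, h]⟩
    rw [List.isChain_reverse]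
    exact hch.imp fun _ _ h => h.symm
  · exact ⟨P, List.Perm.refl _, hch, h⟩

/-- In a partition with the minimal number of paths, paths with adjacent ends have more than `m`
vertices together. -/
theorem PathPartition.length_add_length {W : Finset V} {m : ℕ} {T : Finset (List V)}
    (hT : PathPartition H W m T) (hmin : ∀ T', PathPartition H W m T' → T.card ≤ T'.card)
    {P Q : List V} (hP : P ∈ T) (hQ : Q ∈ T) (hPQ : P ≠ Q) {v w : V}
    (hv : P.head? = some v ∨ P.getLast? = some v) (hw : Q.head? = some w ∨ Q.getLast? = some w)
    (hadj : H.Adj v w) : m + 1 ≤ P.length + Q.length := by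
  classical
  by_contra hlt
  obtain ⟨P', hPP', hP'ch, hP'v⟩ := exists_orientation_getLast (hT.isChain P hP) hv
  obtain ⟨Q', hQQ', hQ'ch, hQ'w⟩ := exists_orientation_getLast (hT.isChain Q hQ) hw
  -- `P'` and `Q'` are oriented to end at `v` and `w`, so the concatenation uses the edge between
  -- them.
  have h := hT.merge hP hQ (l := P' ++ Q'.reverse) ?_ ?_ ?_ ?_ ?_
  · have h1 := hmin _ h
    have h2 := Finset.card_insert_le (P' ++ Q'.reverse) ((T.erase P).erase Q)
    rw [Finset.card_erase_of_mem (Finset.mem_erase.2 ⟨hPQ.symm, hQ⟩),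
      Finset.card_erase_of_mem hP] at h2
    have h3 := Finset.one_lt_card.2 ⟨P, hP, Q, hQ, hPQ⟩
    omega
  · intro h
    rw [List.append_eq_nil_iff] at h
    rw [h.1] at hP'v
    simp at hP'v
  · rw [List.nodup_append']
    refine ⟨hPP'.nodup_iff.2 (hT.nodup P hP),
      List.nodup_reverse.2 (hQQ'.nodup_iff.2 (hT.nodup Q hQ)), ?_⟩
    intro x hx hx'
    exact hPQ (hT.disjoint P hP Q hQ x (hPP'.mem_iff.1 hx)
      (hQQ'.mem_iff.1 (List.mem_reverse.1 hx')))
  · rw [List.isChain_append]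
    refine ⟨hP'ch, ?_, ?_⟩
    · rw [List.isChain_reverse]
      exact hQ'ch.imp fun _ _ h => h.symm
    · intro x hx y hy
      rw [hP'v, Option.mem_def, Option.some_inj] at hx
      rw [List.head?_reverse, hQ'w, Option.mem_def, Option.some_inj] at hy
      rw [← hx, ← hy]
      exact hadj
  · rw [List.length_append, List.length_reverse, hPP'.length_eq, hQQ'.length_eq]
    omega
  · intro x
    rw [List.mem_append, List.mem_reverse, hPP'.mem_iff, hQQ'.mem_iff]

open Classical in
/-- The graph formed by the edges of a path. -/
theorem exists_pathGraph [Fintype V] {l : List V} (hne : l ≠ []) (hnd : l.Nodup)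
    (hch : l.IsChain H.Adj) : ∃ F : SimpleGraph V, F ≤ H ∧ (∀ v w, F.Adj v w → v ∈ l) ∧
      ∑ v ∈ l.toFinset, (nbrs F v).card + 2 = 2 * l.length ∧
      (∀ v ∈ l, (nbrs F v).card ≤ 1 → l.head? = some v ∨ l.getLast? = some v) ∧
      ∀ v ∈ l, ∀ w ∈ l, ∃ q : H.Walk v w, q.edges.IsChain (· ≠ ·) ∧
        (∀ e ∈ q.edges, e ∈ F.edgeSet) ∧ q.length < l.length := by
  set p := SimpleGraph.Walk.ofSupport l hne hch with hp
  have hsupp : p.support = l := SimpleGraph.Walk.support_ofSupport hne hch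
  have hpath : p.IsPath := by rw [SimpleGraph.Walk.isPath_def, hsupp]; exact hnd
  have hlen : p.length + 1 = l.length :=
    p.length_support.symm.trans (congrArg List.length hsupp)
  have hedge : ∀ e, e ∈ p.toSubgraph.spanningCoe.edgeSet ↔ e ∈ p.edges := by
    intro e
    rw [SimpleGraph.Subgraph.edgeSet_spanningCoe, SimpleGraph.Walk.mem_edges_toSubgraph]
  refine ⟨p.toSubgraph.spanningCoe, SimpleGraph.Subgraph.spanningCoe_le _, ?_, ?_, ?_, ?_⟩
  · intro v w h
    rw [← hsupp, ← SimpleGraph.Walk.mem_verts_toSubgraph]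
    exact p.toSubgraph.edge_vert h
  · have h1 : ∑ v ∈ l.toFinset, (nbrs p.toSubgraph.spanningCoe v).card =
        ∑ v, (nbrs p.toSubgraph.spanningCoe v).card := by
      refine Finset.sum_subset (Finset.subset_univ _) fun v _ hv => ?_
      rw [Finset.card_eq_zero, Finset.eq_empty_iff_forall_notMem]
      intro w hw
      rw [mem_nbrs] at hw
      refine hv (List.mem_toFinset.2 ?_)
      rw [← hsupp, ← SimpleGraph.Walk.mem_verts_toSubgraph]
      exact p.toSubgraph.edge_vert hw
    have h2 : p.toSubgraph.spanningCoe.edgeSet = (p.edges.toFinset : Set (Sym2 V)) := by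
      ext e
      rw [hedge]
      simp
    rw [h1, sum_card_nbrs, h2, Set.ncard_coe_finset,
      List.toFinset_card_of_nodup hpath.isTrail.edges_nodup, SimpleGraph.Walk.length_edges]
    omega
  · intro v hv hcard
    by_contra hcon
    push Not at hcon
    obtain ⟨i, hi, rfl⟩ := List.getElem_of_mem hv
    have hi0 : i ≠ 0 := by
      rintro rfl
      exact hcon.1 (by rw [List.head?_eq_getElem?, List.getElem?_eq_getElem hi])
    have hil : i < p.length := by
      by_contra h
      refine hcon.2 ?_
      rw [List.getLast?_eq_getElem?, ← List.getElem?_eq_getElem hi]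
      congr 1
      omega
    have h2 := hpath.ncard_neighborSet_toSubgraph_internal_eq_two hi0 hil
    have h3 : p.getVert i = l[i] := by
      rw [SimpleGraph.Walk.getVert_eq_support_getElem p hil.le]
      simp only [hsupp]
    have h4 : p.toSubgraph.neighborSet (p.getVert i) =
        (nbrs p.toSubgraph.spanningCoe l[i] : Set V) := by
      rw [h3]
      ext w
      simp
    rw [h4, Set.ncard_coe_finset] at h2
    omega
  · intro v hv w hw
    rw [← hsupp] at hv hw
    obtain ⟨q, hq, hsub, hql⟩ := exists_segment hv hw
    exact ⟨q, hq, fun e he => (hedge e).2 (hsub he), by rwa [hsupp] at hql⟩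

open Classical in
/-- The number of paths in a partition with the minimal number of paths of a graph with maximum
degree two and large girth. -/
theorem PathPartition.two_mul_card_le [Fintype V] {W : Finset V} {m g : ℕ} {T : Finset (List V)}
    (hT : PathPartition H W m T) (hmin : ∀ T', PathPartition H W m T' → T.card ≤ T'.card)
    (hg : (g : ℕ∞) ≤ H.egirth) (hmg : m < g) (hHW : ∀ v w, H.Adj v w → v ∈ W)
    {δ : V → ℕ} (hδ : ∀ v ∈ W, (nbrs H v).card + δ v = 2) :
    (m + 1) * (2 * T.card) ≤ 4 * Fintype.card V + (m + 1) * ∑ v ∈ W, δ v := by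
  choose! F hFH hFl hFsum hFend hFwalk using
    fun l (hl : l ∈ T) => exists_pathGraph (hT.ne_nil l hl) (hT.nodup l hl) (hT.isChain l hl)
  choose! Λ hΛT hΛ using fun v hv => (hT.cover v).1 hv
  have hΛeq : ∀ l ∈ T, ∀ v ∈ l, Λ v = l := by
    intro l hl v hv
    have hvW := (hT.cover v).2 ⟨l, hl, hv⟩
    exact hT.disjoint _ (hΛT v hvW) _ hl v (hΛ v hvW) hv
  have hWT : ∀ f : V → ℕ, ∑ v ∈ W, f v = ∑ l ∈ T, ∑ v ∈ l.toFinset, f v := by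
    intro f
    have hW : W = T.biUnion List.toFinset := by
      ext v; simp [hT.cover]
    rw [hW, Finset.sum_biUnion]
    intro l hl l' hl' hne
    rw [Function.onFun, Finset.disjoint_left]
    intro v hv hv'
    exact hne (hT.disjoint l hl l' hl' v (List.mem_toFinset.1 hv) (List.mem_toFinset.1 hv'))
  -- The neighbours of `v` along edges outside its path `Λ v`. A path with k vertices has degree sum
  -- 2k - 2, so for each path the missing degrees `E` and the deficiencies `δ` add up to 2.
  set E : V → Finset V := fun v => nbrs H v \ nbrs (F (Λ v)) v with hE
  have hEcard : ∀ v ∈ W, (E v).card + (nbrs (F (Λ v)) v).card + δ v = 2 := by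
    intro v hv
    rw [← hδ v hv, hE, Finset.card_sdiff_add_card_eq_card]
    intro w hw
    rw [mem_nbrs] at hw ⊢
    exact hFH _ (hΛT v hv) hw
  have hElist : ∀ l ∈ T, ∑ v ∈ l.toFinset, (E v).card + ∑ v ∈ l.toFinset, δ v = 2 := by
    intro l hl
    have h1 : ∑ v ∈ l.toFinset, ((E v).card + (nbrs (F l) v).card + δ v) = 2 * l.length := by
      rw [← List.toFinset_card_of_nodup (hT.nodup l hl), mul_comm, ← smul_eq_mul,
        ← Finset.sum_const]
      refine Finset.sum_congr rfl fun v hv => ?_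
      rw [List.mem_toFinset] at hv
      have := hEcard v ((hT.cover v).2 ⟨l, hl, hv⟩)
      rwa [hΛeq l hl v hv] at this
    have h2 := hFsum l hl
    rw [Finset.sum_add_distrib, Finset.sum_add_distrib] at h1
    omega
  have hEW : ∀ v ∈ W, ∀ w ∈ E v, w ∈ W ∧ v ∈ E w ∧ m + 1 ≤ (Λ v).length + (Λ w).length := by
    intro v hv w hw
    simp only [hE, Finset.mem_sdiff, mem_nbrs] at hw
    obtain ⟨hvw, hnF⟩ := hw
    have hwW := hHW w v hvw.symm
    -- An unused edge between vertices of one path would close a cycle of length at most m < g.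
    have hne : Λ v ≠ Λ w := by
      intro h
      obtain ⟨q, hq, hqF, hql⟩ := hFwalk (Λ v) (hΛT v hv) v (hΛ v hv) w (h ▸ hΛ w hwW)
      have hlm := hT.length_le _ (hΛT v hv)
      have h0 := length_eq_zero_of_isChain_edges hg
        (q.append (SimpleGraph.Walk.cons hvw.symm SimpleGraph.Walk.nil)) ?_ ?_
      · rw [SimpleGraph.Walk.length_append] at h0
        simp at h0
      · rw [SimpleGraph.Walk.edges_append, List.isChain_append]
        refine ⟨hq, by simp, ?_⟩
        intro e he e' he' heq
        have h1 := hqF e (List.mem_of_mem_getLast? he)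
        simp only [SimpleGraph.Walk.edges_cons, SimpleGraph.Walk.edges_nil, List.head?_cons,
          Option.mem_def, Option.some_inj] at he'
        rw [heq, ← he', SimpleGraph.mem_edgeSet] at h1
        exact hnF h1.symm
      · rw [SimpleGraph.Walk.length_append]
        simp only [SimpleGraph.Walk.length_cons, SimpleGraph.Walk.length_nil]
        omega
    have hnF' : ¬ (F (Λ w)).Adj w v := by
      intro h
      have := hFl _ (hΛT w hwW) v w h.symm
      exact hne (hΛeq _ (hΛT w hwW) v this)
    have hwE : v ∈ E w := by
      simp only [hE, Finset.mem_sdiff, mem_nbrs]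
      exact ⟨hvw.symm, hnF'⟩
    have hvE : w ∈ E v := by
      simp only [hE, Finset.mem_sdiff, mem_nbrs]
      exact ⟨hvw, hnF⟩
    have hdeg : ∀ x ∈ W, ∀ y ∈ E x, (nbrs (F (Λ x)) x).card ≤ 1 := by
      intro x hx y hy
      have h1 := hEcard x hx
      have h2 : 0 < (E x).card := Finset.card_pos.2 ⟨y, hy⟩
      omega
    exact ⟨hwW, hwE, hT.length_add_length hmin (hΛT v hv) (hΛT w hwW) hne
      (hFend _ (hΛT v hv) v (hΛ v hv) (hdeg v hv w hvE))
      (hFend _ (hΛT w hwW) w (hΛ w hwW) (hdeg w hwW v hwE)) hvw⟩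
  have hcount : ∑ v ∈ W, (E v).card + ∑ v ∈ W, δ v = 2 * T.card := by
    rw [hWT, hWT, ← Finset.sum_add_distrib, Finset.sum_congr rfl hElist, Finset.sum_const,
      smul_eq_mul, mul_comm]
  have hswap : ∑ v ∈ W, ∑ w ∈ E v, (Λ w).length = ∑ v ∈ W, ∑ w ∈ E v, (Λ v).length := by
    refine Finset.sum_comm' fun v w => ?_
    constructor
    · rintro ⟨hv, hw⟩
      obtain ⟨h1, h2, -⟩ := hEW v hv w hw
      exact ⟨h2, h1⟩
    · rintro ⟨hv, hw⟩
      obtain ⟨h1, h2, -⟩ := hEW w hw v hv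
      exact ⟨h1, h2⟩
  have hlength : ∑ v ∈ W, ∑ w ∈ E v, (Λ v).length ≤ 2 * Fintype.card V := by
    have hW : ∑ l ∈ T, l.length = W.card := by
      rw [Finset.card_eq_sum_ones, hWT]
      refine Finset.sum_congr rfl fun l hl => ?_
      rw [← Finset.card_eq_sum_ones, List.toFinset_card_of_nodup (hT.nodup l hl)]
    calc ∑ v ∈ W, ∑ w ∈ E v, (Λ v).length
        = ∑ l ∈ T, ∑ v ∈ l.toFinset, ∑ w ∈ E v, (Λ v).length := hWT _
      _ ≤ ∑ l ∈ T, 2 * l.length := by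
          refine Finset.sum_le_sum fun l hl => ?_
          rw [Finset.sum_congr rfl (g := fun v => (E v).card * l.length), ← Finset.sum_mul]
          · have := hElist l hl
            exact Nat.mul_le_mul_right _ (by omega)
          · intro v hv
            rw [hΛeq l hl v (List.mem_toFinset.1 hv), Finset.sum_const, smul_eq_mul]
      _ = 2 * W.card := by rw [← Finset.mul_sum, hW]
      _ ≤ 2 * Fintype.card V := Nat.mul_le_mul_left 2 (Finset.card_le_univ W)
  -- Each unused edge joins ends of paths with at least m + 1 vertices together, while each path is
  -- counted at most twice from each side of the symmetric sum.
  have hmain : (m + 1) * ∑ v ∈ W, (E v).card ≤ 4 * Fintype.card V := by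
    calc (m + 1) * ∑ v ∈ W, (E v).card
        = ∑ v ∈ W, ∑ w ∈ E v, (m + 1) := by
          rw [Finset.mul_sum]
          refine Finset.sum_congr rfl fun v _ => ?_
          rw [Finset.sum_const, smul_eq_mul, mul_comm]
      _ ≤ ∑ v ∈ W, ∑ w ∈ E v, ((Λ v).length + (Λ w).length) :=
          Finset.sum_le_sum fun v hv => Finset.sum_le_sum fun w hw => (hEW v hv w hw).2.2
      _ = ∑ v ∈ W, ∑ w ∈ E v, (Λ v).length + ∑ v ∈ W, ∑ w ∈ E v, (Λ w).length := by
          simp only [Finset.sum_add_distrib]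
      _ ≤ 4 * Fintype.card V := by rw [hswap]; omega
  rw [← hcount, mul_add]
  omega

end

end CubicDomination

/-! ### Construction of the path cover -/

namespace CubicDomination

section

variable {V : Type u} {G : SimpleGraph V}

/-- The path cover without paths. -/
def emptyPathCover (G : SimpleGraph V) : PathCover G where
  num := 0
  first := Fin.elim0
  last := Fin.elim0
  walk j := j.elim0
  isPath j := j.elim0
  disjoint j := j.elim0
  mate := id
  mate_covered j := j.elim0
  mate_mate j := j.elim0
  mate_adj j := j.elim0
  mate_edge j := j.elim0

/-- For g ≤ 2K not even a single vertex is an allowed path; the constant 2K then absorbs all n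
vertices as uncovered. -/
theorem emptyPathCover_admissible [Fintype V] {K g : ℕ} (hg0 : 0 < g) (hgK : g ≤ 2 * K) :
    (emptyPathCover G).Admissible K g (2 * K) := by
  classical
  have hg' : (0 : ℝ) < g := by exact_mod_cast hg0
  refine ⟨?_, fun j => j.elim0, ?_⟩
  · simp only [emptyPathCover, Nat.cast_zero]
    positivity
  · calc _ ≤ (Fintype.card V : ℝ) := by exact_mod_cast Finset.card_le_univ _
      _ = g * ((Fintype.card V : ℝ) / g) := by field_simp
      _ ≤ _ := by
        refine mul_le_mul_of_nonneg_right ?_ (by positivity)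
        exact_mod_cast hgK

/-- The edges of `G` between vertices outside `U` that do not join mates. -/
def remainingGraph (G : SimpleGraph V) {U : Finset V} {mate : V → V}
    (hmate : ∀ v ∉ U, mate v ∉ U ∧ mate (mate v) = v ∧ G.Adj v (mate v)) : SimpleGraph V where
  Adj v w := v ∉ U ∧ w ∉ U ∧ G.Adj v w ∧ w ≠ mate v
  symm := ⟨fun v w ⟨hv, hw, hadj, hne⟩ =>
    ⟨hw, hv, hadj.symm, fun h => hne (by rw [h, (hmate w hw).2.1])⟩⟩
  loopless := ⟨fun v h => G.irrefl h.2.2.1⟩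

variable {U : Finset V} {mate : V → V}
  (hmate : ∀ v ∉ U, mate v ∉ U ∧ mate (mate v) = v ∧ G.Adj v (mate v))

theorem remainingGraph_le : remainingGraph G hmate ≤ G := fun _ _ h => h.2.2.1

open Classical in
theorem card_nbrs_remainingGraph [Fintype V] (hreg : ∀ v, (nbrs G v).card = 3) {v : V} (hv : v ∉ U) :
    (nbrs (remainingGraph G hmate) v).card + (nbrs G v ∩ U).card = 2 := by
  obtain ⟨hmU, -, hadj⟩ := hmate v hv
  have h : nbrs G v = insert (mate v) (nbrs (remainingGraph G hmate) v ∪ (nbrs G v ∩ U)) := by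
    ext w
    simp only [mem_nbrs, Finset.mem_insert, Finset.mem_union, Finset.mem_inter, remainingGraph]
    by_cases h1 : w = mate v
    · simp [h1, hadj]
    · by_cases h2 : w ∈ U <;> simp [h1, h2, hv]
  have h3 := hreg v
  rw [h, Finset.card_insert_of_notMem, Finset.card_union_of_disjoint] at h3
  · omega
  · rw [Finset.disjoint_left]
    intro w hw hw'
    rw [mem_nbrs] at hw
    exact hw.2.1 (Finset.mem_inter.1 hw').2
  · simp only [mem_nbrs, Finset.mem_union, Finset.mem_inter, remainingGraph]
    tauto

/-- The path cover given by a near-perfect matching and a partition into paths of the graph of the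
remaining edges. -/
theorem exists_pathCover_of_partition {m : ℕ} {W : Finset V} (hW : ∀ v, v ∈ W ↔ v ∉ U)
    {T : Finset (List V)} (hT : PathPartition (remainingGraph G hmate) W m T) :
    ∃ P : PathCover G, P.num = T.card ∧ (∀ j, (P.walk j).support.length ≤ m) ∧
      ∀ v, P.Covered v ↔ v ∉ U := by
  let e := T.equivFin.symm
  let w : ∀ j : Fin T.card, (remainingGraph G hmate).Walk ((e j).1.head (hT.ne_nil _ (e j).2))
      ((e j).1.getLast (hT.ne_nil _ (e j).2)) := fun j =>
    SimpleGraph.Walk.ofSupport (e j).1 (hT.ne_nil _ (e j).2) (hT.isChain _ (e j).2)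
  have hw : ∀ j, ((w j).mapLe (remainingGraph_le hmate)).support = (e j).1 := by
    intro j
    rw [SimpleGraph.Walk.support_mapLe_eq_support]
    exact SimpleGraph.Walk.support_ofSupport _ _
  have hcov : ∀ v, v ∉ U ↔ ∃ j, v ∈ ((w j).mapLe (remainingGraph_le hmate)).support := by
    intro v
    rw [← hW, hT.cover]
    simp only [hw]
    constructor
    · rintro ⟨l, hl, hv⟩
      exact ⟨e.symm ⟨l, hl⟩, by simpa using hv⟩
    · rintro ⟨j, hj⟩
      exact ⟨_, (e j).2, hj⟩
  refine ⟨{ num := T.card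
            first := fun j => (e j).1.head (hT.ne_nil _ (e j).2)
            last := fun j => (e j).1.getLast (hT.ne_nil _ (e j).2)
            walk := fun j => (w j).mapLe (remainingGraph_le hmate)
            isPath := ?_
            disjoint := ?_
            mate := mate
            mate_covered := ?_
            mate_mate := ?_
            mate_adj := ?_
            mate_edge := ?_ }, rfl, ?_, ?_⟩
  · intro j
    rw [SimpleGraph.Walk.isPath_def, hw]
    exact hT.nodup _ (e j).2
  · intro i j v hi hj
    rw [hw] at hi hj
    exact e.injective (Subtype.ext (hT.disjoint _ (e i).2 _ (e j).2 v hi hj))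
  · intro j v hv
    exact (hcov _).1 (hmate v ((hcov v).2 ⟨j, hv⟩)).1
  · intro j v hv
    exact (hmate v ((hcov v).2 ⟨j, hv⟩)).2.1
  · intro j v hv
    exact (hmate v ((hcov v).2 ⟨j, hv⟩)).2.2
  · intro j v _ i hi
    rw [SimpleGraph.Walk.edges_mapLe_eq_edges] at hi
    exact ((w i).adj_of_mem_edges hi).2.2.2 rfl
  · intro j
    simp only [hw]
    exact hT.length_le _ (e j).2
  · intro v
    exact (hcov v).symm

theorem exists_admissible_pathCover [Fintype V] [DecidableRel G.Adj] {K g : ℕ} (hK : 0 < K) (hg0 : 0 < g)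
    (hG : G.IsRegularOfDegree 3) (hg : (g : ℕ∞) ≤ G.egirth) :
    ∃ P : PathCover G, P.Admissible K g (2 * K) := by
  classical
  by_cases hgK : g ≤ 2 * K
  · exact ⟨emptyPathCover G, emptyPathCover_admissible hg0 hgK⟩
  have hreg := card_nbrs_of_regular hG
  obtain ⟨U, mate, hU, hmate⟩ := exists_near_perfect_matching hg0 hg hreg
  -- The largest integer smaller than g/(2K), hence m + 1 ≥ g/(2K).
  set m := (g - 1) / (2 * K) with hm
  have hm1 : 1 ≤ m := by
    rw [hm, Nat.le_div_iff_mul_le (by positivity)]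
    omega
  have hm2 : 2 * K * m < g := by
    have := Nat.mul_div_le (g - 1) (2 * K)
    rw [← hm] at this
    omega
  have hm3 : g ≤ 2 * K * (m + 1) := by
    have := Nat.lt_mul_div_succ (g - 1) (show 0 < 2 * K by omega)
    rw [← hm] at this
    omega
  have hmg : m < g := by nlinarith
  obtain ⟨T, hT, hmin⟩ := exists_minimal_pathPartition (remainingGraph G hmate) Uᶜ hm1
  have hcount := hT.two_mul_card_le hmin
    (hg.trans (SimpleGraph.egirth_anti (remainingGraph_le hmate))) hmg
    (fun v w h => Finset.mem_compl.2 h.1)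
    (fun v hv => card_nbrs_remainingGraph hmate hreg (Finset.mem_compl.1 hv))
  have hδ : ∑ v ∈ Uᶜ, (nbrs G v ∩ U).card ≤ 3 * U.card := by
    rw [sum_card_nbrs_inter_comm, mul_comm, ← smul_eq_mul, ← Finset.sum_const]
    refine Finset.sum_le_sum fun v _ => ?_
    rw [← hreg v]
    exact Finset.card_le_card Finset.inter_subset_left
  -- From 2|T| ≤ 4n/(m+1) + 3|U|: the first term is at most 8Kn/g, the second at most 2n/g.
  have hnum : 2 * g * T.card ≤ (8 * K + 2) * Fintype.card V := by
    by_cases hle : 2 * T.card ≤ 3 * U.card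
    · have := Nat.mul_le_mul_left g hle
      nlinarith
    · obtain ⟨k, hk⟩ := Nat.exists_eq_add_of_lt (not_le.1 hle)
      have h1 : (m + 1) * (k + 1) ≤ 4 * Fintype.card V := by
        have := Nat.mul_le_mul_left (m + 1) hδ
        rw [hk] at hcount
        nlinarith
      have h2 : g * (k + 1) ≤ 2 * K * (4 * Fintype.card V) :=
        calc g * (k + 1) ≤ 2 * K * (m + 1) * (k + 1) := Nat.mul_le_mul_right _ hm3
          _ = 2 * K * ((m + 1) * (k + 1)) := by ring
          _ ≤ _ := Nat.mul_le_mul_left _ h1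
      calc 2 * g * T.card = g * (2 * T.card) := by ring
        _ = 3 * g * U.card + g * (k + 1) := by rw [hk]; ring
        _ ≤ 2 * Fintype.card V + 2 * K * (4 * Fintype.card V) := Nat.add_le_add hU h2
        _ = _ := by ring
  obtain ⟨P, hPnum, hPlen, hPcov⟩ :=
    exists_pathCover_of_partition hmate (fun v => Finset.mem_compl) hT
  have hg' : (0 : ℝ) < g := by exact_mod_cast hg0
  have hK' : (0 : ℝ) < K := by exact_mod_cast hK
  refine ⟨P, ?_, ?_, ?_⟩
  · rw [hPnum, div_mul_eq_mul_div, le_div_iff₀ (by positivity)]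
    have h1 : (2 * g * T.card : ℝ) ≤ (8 * K + 2) * Fintype.card V := by exact_mod_cast hnum
    have h2 : (0 : ℝ) ≤ Fintype.card V := Nat.cast_nonneg _
    nlinarith
  · intro j
    rw [lt_div_iff₀ (by positivity)]
    have h1 := Nat.mul_le_mul_left (2 * K) (hPlen j)
    have h2 : (P.walk j).support.length * (2 * K) < g := by rw [mul_comm]; omega
    exact_mod_cast h2
  · have h1 : Finset.univ.filter (fun v => ¬ P.Covered v) = U := by
      ext v
      simp [hPcov]
    rw [h1, ← mul_div_assoc, le_div_iff₀ hg']
    have h2 : (3 * g * U.card : ℝ) ≤ 2 * Fintype.card V := by exact_mod_cast hU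
    have h3 : (0 : ℝ) ≤ Fintype.card V := Nat.cast_nonneg _
    have h4 : (1 : ℝ) ≤ K := by exact_mod_cast hK
    have h5 : (0 : ℝ) ≤ g * U.card :=
      mul_nonneg (Nat.cast_nonneg _) (Nat.cast_nonneg _)
    nlinarith

end

end CubicDomination

theorem lemma3 (K : ℕ) (hK : 2 ≤ K) :
    (∃ c : ℝ, ∀ (V : Type u) [Fintype V] (G : SimpleGraph V) [DecidableRel G.Adj] (g : ℕ),
      0 < g → G.IsRegularOfDegree 3 → (g : ℕ∞) ≤ G.egirth →
      ∃ P : PathCover G, P.Admissible K g c) ∧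
    ∀ R : Finset Rule, UniquelyMatching R → Correct R → ∀ c : ℝ, ∃ B : ℝ,
      ∀ (V : Type u) [Fintype V] (G : SimpleGraph V) [DecidableRel G.Adj] (g : ℕ),
        0 < g → G.IsRegularOfDegree 3 → (g : ℕ∞) ≤ G.egirth →
        ∀ P : PathCover G, P.Admissible K g c →
          ((∀ ω, 0 ≤ P.outcomeProb R K ω) ∧ ∑ ω, P.outcomeProb R K ω = 1) ∧
          (∀ ω : P.Outcome K (maxLength R), IsDominating G (P.dominatingSet R ω)) ∧
          P.expectedSize R K ≤
            density R K * (Fintype.card V : ℝ) + B * ((Fintype.card V : ℝ) / (g : ℝ)) ∧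
          (NonWasteful R →
            |P.expectedSize R K - density R K * (Fintype.card V : ℝ)| ≤
              B * ((Fintype.card V : ℝ) / (g : ℝ))) := by
  -- The error constant consists of the share of the uncovered vertices and of 3 + 8K for the two
  -- ends of each path.
  refine ⟨⟨2 * K, fun V _ G _ g hg0 hG hg =>
    exists_admissible_pathCover (by omega) hg0 hG hg⟩, fun R hR hc c =>
    ⟨(1 + |density R K|) * c + (3 + 8 * K), fun V _ G _ g hg0 _ hg P hP => ?_⟩⟩
  have hbounds := P.expectedSize_bounds hR hc (by omega) hg0 hg hP
  exact ⟨⟨P.outcomeProb_nonneg hR, P.sum_outcomeProb hR (by omega)⟩,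
    fun ω => P.isDominating hR hc, hbounds⟩
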